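/- **Notation.** For $\lambda>-1/2$, $\lambda\neq0$, let $C_n^{\lambda}(x)=\frac{(2\lambda)_n}{n!}\,{}_2F_1\!\left(-n,\,n+2\lambda;\,\lambda+\tfrac12;\,\tfrac{1-x}{2}\right)$ be the Gegenbauer polynomials, and let $$S_n^{\lambda}(f)=\sum_{k=0}^n a_k^{\lambda}C_k^{\lambda},\qquad a_k^{\lambda}=\frac1{h_k^{\lambda}}\int_{-1}^1(1-x^2)^{\lambda-1/2}C_k^{\lambda}(x)f(x)\,dx,\qquad h_k^{\lambda}=\frac{\pi\,2^{1-2\lambda}\,\Gamma(k+2\lambda)}{\Gamma(\lambda)^2\,\Gamma(k+1)\,(k+\lambda)}.$$ For $\rho>1$ let $\mathcal E_\rho=\{(u+u^{-1})/2:\ u\in\mathbb C,\ |u|=\rho\}$ be the Bernstein ellipse, $L(\mathcal E_\rho)$ its circumference, and, for a function $f$ continuous on $\mathcal E_\rho$, let $M=\max_{z\in\mathcal E_\rho}|f(z)|$ and $$D_\lambda(\rho)=\frac{M\,L(\mathcal E_\rho)}{\pi\rho}\cdot\begin{cases}\dfrac{|\Gamma(\lambda)|\,\Gamma(1+\lambda)\,\Gamma(1-2\lambda)}{\Gamma(1-\lambda)}\left(1-\rho^{-2}\right)^{2\lambda-1},&-1/2<\lambda<0,\\[2mm]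 \dfrac1\lambda\left(1-\rho^{-2}\right)^{\lambda-1},&0<\lambda\le1,\\[2mm] \Gamma(\lambda)\left(1+\rho^{-2}\right)^{\lambda-1},&\lambda>1.\end{cases}$$ Let $\|\cdot\|_\infty$ be the maximum norm on $[-1,1]$. **Theorem 6.5 (spectral differentiation error).** Let $\lambda>-1/2$ with $\lambda\ne0$, and let $j\ge1$ be an integer. For $\rho>1$, $n\ge1$ and $c>0$, consider the statement that $$\bigl\|f^{(j)}-(S_n^{\lambda}(f))^{(j)}\bigr\|_\infty\ \le\ c\left[\frac{2^{1-j-2\lambda}\sqrt\pi\,D_\lambda(\rho)}{|\Gamma(\lambda)|\,\Gamma(\lambda+j+\frac12)\,\ln\rho}\right]\frac{n^{\lambda+2j}}{\rho^n}\tag{$*$}$$ holds for every complex-valued $f$ that is analytic in the open region bounded by $\mathcal E_\rho$ and continuous on the closure of that region. Then: 1. for every $\rho>1$ there is a constant $c=c(\lambda,j,\rho)>0$ such that $(*)$ holds for all $n\ge1$; 2. there is a constant $c=c(\lambda,j)>0$ such that $(*)$ holds for all $\rho>1$ and all $n\ge1$ with $n\ge(\lambda+2j)/\ln\rho$; 3.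 $c\simeq1$ for large $n$: for every $\rho>1$ and every $c>1$ there is $N=N(\lambda,j,\rho,c)$ such that $(*)$ holds for all $n\ge N$. -/

import Mathlib

open Real Set Filter Topology

noncomputable section

/-- The Gegenbauer polynomial `C_n^lam(x)`, through the Gauss hypergeometric function. -/
def gegenbauerC (lam : ℝ) (n : ℕ) (x : ℝ) : ℝ :=
  (ascPochhammer ℝ n).eval (2 * lam) / (n.factorial : ℝ) *
    ordinaryHypergeometric (-(n : ℝ)) ((n : ℝ) + 2 * lam) (lam + 1 / 2) ((1 - x) / 2)

/-- The Gegenbauer weight `(1 - x^2)^(lam - 1/2)` on `[-1, 1]`. -/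
def gegenbauerWeight (lam x : ℝ) : ℝ := (1 - x ^ 2) ^ (lam - 1 / 2)

/-- The normalization constant `h_n^lam`, the squared weighted norm of `C_n^lam`. -/
def gegenbauerH (lam : ℝ) (n : ℕ) : ℝ :=
  π * (2 : ℝ) ^ (1 - 2 * lam) * Gamma ((n : ℝ) + 2 * lam) /
    (Gamma lam ^ 2 * Gamma ((n : ℝ) + 1) * ((n : ℝ) + lam))

/-- The Gegenbauer coefficient `a_k^lam` of `f`. -/
def gegenbauerCoeff (lam : ℝ) (f : ℝ → ℂ) (k : ℕ) : ℂ :=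
  ((1 / gegenbauerH lam k : ℝ) : ℂ) *
    ∫ x in (-1 : ℝ)..1, ((gegenbauerWeight lam x * gegenbauerC lam k x : ℝ) : ℂ) * f x

/-- The Gegenbauer projection `S_n^lam(f)`. -/
def gegenbauerProj (lam : ℝ) (n : ℕ) (f : ℝ → ℂ) (x : ℝ) : ℂ :=
  ∑ k ∈ Finset.range (n + 1), gegenbauerCoeff lam f k * ((gegenbauerC lam k x : ℝ) : ℂ)

/-- The Bernstein ellipse `E_ρ`. -/
def bernsteinEllipse (ρ : ℝ) : Set ℂ :=
  {z | ∃ u : ℂ, ‖u‖ = ρ ∧ z = (u + u⁻¹) / 2}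

/-- The open region bounded by `E_ρ`: the points whose distances to the foci `±1` add up to
less than the length `ρ + ρ⁻¹` of the major axis. -/
def bernsteinRegion (ρ : ℝ) : Set ℂ :=
  {z | ‖z - 1‖ + ‖z + 1‖ < ρ + ρ⁻¹}

/-- The parametrization of `E_ρ` by `u = ρ e^{iθ}`. -/
def bernsteinParam (ρ θ : ℝ) : ℂ :=
  ((ρ : ℂ) * Complex.exp (θ * Complex.I) + ((ρ : ℂ) * Complex.exp (θ * Complex.I))⁻¹) / 2

/-- The circumference `L(E_ρ)`, as the arc length of the parametrization. -/
def bernsteinLength (ρ : ℝ) : ℝ :=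
  ∫ θ in (0 : ℝ)..(2 * π), ‖deriv (bernsteinParam ρ) θ‖

/-- `M`, the maximum of `|f|` over `E_ρ` (attained when `f` is continuous on `E_ρ`). -/
def bernsteinMax (ρ : ℝ) (f : ℂ → ℂ) : ℝ :=
  sSup ((fun z => ‖f z‖) '' bernsteinEllipse ρ)

/-- The quantity `D_lam(ρ)` attached to `f`. -/
def bernsteinD (lam ρ : ℝ) (f : ℂ → ℂ) : ℝ :=
  bernsteinMax ρ f * bernsteinLength ρ / (π * ρ) *
    (if lam < 0 then
      |Gamma lam| * Gamma (1 + lam) * Gamma (1 - 2 * lam) / Gamma (1 - lam) *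
        (1 - 1 / ρ ^ 2) ^ (2 * lam - 1)
    else if lam ≤ 1 then 1 / lam * (1 - 1 / ρ ^ 2) ^ (lam - 1)
    else Gamma lam * (1 + 1 / ρ ^ 2) ^ (lam - 1))

/-- The right-hand side of the differentiation error estimate, without the constant `c`. -/
def diffErrorRate (lam : ℝ) (j : ℕ) (ρ : ℝ) (f : ℂ → ℂ) (n : ℕ) : ℝ :=
  ((2 : ℝ) ^ (1 - (j : ℝ) - 2 * lam) * √π * bernsteinD lam ρ f /
      (|Gamma lam| * Gamma (lam + j + 1 / 2) * Real.log ρ)) *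
    ((n : ℝ) ^ (lam + 2 * j) / ρ ^ n)

/-- The estimate `‖f^(j) - (S_n^lam f)^(j)‖_∞ ≤ c * diffErrorRate`, in the maximum norm on
`[-1, 1]`, for given `n` and `c`, and for every `f` that is analytic in the region bounded by `E_ρ`
and continuous on its closure. The derivatives are those along the real axis. -/
def DiffErrorEstimate (lam : ℝ) (j : ℕ) (ρ : ℝ) (n : ℕ) (c : ℝ) : Prop :=
  ∀ f : ℂ → ℂ, DiffContOnCl ℂ f (bernsteinRegion ρ) →
    ∀ x ∈ Icc (-1 : ℝ) 1,
      ‖iteratedDeriv j (fun t : ℝ => f t) x -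
          iteratedDeriv j (gegenbauerProj lam n (fun t : ℝ => f t)) x‖ ≤
        c * diffErrorRate lam j ρ f n

end

/-! The argument expands `f` in Gegenbauer polynomials, bounds each coefficient, and sums the tail
of the differentiated series.

Coefficients. Put `f` on the ellipse in the form `f ∘ J` with `J(u) = (u + u⁻¹)/2`. Its Laurent
coefficients `t m` are even in `m` and can be computed on `|u| = ρ`, and `f = ∑ s m U_m` with `s m =
t m - t (m + 2)`. The coefficient of `C_k^lam` in `U_(k+2i)` is `k!/(lam)_k` times the `i`-th
coefficient of `₂F₁(k+1, 1-lam; k+lam+1; w)` (`chebyshevCoeff_add_two_mul`). Hence `a_k` is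
`k!/(lam)_k` times the mean over the circle of `f(J(u)) (1 - u⁻²) u⁻ᵏ ₂F₁(u⁻²)`. Since `|1 - u⁻²|`
is `2/ρ` times the arc length element of the ellipse, the circumference appears
(`norm_gegenbauerCoeff_le`).

Kernel. On `|w| = ρ⁻²` the function `₂F₁` is compared with a binomial series: `(1 - r)^(2 lam - 1)`
for `lam < 0`, `(1 - r)^(lam - 1)` for `0 < lam ≤ 1`, where `r = ρ⁻²`. For `lam > 1` it tends to `(1
- w)^(lam - 1)` as `k → ∞`, which is at most `(1 + r)^(lam - 1)` in modulus; there the bound costs a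
constant for all `k`, and a factor arbitrarily close to one for large `k`.

Differentiation. The `j`-th derivative of `C_k^lam` is `2^j (lam)_j C_(k-j)^(lam+j)`. Because `j ≥
1` gives `lam + j > 0`, this polynomial is largest in modulus at `x = 1`. By Euler's limit for `Γ`,
`k!/(lam)_k` times that maximum is asymptotic to a constant times `k^(lam+2j)`, and the duplication
formula puts the constant into the stated form.

Tail. `∑_{k>n} k^a ρ⁻ᵏ` with `a = lam + 2j` is asymptotic to `n^a ρ⁻ⁿ/(ρ - 1)`, and `1/(ρ - 1) <
1/log ρ`. This strict inequality lets `1/log ρ` serve for large `n`. A bound uniform in `ρ` needs `n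
≥ a/log ρ`, beyond which the power growth uses up at most half of the exponential decay. -/

noncomputable section

open MeasureTheory Polynomial

/-! ### Gegenbauer polynomials: derivative, differential equation, parity, maximum. -/

/-- The hypergeometric coefficients of the Gegenbauer polynomial, in powers of `(1 - x) / 2`. -/
def gegenbauerScalar (lam : ℝ) (n i : ℕ) : ℝ :=
  (ascPochhammer ℝ n).eval (2 * lam) / (n.factorial : ℝ) *
    ordinaryHypergeometricCoefficient (-(n : ℝ)) ((n : ℝ) + 2 * lam) (lam + 1 / 2) i

/-- The Gegenbauer polynomial in the variable `t = (1 - x) / 2`. -/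
def gegenbauerShifted (lam : ℝ) (n : ℕ) : ℝ[X] :=
  ∑ i ∈ Finset.range (n + 1), monomial i (gegenbauerScalar lam n i)

/-- The Gegenbauer polynomial as an element of `ℝ[X]`. -/
def gegenbauerPoly (lam : ℝ) (n : ℕ) : ℝ[X] :=
  (gegenbauerShifted lam n).comp (C (1 / 2) * (1 - X))

theorem ascPochhammer_eval_succ_left (a : ℝ) (n : ℕ) :
    (ascPochhammer ℝ (n + 1)).eval a = a * (ascPochhammer ℝ n).eval (a + 1) := by
  simp [ascPochhammer_succ_left, Polynomial.eval_comp]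

theorem ascPochhammer_eval_ne_zero_of_pos {a : ℝ} (ha : 0 < a) (n : ℕ) :
    (ascPochhammer ℝ n).eval a ≠ 0 :=
  (ascPochhammer_pos n a ha).ne'

theorem gegenbauerScalar_eq_zero (lam : ℝ) {n i : ℕ} (h : n < i) :
    gegenbauerScalar lam n i = 0 := by
  have : (ascPochhammer ℝ i).eval (-(n : ℝ)) = 0 :=
    (ascPochhammer_eval_eq_zero_iff i _).2 ⟨n, h, by simp⟩
  simp [gegenbauerScalar, ordinaryHypergeometricCoefficient, this]

theorem coeff_gegenbauerShifted (lam : ℝ) (n i : ℕ) :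
    (gegenbauerShifted lam n).coeff i = gegenbauerScalar lam n i := by
  simp only [gegenbauerShifted, Polynomial.finsetSum_coeff, Polynomial.coeff_monomial,
    Finset.sum_ite_eq', Finset.mem_range]
  split_ifs with h
  · rfl
  · exact (gegenbauerScalar_eq_zero lam (by omega)).symm

theorem gegenbauerC_eq_eval (lam : ℝ) (n : ℕ) (x : ℝ) :
    gegenbauerC lam n x = (gegenbauerPoly lam n).eval x := by
  have h : ordinaryHypergeometric (-(n : ℝ)) ((n : ℝ) + 2 * lam) (lam + 1 / 2) ((1 - x) / 2) =
      ∑ i ∈ Finset.range (n + 1), ordinaryHypergeometricCoefficient (-(n : ℝ))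
        ((n : ℝ) + 2 * lam) (lam + 1 / 2) i * ((1 - x) / 2) ^ i := by
    rw [ordinaryHypergeometric_eq_tsum]
    simp only [smul_eq_mul]
    refine tsum_eq_sum fun i hi => ?_
    have : (ascPochhammer ℝ i).eval (-(n : ℝ)) = 0 :=
      (ascPochhammer_eval_eq_zero_iff i _).2 ⟨n, by simpa using hi, by simp⟩
    simp [this]
  rw [gegenbauerC, h, gegenbauerPoly, gegenbauerShifted, Polynomial.eval_comp,
    Polynomial.eval_finsetSum, Finset.mul_sum]
  refine Finset.sum_congr rfl fun i _ => ?_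
  simp only [gegenbauerScalar, Polynomial.eval_monomial, Polynomial.eval_mul, Polynomial.eval_C,
    Polynomial.eval_sub, Polynomial.eval_one, Polynomial.eval_X]
  ring

theorem gegenbauerScalar_succ {lam : ℝ} (hlam : -1 / 2 < lam) (n i : ℕ) :
    ((i : ℝ) + 1) * (i + (lam + 1 / 2)) * gegenbauerScalar lam n (i + 1) =
      (i - n) * (i + n + 2 * lam) * gegenbauerScalar lam n i := by
  have h1 : (ascPochhammer ℝ i).eval (lam + 1 / 2) ≠ 0 :=
    ascPochhammer_eval_ne_zero_of_pos (by linarith) i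
  have h2 : lam + 1 / 2 + i ≠ 0 := by
    have : (0 : ℝ) ≤ i := by positivity
    linarith
  have h3 : (i : ℝ) + 1 ≠ 0 := by positivity
  have h4 : (i.factorial : ℝ) ≠ 0 := by positivity
  have h5 : (n.factorial : ℝ) ≠ 0 := by positivity
  simp only [gegenbauerScalar, ordinaryHypergeometricCoefficient, ascPochhammer_succ_eval,
    Nat.factorial_succ, Nat.cast_mul, Nat.cast_add, Nat.cast_one]
  rw [mul_inv, mul_inv]
  generalize (ascPochhammer ℝ i).eval (lam + 1 / 2) = p at *
  generalize hc : lam + 1 / 2 = c at *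
  obtain rfl : lam = c - 1 / 2 := by linarith
  field_simp
  ring

theorem gegenbauerScalar_shift {lam : ℝ} (hlam : -1 / 2 < lam) (n i : ℕ) :
    ((i : ℝ) + 1) * gegenbauerScalar lam (n + 1) (i + 1) =
      -(4 * lam) * gegenbauerScalar (lam + 1) n i := by
  have h1 : (ascPochhammer ℝ i).eval (lam + 1 + 1 / 2) ≠ 0 :=
    ascPochhammer_eval_ne_zero_of_pos (by linarith) i
  have h2 : lam + 1 / 2 ≠ 0 := by linarith
  have h3 : (i : ℝ) + 1 ≠ 0 := by positivity
  have h4 : (i.factorial : ℝ) ≠ 0 := by positivity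
  have h5 : (n.factorial : ℝ) ≠ 0 := by positivity
  have h6 : (n : ℝ) + 1 ≠ 0 := by positivity
  have h7 : (2 * lam + (n + 1 : ℕ)) * (ascPochhammer ℝ (n + 1)).eval (2 * lam) =
      2 * lam * (2 * lam + 1) * (ascPochhammer ℝ n).eval (2 * (lam + 1)) := by
    rw [mul_comm, ← ascPochhammer_succ_eval, ascPochhammer_eval_succ_left,
      ascPochhammer_eval_succ_left]
    ring_nf
  have e1 : -((n + 1 : ℕ) : ℝ) + 1 = -(n : ℝ) := by push_cast; ring
  have e2 : ((n + 1 : ℕ) : ℝ) + 2 * lam + 1 = n + 2 * (lam + 1) := by push_cast; ring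
  have e3 : lam + 1 / 2 + 1 = lam + 1 + 1 / 2 := by ring
  simp only [gegenbauerScalar, ordinaryHypergeometricCoefficient,
    ascPochhammer_eval_succ_left _ i, Nat.factorial_succ i, Nat.factorial_succ n, Nat.cast_mul,
    e1, e2, e3]
  push_cast at h7 ⊢
  generalize (ascPochhammer ℝ i).eval (lam + 1 + 1 / 2) = p at *
  generalize (ascPochhammer ℝ i).eval (-(n : ℝ)) = q at *
  generalize (ascPochhammer ℝ i).eval ((n : ℝ) + 2 * (lam + 1)) = r at *
  generalize (ascPochhammer ℝ (n + 1)).eval (2 * lam) = s at *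
  generalize (ascPochhammer ℝ n).eval (2 * (lam + 1)) = u at *
  have h8 : 2 * lam + 1 ≠ 0 := by linarith
  field_simp
  linear_combination (-2 : ℝ) * q * r * h7

theorem derivative_gegenbauerPoly_succ {lam : ℝ} (hlam : -1 / 2 < lam) (n : ℕ) :
    derivative (gegenbauerPoly lam (n + 1)) = C (2 * lam) * gegenbauerPoly (lam + 1) n := by
  have h : derivative (gegenbauerShifted lam (n + 1)) =
      C (-(4 * lam)) * gegenbauerShifted (lam + 1) n := by
    ext i
    rw [coeff_derivative, coeff_gegenbauerShifted, coeff_C_mul, coeff_gegenbauerShifted,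
      ← gegenbauerScalar_shift hlam]
    ring
  have e : (C (2 * lam) : ℝ[X]) = C (1 / 2) * (-1) * C (-(4 * lam)) := by
    rw [mul_right_comm, ← C_mul, mul_neg_one, ← C_neg]
    congr 1; ring
  rw [gegenbauerPoly, derivative_comp, h, gegenbauerPoly, mul_comp, C_comp, e]
  simp
  ring

theorem derivative_gegenbauerPoly_zero (lam : ℝ) : derivative (gegenbauerPoly lam 0) = 0 := by
  simp [gegenbauerPoly, gegenbauerShifted]

theorem gegenbauerPoly_zero (lam : ℝ) : gegenbauerPoly lam 0 = 1 := by
  simp [gegenbauerPoly, gegenbauerShifted, gegenbauerScalar, ordinaryHypergeometricCoefficient]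

/-- In the variable `t = (1 - x)/2` this is the hypergeometric equation, which read coefficientwise
is the two-term recurrence `gegenbauerScalar_succ`. The chain rule then carries it to `x`. -/
theorem gegenbauerPoly_ode {lam : ℝ} (hlam : -1 / 2 < lam) (n : ℕ) :
    (1 - X ^ 2) * derivative (derivative (gegenbauerPoly lam n)) -
      C (2 * lam + 1) * X * derivative (gegenbauerPoly lam n) +
      C (n * (n + 2 * lam)) * gegenbauerPoly lam n = 0 := by
  set G := gegenbauerShifted lam n with hG
  have h : (X - X ^ 2) * derivative (derivative G) +
      (C (lam + 1 / 2) - C (2 * lam + 1) * X) * derivative G + C (n * (n + 2 * lam)) * G = 0 := by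
    have e : (X - X ^ 2) * derivative (derivative G) +
      (C (lam + 1 / 2) - C (2 * lam + 1) * X) * derivative G + C (n * (n + 2 * lam)) * G =
      X * derivative (derivative G) - X * (X * derivative (derivative G)) +
      C (lam + 1 / 2) * derivative G - C (2 * lam + 1) * (X * derivative G) +
        C (n * (n + 2 * lam)) * G := by ring
    rw [e]
    ext i
    have key := gegenbauerScalar_succ hlam n i
    rcases i with _ | _ | i
    all_goals
      simp only [coeff_add, coeff_sub, coeff_C_mul, coeff_X_mul, coeff_X_mul_zero,
        coeff_derivative, hG, coeff_gegenbauerShifted, coeff_zero] at key ⊢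
      push_cast at key ⊢
      linear_combination key
  have hc := congrArg (fun p => p.comp (C (1 / 2) * (1 - X))) h
  have d : derivative (C (1 / 2 : ℝ) * (1 - X)) = -C (1 / 2) := by simp
  have d1 : derivative (gegenbauerPoly lam n) =
      -C (1 / 2) * (derivative G).comp (C (1 / 2) * (1 - X)) := by
    rw [gegenbauerPoly, derivative_comp, d]
  have d2 : derivative (derivative (gegenbauerPoly lam n)) =
      C (1 / 2) * C (1 / 2) * (derivative (derivative G)).comp (C (1 / 2) * (1 - X)) := by
    rw [d1, derivative_mul, derivative_comp, d]; simp; ring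
  simp only [add_comp, mul_comp, sub_comp, pow_comp, X_comp, C_comp, zero_comp] at hc
  have h2 : (2 : ℝ[X]) * C (1 / 2) = 1 := by
    rw [show (2 : ℝ[X]) = C 2 from rfl, ← C_mul]; norm_num
  have h3 : (C (2 * lam + 1) : ℝ[X]) = 2 * C (lam + 1 / 2) := by
    rw [show (2 : ℝ[X]) = C 2 from rfl, ← C_mul]; congr 1; ring
  rw [d2, d1]
  rw [gegenbauerPoly, ← hG]
  rw [h3] at hc ⊢
  generalize (C (1 / 2) : ℝ[X]) = a at *
  generalize (derivative (derivative G)).comp (a * (1 - X)) = G2 at *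
  generalize (derivative G).comp (a * (1 - X)) = G1 at *
  generalize G.comp (a * (1 - X)) = G0 at *
  linear_combination hc + (a * G2 * (1 - X) + C (lam + 1 / 2) * G1) * h2

theorem eval_one_gegenbauerPoly (lam : ℝ) (n : ℕ) :
    (gegenbauerPoly lam n).eval 1 = (ascPochhammer ℝ n).eval (2 * lam) / (n.factorial : ℝ) := by
  rw [gegenbauerPoly, eval_comp]
  simp [← coeff_zero_eq_eval_zero, coeff_gegenbauerShifted, gegenbauerScalar,
    ordinaryHypergeometricCoefficient]

theorem ascPochhammer_eval_two_mul_ne_zero {lam : ℝ} (hlam : -1 / 2 < lam) (hlam0 : lam ≠ 0)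
    (n : ℕ) : (ascPochhammer ℝ n).eval (2 * lam) ≠ 0 := by
  rcases n with _ | n
  · simp
  · rw [ascPochhammer_eval_succ_left]
    exact mul_ne_zero (by simpa) (ascPochhammer_eval_ne_zero_of_pos (by linarith) n)

theorem natCast_add_two_mul_pos {lam : ℝ} (hlam : -1 / 2 < lam) {n : ℕ} (hn : n ≠ 0) :
    0 < (n : ℝ) + 2 * lam := by
  have : (1 : ℝ) ≤ n := by exact_mod_cast Nat.one_le_iff_ne_zero.2 hn
  linarith

theorem gegenbauerScalar_self_ne_zero {lam : ℝ} (hlam : -1 / 2 < lam) (hlam0 : lam ≠ 0)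
    (n : ℕ) : gegenbauerScalar lam n n ≠ 0 := by
  rcases eq_or_ne n 0 with rfl | hn
  · simp [gegenbauerScalar, ordinaryHypergeometricCoefficient]
  have h1 := ascPochhammer_eval_two_mul_ne_zero hlam hlam0 n
  have h2 := ascPochhammer_eval_ne_zero_of_pos (natCast_add_two_mul_pos hlam hn) n
  have h3 := ascPochhammer_eval_ne_zero_of_pos (show 0 < lam + 1 / 2 by linarith) n
  have h4 : (ascPochhammer ℝ n).eval (-(n : ℝ)) ≠ 0 := by
    rw [Ne, ascPochhammer_eval_eq_zero_iff]
    rintro ⟨k, hk, h⟩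
    rw [neg_neg] at h
    exact hk.ne (by exact_mod_cast h)
  have h5 : (n.factorial : ℝ) ≠ 0 := by positivity
  simp only [gegenbauerScalar, ordinaryHypergeometricCoefficient]
  positivity

theorem degree_gegenbauerPoly {lam : ℝ} (hlam : -1 / 2 < lam) (hlam0 : lam ≠ 0) (n : ℕ) :
    (gegenbauerPoly lam n).degree = n := by
  have h1 : (gegenbauerShifted lam n).degree = n := by
    refine le_antisymm ?_ (le_degree_of_ne_zero ?_)
    · rw [degree_le_iff_coeff_zero]
      intro m hm
      rw [coeff_gegenbauerShifted]
      exact gegenbauerScalar_eq_zero lam (by exact_mod_cast hm)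
    · rw [coeff_gegenbauerShifted]
      exact gegenbauerScalar_self_ne_zero hlam hlam0 n
  have h2 : (C (1 / 2 : ℝ) * (1 - X)).natDegree = 1 := by
    have : (C (1 / 2 : ℝ) * (1 - X)) = C (-1 / 2) * X + C (1 / 2) := by
      rw [mul_sub, mul_one, neg_div, C_neg]; ring
    rw [this, natDegree_linear (by norm_num)]
  have h3 : (gegenbauerPoly lam n).natDegree = n := by
    rw [gegenbauerPoly, natDegree_comp, h2, mul_one, natDegree_eq_of_degree_eq_some h1]
  have h4 : gegenbauerPoly lam n ≠ 0 := by
    intro h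
    have := eval_one_gegenbauerPoly lam n
    rw [h, eval_zero, eq_comm, div_eq_zero_iff] at this
    rcases this with h | h
    · exact ascPochhammer_eval_two_mul_ne_zero hlam hlam0 n h
    · exact absurd h (by positivity)
  rw [degree_eq_natDegree h4, h3]

/-- Differentiation lowers `n` and raises `lam`, so by induction `y(-x)` and `(-1)^(n+1) y(x)` have
the same derivative and differ by a constant. Both solve the differential equation, whose zeroth
order coefficient `(n+1)(n+1+2 lam)` is nonzero, so the constant is zero. -/
theorem gegenbauerPoly_comp_neg {lam : ℝ} (hlam : -1 / 2 < lam) (n : ℕ) :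
    (gegenbauerPoly lam n).comp (-X) = (-1) ^ n * gegenbauerPoly lam n := by
  induction n generalizing lam with
  | zero => simp [gegenbauerPoly_zero]
  | succ n ih =>
    set y := gegenbauerPoly lam (n + 1) with hy
    have dy : derivative y = C (2 * lam) * gegenbauerPoly (lam + 1) n :=
      derivative_gegenbauerPoly_succ hlam n
    have h1 : derivative (y.comp (-X)) = (-1) ^ (n + 1) * derivative y := by
      rw [derivative_comp, dy, mul_comp, C_comp, ih (by linarith)]
      simp
      ring
    have h2 : derivative (y.comp (-X) - (-1) ^ (n + 1) * y) = 0 := by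
      rw [derivative_sub, h1]
      have : ((-1) ^ (n + 1) : ℝ[X]) = C ((-1) ^ (n + 1)) := by simp
      rw [this, derivative_C_mul, sub_self]
    have h3 : y.comp (-X) = (-1) ^ (n + 1) * y + C ((y.comp (-X) - (-1) ^ (n + 1) * y).coeff 0) := by
      rw [← eq_C_of_derivative_eq_zero h2]; ring
    generalize (y.comp (-X) - (-1) ^ (n + 1) * y).coeff 0 = c at h3
    have ode := gegenbauerPoly_ode hlam (n + 1)
    rw [← hy] at ode
    have e1 : (derivative y).comp (-X) = -((-1) ^ (n + 1) * derivative y) := by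
      rw [← h1, derivative_comp]; simp
    have e2 : (derivative (derivative y)).comp (-X) =
        (-1) ^ (n + 1) * derivative (derivative y) := by
      have h := congrArg derivative e1
      rw [derivative_comp, ← mul_neg, derivative_mul] at h
      have h0 : derivative ((-1) ^ (n + 1) : ℝ[X]) = 0 := by
        have : ((-1) ^ (n + 1) : ℝ[X]) = C ((-1) ^ (n + 1)) := by simp
        rw [this, derivative_C]
      rw [h0] at h
      simp at h
      linear_combination h
    have hc := congrArg (fun p => p.comp (-X)) ode
    simp only [add_comp, mul_comp, sub_comp, pow_comp, X_comp, C_comp, zero_comp, one_comp, e1, e2,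
      h3] at hc
    have h4 : C (((n + 1 : ℕ) : ℝ) * ((n + 1 : ℕ) + 2 * lam)) * C c = 0 := by
      linear_combination hc - (-1) ^ (n + 1) * ode
    rw [← C_mul, C_eq_zero, mul_eq_zero] at h4
    have h5 : c = 0 := by
      rcases h4 with h | h
      · exact absurd h (mul_pos (by positivity) (natCast_add_two_mul_pos hlam n.succ_ne_zero)).ne'
      · exact h
    rw [h3, h5, C_0, add_zero]

theorem eval_ode_gegenbauerPoly {lam : ℝ} (hlam : -1 / 2 < lam) (n : ℕ) (x : ℝ) :
    (1 - x ^ 2) * (derivative (derivative (gegenbauerPoly lam n))).eval x -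
      (2 * lam + 1) * x * (derivative (gegenbauerPoly lam n)).eval x +
      n * (n + 2 * lam) * (gegenbauerPoly lam n).eval x = 0 := by
  simpa using congrArg (eval x) (gegenbauerPoly_ode hlam n)

/-- Sonin's method. With `K = n(n + 2 lam)`, the function `φ = K y² + (1 - x²) y'²` has derivative
`4 lam x y'²` by the differential equation. For `lam ≥ 0` it therefore decreases on `[-1, 0]` and
increases on `[0, 1]`; at the endpoints it equals `K y²`, with the same value at both by parity. -/
theorem abs_eval_gegenbauerPoly_le {lam : ℝ} (hlam : 0 ≤ lam) (n : ℕ) {x : ℝ}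
    (hx : x ∈ Icc (-1 : ℝ) 1) :
    |(gegenbauerPoly lam n).eval x| ≤
      (ascPochhammer ℝ n).eval (2 * lam) / (n.factorial : ℝ) := by
  rcases eq_or_ne n 0 with rfl | hn
  · simp [gegenbauerPoly_zero]
  have hlam' : -1 / 2 < lam := by linarith
  have hK : 0 < (n : ℝ) * (n + 2 * lam) := by
    have : (0 : ℝ) < n := by exact_mod_cast Nat.pos_of_ne_zero hn
    exact mul_pos this (natCast_add_two_mul_pos hlam' hn)
  set K := (n : ℝ) * (n + 2 * lam)
  set y := gegenbauerPoly lam n with hy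
  set φ : ℝ[X] := C K * y ^ 2 + (1 - X ^ 2) * derivative y ^ 2 with hφ
  have hderiv : ∀ t : ℝ, (derivative φ).eval t = 4 * lam * t * (derivative y).eval t ^ 2 := by
    intro t
    have := eval_ode_gegenbauerPoly hlam' n t
    simp [hφ, derivative_pow]
    linear_combination (2 * eval t (derivative y)) * this
  have h1 : (y.eval (-1)) ^ 2 = (y.eval 1) ^ 2 := by
    have := congrArg (eval 1) (gegenbauerPoly_comp_neg hlam' n)
    rw [eval_comp] at this
    simp at this
    rw [hy, this, mul_pow, ← pow_mul, mul_comm n 2, pow_mul]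
    simp
  have h2 : K * y.eval x ^ 2 ≤ φ.eval x := by
    have : 0 ≤ (1 - x ^ 2) * (derivative y).eval x ^ 2 :=
      mul_nonneg (by nlinarith [hx.1, hx.2]) (sq_nonneg _)
    simp [hφ]; linarith
  have h3 : φ.eval x ≤ K * y.eval 1 ^ 2 := by
    rcases le_total 0 x with h | h
    · have hm : MonotoneOn (fun t => φ.eval t) (Icc 0 1) := by
        refine monotoneOn_of_deriv_nonneg (convex_Icc 0 1) φ.continuousOn
          φ.differentiable.differentiableOn fun t ht => ?_
        rw [interior_Icc] at ht
        rw [Polynomial.deriv, hderiv]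
        have := ht.1
        positivity
      have := hm ⟨h, hx.2⟩ (right_mem_Icc.2 zero_le_one) hx.2
      simpa [hφ] using this
    · have hm : AntitoneOn (fun t => φ.eval t) (Icc (-1) 0) := by
        refine antitoneOn_of_deriv_nonpos (convex_Icc (-1) 0) φ.continuousOn
          φ.differentiable.differentiableOn fun t ht => ?_
        rw [interior_Icc] at ht
        rw [Polynomial.deriv, hderiv]
        have : 0 ≤ 4 * lam * (-t) * eval t (derivative y) ^ 2 := by
          have : 0 ≤ -t := by linarith [ht.2]
          positivity
        linarith
      have := hm (left_mem_Icc.2 (by norm_num)) ⟨hx.1, h⟩ hx.1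
      rw [← h1]
      simpa [hφ] using this
  have h4 : y.eval x ^ 2 ≤ y.eval 1 ^ 2 := le_of_mul_le_mul_left (h2.trans h3) hK
  have h5 : 0 ≤ y.eval 1 := by
    rw [hy, eval_one_gegenbauerPoly]
    -- For `lam = 0` and `n ≠ 0` the value at `1` is zero, since `(0)_n = 0`.
    have h2n : 0 < 2 * lam ∨ 2 * lam = 0 := by
      rcases hlam.lt_or_eq with h | h
      · left; linarith
      · right; linarith
    rcases h2n with h | h
    · have := ascPochhammer_pos n _ h
      positivity
    · rw [h]
      simp [hn]
  rw [← eval_one_gegenbauerPoly, ← hy]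
  exact abs_le_of_sq_le_sq h4 h5

/-! ### The weight, its total mass, and the normalization constants. -/

theorem betaIntegrand_eq_ofReal (s : ℝ) {t : ℝ} (ht : t ∈ Icc (0 : ℝ) 1) :
    ((t : ℂ) ^ ((s : ℂ) - 1) * (1 - (t : ℂ)) ^ ((s : ℂ) - 1)) =
      (((t ^ (s - 1) * (1 - t) ^ (s - 1) : ℝ)) : ℂ) := by
  have h1 : (0 : ℝ) ≤ 1 - t := by linarith [ht.2]
  push_cast
  rw [Complex.ofReal_cpow ht.1, Complex.ofReal_cpow h1]
  push_cast
  rfl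

theorem gegenbauerWeight_two_mul_sub_one (lam : ℝ) {t : ℝ} (ht : t ∈ Icc (0 : ℝ) 1) :
    gegenbauerWeight lam (2 * t - 1) =
      4 ^ (lam - 1 / 2) * (t ^ (lam - 1 / 2) * (1 - t) ^ (lam - 1 / 2)) := by
  have h1 : (0 : ℝ) ≤ 1 - t := by linarith [ht.2]
  rw [gegenbauerWeight, ← mul_rpow ht.1 h1, ← mul_rpow (by norm_num) (mul_nonneg ht.1 h1)]
  congr 1; ring

theorem intervalIntegrable_gegenbauerWeight {lam : ℝ} (hlam : -1 / 2 < lam) :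
    IntervalIntegrable (gegenbauerWeight lam) volume (-1) 1 := by
  have hs : 0 < lam + 1 / 2 := by linarith
  have h0 := Complex.betaIntegral_convergent (u := ((lam + 1 / 2 : ℝ) : ℂ))
    (v := ((lam + 1 / 2 : ℝ) : ℂ)) (by simpa using hs) (by simpa using hs)
  have h1 : IntervalIntegrable (fun t : ℝ => t ^ (lam - 1 / 2) * (1 - t) ^ (lam - 1 / 2))
      volume 0 1 := by
    refine (intervalIntegrable_congr ?_).1 h0.norm
    intro t ht
    rw [uIoc_of_le zero_le_one] at ht
    have ht' : t ∈ Icc (0 : ℝ) 1 := ⟨ht.1.le, ht.2⟩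
    have h1 : (0 : ℝ) ≤ 1 - t := by linarith [ht.2]
    simp only [betaIntegrand_eq_ofReal _ ht', Complex.norm_real]
    rw [Real.norm_of_nonneg (by have := ht.1; positivity)]
    ring_nf
  have h2 : IntervalIntegrable (fun t : ℝ => gegenbauerWeight lam (2 * t - 1)) volume 0 1 := by
    refine (intervalIntegrable_congr ?_).1 (h1.const_mul (4 ^ (lam - 1 / 2)))
    intro t ht
    rw [uIoc_of_le zero_le_one] at ht
    exact (gegenbauerWeight_two_mul_sub_one lam ⟨ht.1.le, ht.2⟩).symm
  have h3 := (h2.comp_mul_left (c := 1 / 2)).comp_add_right 1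
  norm_num at h3
  refine (intervalIntegrable_congr ?_).1 h3
  intro t _
  simp only
  congr 1
  ring

/-- The substitution `x = 2t - 1` gives the beta integral `B(lam + 1/2, lam + 1/2)`; the duplication
formula for `Γ` brings it to the form of `h_0`. -/
theorem integral_gegenbauerWeight {lam : ℝ} (hlam : -1 / 2 < lam) (hlam0 : lam ≠ 0) :
    ∫ x in (-1 : ℝ)..1, gegenbauerWeight lam x = gegenbauerH lam 0 := by
  have hs : 0 < lam + 1 / 2 := by linarith
  have h1 : ∫ x in (-1 : ℝ)..1, gegenbauerWeight lam x =
      2 * ∫ t in (0 : ℝ)..1, gegenbauerWeight lam (2 * t - 1) := by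
    rw [intervalIntegral.integral_comp_mul_sub _ (two_ne_zero)]
    norm_num
    linarith
  have h2 : ∫ t in (0 : ℝ)..1, gegenbauerWeight lam (2 * t - 1) = 4 ^ (lam - 1 / 2) *
      ∫ t in (0 : ℝ)..1, (t ^ (lam - 1 / 2) * (1 - t) ^ (lam - 1 / 2)) := by
    rw [← intervalIntegral.integral_const_mul]
    refine intervalIntegral.integral_congr fun t ht => ?_
    rw [uIcc_of_le zero_le_one] at ht
    exact gegenbauerWeight_two_mul_sub_one lam ht
  have h3 : (((∫ t in (0 : ℝ)..1, (t ^ (lam - 1 / 2) * (1 - t) ^ (lam - 1 / 2)) : ℝ)) : ℂ) =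
      Complex.betaIntegral ((lam + 1 / 2 : ℝ) : ℂ) ((lam + 1 / 2 : ℝ) : ℂ) := by
    rw [Complex.betaIntegral, ← intervalIntegral.integral_ofReal]
    refine intervalIntegral.integral_congr fun t ht => ?_
    rw [uIcc_of_le zero_le_one] at ht
    simp only [betaIntegrand_eq_ofReal _ ht]
    ring_nf
  have h4 : Gamma (2 * lam + 1) * ∫ t in (0 : ℝ)..1, (t ^ (lam - 1 / 2) * (1 - t) ^ (lam - 1 / 2)) =
      Gamma (lam + 1 / 2) * Gamma (lam + 1 / 2) := by
    have := Complex.Gamma_mul_Gamma_eq_betaIntegral (s := ((lam + 1 / 2 : ℝ) : ℂ))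
      (t := ((lam + 1 / 2 : ℝ) : ℂ)) (by simpa using hs) (by simpa using hs)
    rw [← h3, ← Complex.ofReal_add, Complex.Gamma_ofReal, Complex.Gamma_ofReal] at this
    rw [show 2 * lam + 1 = lam + 1 / 2 + (lam + 1 / 2) by ring]
    exact_mod_cast this.symm
  have h5 : Gamma (2 * lam + 1) = 2 * lam * Gamma (2 * lam) := Gamma_add_one (by simpa using hlam0)
  have h6 : 0 < Gamma (2 * lam + 1) := Gamma_pos_of_pos (by linarith)
  have h7 : Gamma (2 * lam) ≠ 0 := by
    intro h
    rw [h5, h, mul_zero] at h6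
    exact h6.false
  have h8 : 0 < Gamma (lam + 1) := Gamma_pos_of_pos (by linarith)
  have h9 : Gamma lam ≠ 0 := by
    intro h
    rw [Gamma_add_one hlam0, h, mul_zero] at h8
    exact h8.false
  have h10 := Real.Gamma_mul_Gamma_add_half lam
  have e1 : (4 : ℝ) ^ (lam - 1 / 2) = 1 / 2 ^ (1 - 2 * lam) := by
    rw [show (4 : ℝ) = 2 ^ (2 : ℝ) by norm_num, eq_div_iff (by positivity),
      ← rpow_mul (by norm_num), ← rpow_add (by norm_num)]
    ring_nf
    simp
  have e2 : (0 : ℝ) < 2 ^ (1 - 2 * lam) := by positivity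
  rw [h1, h2, e1, gegenbauerH]
  have h11 : ∫ t in (0 : ℝ)..1, (t ^ (lam - 1 / 2) * (1 - t) ^ (lam - 1 / 2)) =
      Gamma (lam + 1 / 2) * Gamma (lam + 1 / 2) / Gamma (2 * lam + 1) := by
    rw [← h4, mul_div_cancel_left₀ _ h6.ne']
  have h12 : Gamma (lam + 1 / 2) = Gamma (2 * lam) * 2 ^ (1 - 2 * lam) * √π / Gamma lam := by
    rw [← h10]; field_simp
  rw [h11, h5, h12]
  have hpi : √π * √π = π := Real.mul_self_sqrt pi_pos.le
  simp only [Nat.cast_zero, zero_add, Gamma_one]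
  field_simp
  rw [pow_two √π, hpi]

theorem gegenbauerH_zero_ne_zero {lam : ℝ} (hlam : -1 / 2 < lam) (hlam0 : lam ≠ 0) :
    gegenbauerH lam 0 ≠ 0 := by
  have h5 : Gamma (2 * lam + 1) = 2 * lam * Gamma (2 * lam) := Gamma_add_one (by simpa using hlam0)
  have h6 : 0 < Gamma (2 * lam + 1) := Gamma_pos_of_pos (by linarith)
  have h7 : Gamma (2 * lam) ≠ 0 := by
    intro h
    rw [h5, h, mul_zero] at h6
    exact h6.false
  have h8 : 0 < Gamma (lam + 1) := Gamma_pos_of_pos (by linarith)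
  have h9 : Gamma lam ≠ 0 := by
    intro h
    rw [Gamma_add_one hlam0, h, mul_zero] at h8
    exact h8.false
  have := pi_pos
  simp only [gegenbauerH, Nat.cast_zero, zero_add, Gamma_one]
  positivity

theorem gegenbauerH_shift {lam : ℝ} (hlam : -1 / 2 < lam) (hlam0 : lam ≠ 0) (n : ℕ) :
    ((n : ℝ) + 1) * (n + 1 + 2 * lam) * gegenbauerH lam (n + 1) =
      4 * lam ^ 2 * gegenbauerH (lam + 1) n := by
  have h1 := natCast_add_two_mul_pos hlam n.succ_ne_zero
  push_cast at h1
  have h2 : (0 : ℝ) < n + 1 + lam := by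
    have : (0 : ℝ) ≤ n := by positivity
    linarith
  have e1 : Gamma ((n : ℝ) + 2 * (lam + 1)) = (n + 1 + 2 * lam) * Gamma (n + 1 + 2 * lam) := by
    rw [← Gamma_add_one h1.ne']; congr 1; ring
  have e2 : Gamma ((n : ℝ) + 1 + 1) = (n + 1) * Gamma (n + 1) :=
    Gamma_add_one (by positivity)
  have e3 : (2 : ℝ) ^ (1 - 2 * lam) = 4 * 2 ^ (1 - 2 * (lam + 1)) := by
    rw [show 1 - 2 * lam = 2 + (1 - 2 * (lam + 1)) by ring, rpow_add (by norm_num)]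
    norm_num
  have h3 : 0 < Gamma ((n : ℝ) + 1) := Gamma_pos_of_pos (by positivity)
  have h8 : 0 < Gamma (lam + 1) := Gamma_pos_of_pos (by linarith)
  have h9 : Gamma lam ≠ 0 := by
    intro h
    rw [Gamma_add_one hlam0, h, mul_zero] at h8
    exact h8.false
  simp only [gegenbauerH, Nat.cast_add, Nat.cast_one, e1, e2, e3, Gamma_add_one hlam0]
  have h4 : (n : ℝ) + (lam + 1) ≠ 0 := by linarith
  have h5 : (n : ℝ) + 1 ≠ 0 := by positivity
  rw [show (n : ℝ) + (lam + 1) = n + 1 + lam by ring]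
  field_simp

theorem gegenbauerWeight_add_one {lam : ℝ} (hlam : -1 / 2 < lam) {x : ℝ}
    (hx : x ∈ Icc (-1 : ℝ) 1) :
    gegenbauerWeight (lam + 1) x = (1 - x ^ 2) * gegenbauerWeight lam x := by
  have h0 : 0 ≤ 1 - x ^ 2 := by nlinarith [hx.1, hx.2]
  rw [gegenbauerWeight, gegenbauerWeight, show lam + 1 - 1 / 2 = (lam - 1 / 2) + 1 by ring,
    rpow_add_one' h0 (by linarith), mul_comm]

theorem intervalIntegrable_gegenbauerWeight_mul {lam : ℝ} (hlam : -1 / 2 < lam) {g : ℝ → ℂ}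
    (hg : ContinuousOn g (Icc (-1) 1)) :
    IntervalIntegrable (fun x => (gegenbauerWeight lam x : ℂ) * g x) volume (-1) 1 := by
  have h : IntervalIntegrable (fun x => (gegenbauerWeight lam x : ℂ)) volume (-1) 1 := by
    have h' := intervalIntegrable_gegenbauerWeight hlam
    exact ⟨h'.1.ofReal, h'.2.ofReal⟩
  exact h.mul_continuousOn (by rwa [uIcc_of_le (by norm_num)])

/-! ### Integration by parts and the effect of differentiation on coefficients. -/

/-- The integrand is the derivative of `(1 - x²)^(lam + 1/2) q`, which vanishes at `±1` because `lam
+ 1/2 > 0`. Both the index shift under differentiation and the symmetry of the Gegenbauer operator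
come from this identity. -/
theorem integral_gegenbauerWeight_mul_deriv {lam : ℝ} (hlam : -1 / 2 < lam) {q q' : ℝ → ℂ}
    (hq : ContinuousOn q (Icc (-1) 1)) (hd : ∀ x ∈ Ioo (-1 : ℝ) 1, HasDerivAt q (q' x) x)
    (hq' : ContinuousOn q' (Icc (-1) 1)) :
    ∫ x in (-1 : ℝ)..1, (gegenbauerWeight lam x : ℂ) *
      ((1 - (x : ℂ) ^ 2) * q' x - (2 * lam + 1) * x * q x) = 0 := by
  have hF : ContinuousOn (fun x : ℝ => (((1 - x ^ 2) ^ (lam + 1 / 2) : ℝ) : ℂ) * q x)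
      (Icc (-1) 1) := by
    refine ContinuousOn.mul (Continuous.continuousOn ?_) hq
    exact Complex.continuous_ofReal.comp
      (Continuous.rpow_const (by fun_prop) fun x => Or.inr (by linarith))
  have hF' : ∀ x ∈ Ioo (-1 : ℝ) 1,
      HasDerivAt (fun x : ℝ => (((1 - x ^ 2) ^ (lam + 1 / 2) : ℝ) : ℂ) * q x)
        ((gegenbauerWeight lam x : ℂ) *
          ((1 - (x : ℂ) ^ 2) * q' x - (2 * lam + 1) * x * q x)) x := by
    intro x hx
    have h0 : 0 < 1 - x ^ 2 := by nlinarith [hx.1, hx.2]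
    have h1 : HasDerivAt (fun x : ℝ => 1 - x ^ 2) (-(2 * x)) x := by
      simpa using ((hasDerivAt_id x).pow 2).const_sub 1
    have h2 := (h1.rpow_const (p := lam + 1 / 2) (Or.inl h0.ne')).ofReal_comp
    refine (h2.mul (hd x hx)).congr_deriv ?_
    have e : (1 - x ^ 2) ^ (lam + 1 / 2) = (1 - x ^ 2) * gegenbauerWeight lam x := by
      rw [← gegenbauerWeight_add_one hlam ⟨hx.1.le, hx.2.le⟩, gegenbauerWeight]
      congr 1; ring
    rw [e, show lam + 1 / 2 - 1 = lam - 1 / 2 by ring]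
    change ((-(2 * x) * (lam + 1 / 2) * gegenbauerWeight lam x : ℝ) : ℂ) * _ + _ = _
    push_cast
    ring
  rw [intervalIntegral.integral_eq_sub_of_hasDerivAt_of_le (by norm_num) hF hF']
  · have : lam + 1 / 2 ≠ 0 := by linarith
    norm_num [zero_rpow this]
  · refine intervalIntegrable_gegenbauerWeight_mul hlam ?_
    fun_prop

/-- The weighted integral of a function against the Gegenbauer polynomial. -/
def gegenbauerPairing (lam : ℝ) (k : ℕ) (f : ℝ → ℂ) : ℂ :=
  ∫ x in (-1 : ℝ)..1, ((gegenbauerWeight lam x * gegenbauerC lam k x : ℝ) : ℂ) * f x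

theorem gegenbauerCoeff_eq (lam : ℝ) (f : ℝ → ℂ) (k : ℕ) :
    gegenbauerCoeff lam f k = ((1 / gegenbauerH lam k : ℝ) : ℂ) * gegenbauerPairing lam k f := rfl

theorem gegenbauerPairing_eq (lam : ℝ) (k : ℕ) (f : ℝ → ℂ) :
    gegenbauerPairing lam k f = ∫ x in (-1 : ℝ)..1, (gegenbauerWeight lam x : ℂ) *
      (((gegenbauerPoly lam k).eval x : ℝ) * f x) := by
  simp only [gegenbauerPairing, gegenbauerC_eq_eval, Complex.ofReal_mul, mul_assoc]

theorem hasDerivAt_ofReal_eval (p : ℝ[X]) (x : ℝ) :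
    HasDerivAt (fun x : ℝ => ((p.eval x : ℝ) : ℂ)) (((derivative p).eval x : ℝ) : ℂ) x :=
  (p.hasDerivAt x).ofReal_comp

theorem continuous_ofReal_eval (p : ℝ[X]) : Continuous (fun x : ℝ => ((p.eval x : ℝ) : ℂ)) :=
  Complex.continuous_ofReal.comp p.continuous

theorem intervalIntegrable_gegenbauerPairing {lam : ℝ} (hlam : -1 / 2 < lam) (k : ℕ) {f : ℝ → ℂ}
    (hf : ContinuousOn f (Icc (-1) 1)) :
    IntervalIntegrable (fun x => (gegenbauerWeight lam x : ℂ) *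
      (((gegenbauerPoly lam k).eval x : ℝ) * f x)) volume (-1) 1 :=
  intervalIntegrable_gegenbauerWeight_mul hlam ((continuous_ofReal_eval _).continuousOn.mul hf)

/-- Integration by parts with `q = C_n^(lam+1) f`. As `2 lam C_n^(lam+1)` is the derivative of
`C_(n+1)^lam`, the terms containing `f` undifferentiated combine by the differential equation into
`(n+1)(n+1+2 lam) C_(n+1)^lam f`. -/
theorem gegenbauerPairing_shift {lam : ℝ} (hlam : -1 / 2 < lam) (n : ℕ)
    {f f' : ℝ → ℂ} (hf : ContinuousOn f (Icc (-1) 1))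
    (hd : ∀ x ∈ Ioo (-1 : ℝ) 1, HasDerivAt f (f' x) x) (hf' : ContinuousOn f' (Icc (-1) 1)) :
    2 * lam * gegenbauerPairing (lam + 1) n f' =
      (n + 1) * (n + 1 + 2 * lam) * gegenbauerPairing lam (n + 1) f := by
  have hC := continuous_ofReal_eval (gegenbauerPoly (lam + 1) n)
  have hC' := continuous_ofReal_eval (derivative (gegenbauerPoly (lam + 1) n))
  have key := integral_gegenbauerWeight_mul_deriv hlam
    (q := fun x => ((gegenbauerPoly (lam + 1) n).eval x : ℝ) * f x) (hC.continuousOn.mul hf)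
    (fun x hx => (hasDerivAt_ofReal_eval _ x).mul (hd x hx))
    ((hC'.continuousOn.mul hf).add (hC.continuousOn.mul hf'))
  have h1 : 2 * lam * gegenbauerPairing (lam + 1) n f' -
      (n + 1) * (n + 1 + 2 * lam) * gegenbauerPairing lam (n + 1) f = 2 * lam * 0 := by
    rw [← key, gegenbauerPairing_eq, gegenbauerPairing_eq,
      ← intervalIntegral.integral_const_mul, ← intervalIntegral.integral_const_mul,
      ← intervalIntegral.integral_const_mul, ← intervalIntegral.integral_sub]
    · refine intervalIntegral.integral_congr fun x hx => ?_
      rw [uIcc_of_le (by norm_num)] at hx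
      have ode := eval_ode_gegenbauerPoly hlam (n + 1) x
      simp only [derivative_gegenbauerPoly_succ hlam, derivative_C_mul, eval_mul, eval_C] at ode
      have ode' := congrArg (fun t : ℝ => (t : ℂ)) ode
      simp only [gegenbauerWeight_add_one hlam hx]
      push_cast at ode' ⊢
      linear_combination (-gegenbauerWeight lam x * f x : ℂ) * ode'
    · exact (intervalIntegrable_gegenbauerPairing (by linarith) n hf').const_mul _
    · exact (intervalIntegrable_gegenbauerPairing hlam _ hf).const_mul _
  rw [mul_zero] at h1
  exact sub_eq_zero.1 h1

theorem gegenbauerCoeff_shift {lam : ℝ} (hlam : -1 / 2 < lam) (hlam0 : lam ≠ 0) (n : ℕ)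
    {f f' : ℝ → ℂ} (hf : ContinuousOn f (Icc (-1) 1))
    (hd : ∀ x ∈ Ioo (-1 : ℝ) 1, HasDerivAt f (f' x) x) (hf' : ContinuousOn f' (Icc (-1) 1)) :
    gegenbauerCoeff (lam + 1) f' n = 2 * lam * gegenbauerCoeff lam f (n + 1) := by
  have h1 := gegenbauerPairing_shift hlam n hf hd hf'
  have h2 := congrArg (fun t : ℝ => (t : ℂ)) (gegenbauerH_shift hlam hlam0 n)
  have hl : (lam : ℂ) ≠ 0 := by exact_mod_cast hlam0
  have hn : ((n : ℂ) + 1) * (n + 1 + 2 * lam) ≠ 0 := by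
    have h1 := natCast_add_two_mul_pos hlam n.succ_ne_zero
    have : (((n : ℝ) + 1) * (n + 1 + 2 * lam)) ≠ 0 := by
      push_cast at h1
      positivity
    exact_mod_cast this
  rw [gegenbauerCoeff_eq, gegenbauerCoeff_eq]
  push_cast at h2 ⊢
  generalize gegenbauerPairing (lam + 1) n f' = P at *
  generalize gegenbauerPairing lam (n + 1) f = Q at *
  generalize (gegenbauerH lam (n + 1) : ℂ) = H at *
  generalize (gegenbauerH (lam + 1) n : ℂ) = G at *
  have hP : P = (n + 1) * (n + 1 + 2 * lam) * Q / (2 * lam) := by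
    rw [← h1]; field_simp
  have hH : H = 4 * lam ^ 2 * G / ((n + 1) * (n + 1 + 2 * lam)) := by
    rw [← h2, mul_div_cancel_left₀ _ hn]
  rw [hP, hH]
  rcases eq_or_ne G 0 with rfl | hG
  · simp
  have hn1 := left_ne_zero_of_mul hn
  have hn2 := right_ne_zero_of_mul hn
  field_simp
  ring

/-! ### Linearity, series, and orthogonality of the coefficients. -/

theorem gegenbauerCoeff_add {lam : ℝ} (hlam : -1 / 2 < lam) (k : ℕ) {f g : ℝ → ℂ}
    (hf : ContinuousOn f (Icc (-1) 1)) (hg : ContinuousOn g (Icc (-1) 1)) :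
    gegenbauerCoeff lam (fun x => f x + g x) k =
      gegenbauerCoeff lam f k + gegenbauerCoeff lam g k := by
  rw [gegenbauerCoeff_eq, gegenbauerCoeff_eq, gegenbauerCoeff_eq, ← mul_add]
  congr 1
  rw [gegenbauerPairing_eq, gegenbauerPairing_eq, gegenbauerPairing_eq,
    ← intervalIntegral.integral_add (intervalIntegrable_gegenbauerPairing hlam k hf)
      (intervalIntegrable_gegenbauerPairing hlam k hg)]
  simp only [mul_add]

theorem gegenbauerCoeff_const_mul (lam : ℝ) (k : ℕ) (c : ℂ) (f : ℝ → ℂ) :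
    gegenbauerCoeff lam (fun x => c * f x) k = c * gegenbauerCoeff lam f k := by
  rw [gegenbauerCoeff_eq, gegenbauerCoeff_eq, gegenbauerPairing, gegenbauerPairing]
  simp only [mul_left_comm _ c, intervalIntegral.integral_const_mul]

theorem gegenbauerCoeff_linear_combination {lam : ℝ} (hlam : -1 / 2 < lam) (k : ℕ) (a b : ℝ)
    (p q : ℝ[X]) :
    gegenbauerCoeff lam (fun x => ((C a * p + C b * q).eval x : ℝ)) k =
      a * gegenbauerCoeff lam (fun x => (p.eval x : ℝ)) k +
        b * gegenbauerCoeff lam (fun x => (q.eval x : ℝ)) k := by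
  have h := gegenbauerCoeff_add hlam k (f := fun x => (a : ℂ) * ((p.eval x : ℝ) : ℂ))
    (g := fun x => (b : ℂ) * ((q.eval x : ℝ) : ℂ))
    (continuousOn_const.mul (continuous_ofReal_eval p).continuousOn)
    (continuousOn_const.mul (continuous_ofReal_eval q).continuousOn)
  rw [gegenbauerCoeff_const_mul, gegenbauerCoeff_const_mul] at h
  rw [← h]
  simp

/-- The Gegenbauer coefficient of a series of continuous functions that converges in `ℓ¹`. -/
theorem hasSum_gegenbauerCoeff {lam : ℝ} (hlam : -1 / 2 < lam) (k : ℕ) {g : ℕ → ℝ → ℂ}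
    {f : ℝ → ℂ} {B : ℕ → ℝ} (hg : ∀ m, ContinuousOn (g m) (Icc (-1) 1))
    (hB : ∀ m, ∀ x ∈ Icc (-1 : ℝ) 1, ‖g m x‖ ≤ B m) (hsum : Summable B)
    (hf : ∀ x ∈ Ioo (-1 : ℝ) 1, HasSum (fun m => g m x) (f x)) :
    HasSum (fun m => gegenbauerCoeff lam (g m) k) (gegenbauerCoeff lam f k) := by
  simp only [gegenbauerCoeff_eq, gegenbauerPairing_eq]
  refine HasSum.mul_left _ ?_
  set W : ℝ → ℂ := fun x => (gegenbauerWeight lam x : ℂ) * ((gegenbauerPoly lam k).eval x : ℝ)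
    with hW
  have hWi : IntervalIntegrable W volume (-1) 1 :=
    intervalIntegrable_gegenbauerWeight_mul hlam (continuous_ofReal_eval _).continuousOn
  have key : HasSum (fun m => ∫ x in (-1 : ℝ)..1, W x * g m x) (∫ x in (-1 : ℝ)..1, W x * f x) := by
    refine intervalIntegral.hasSum_integral_of_dominated_convergence
      (fun m x => ‖W x‖ * B m) (fun m => ?_) (fun m => ?_) ?_ ?_ ?_
    · exact IntervalIntegrable.aestronglyMeasurable_restrict_uIoc (hWi.mul_continuousOn (by
        rw [uIcc_of_le (by norm_num)]; exact hg m))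
    · refine Eventually.of_forall fun x hx => ?_
      rw [uIoc_of_le (by norm_num)] at hx
      rw [norm_mul]
      exact mul_le_mul_of_nonneg_left (hB m x ⟨hx.1.le, hx.2⟩) (norm_nonneg _)
    · exact Eventually.of_forall fun x _ => hsum.mul_left _
    · simp only [tsum_mul_left]
      exact hWi.norm.mul_const _
    -- Convergence is assumed only inside the interval, while the integral runs over `(-1, 1]`.
    · have h1 : ∀ᵐ x : ℝ, x ≠ 1 := by simp [ae_iff]
      filter_upwards [h1] with x hx hx'
      rw [uIoc_of_le (by norm_num)] at hx'
      exact (hf x ⟨hx'.1, lt_of_le_of_ne hx'.2 hx⟩).mul_left _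
  simpa only [hW, mul_assoc] using key

theorem gegenbauerCoeff_zero_one {lam : ℝ} (hlam : -1 / 2 < lam) (hlam0 : lam ≠ 0) :
    gegenbauerCoeff lam (fun _ => 1) 0 = 1 := by
  rw [gegenbauerCoeff_eq, gegenbauerPairing]
  simp only [gegenbauerC_eq_eval, gegenbauerPoly_zero, eval_one, mul_one,
    intervalIntegral.integral_ofReal, integral_gegenbauerWeight hlam hlam0]
  have := gegenbauerH_zero_ne_zero hlam hlam0
  rw [← Complex.ofReal_mul, one_div_mul_cancel this, Complex.ofReal_one]

theorem gegenbauerCoeff_zero_right (lam : ℝ) (k : ℕ) :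
    gegenbauerCoeff lam (fun _ => 0) k = 0 := by
  simpa using gegenbauerCoeff_const_mul lam k 0 (fun _ => 0)

theorem gegenbauerCoeff_shift_polynomial {lam : ℝ} (hlam : -1 / 2 < lam) (hlam0 : lam ≠ 0) (n : ℕ)
    (p : ℝ[X]) :
    gegenbauerCoeff lam (fun x => (p.eval x : ℝ)) (n + 1) =
      1 / (2 * lam) * gegenbauerCoeff (lam + 1) (fun x => ((derivative p).eval x : ℝ)) n := by
  have h := gegenbauerCoeff_shift hlam hlam0 n (continuous_ofReal_eval p).continuousOn
    (fun x _ => hasDerivAt_ofReal_eval p x) (continuous_ofReal_eval (derivative p)).continuousOn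
  have hl : (lam : ℂ) ≠ 0 := by exact_mod_cast hlam0
  rw [h]
  field_simp

/-- The Gegenbauer coefficient of index at least the degree of the polynomial. -/
theorem gegenbauerCoeff_polynomial {lam : ℝ} (hlam : -1 / 2 < lam) (hlam0 : lam ≠ 0) (k : ℕ)
    {p : ℝ[X]} (hp : p.natDegree ≤ k) :
    gegenbauerCoeff lam (fun x => (p.eval x : ℝ)) k =
      ((p.coeff k * k.factorial / (2 ^ k * (ascPochhammer ℝ k).eval lam) : ℝ) : ℂ) := by
  induction k generalizing lam p with
  | zero =>
    rw [natDegree_eq_zero.1 (Nat.le_zero.1 hp) |>.choose_spec.symm]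
    have := gegenbauerCoeff_const_mul lam 0 ((Classical.choose
      (natDegree_eq_zero.1 (Nat.le_zero.1 hp)) : ℝ) : ℂ) (fun _ => 1)
    rw [gegenbauerCoeff_zero_one hlam hlam0] at this
    simpa using this
  | succ k ih =>
    have hd : (derivative p).natDegree ≤ k := by
      have := natDegree_derivative_le p
      omega
    rw [gegenbauerCoeff_shift_polynomial hlam hlam0, ih (by linarith) (by linarith) hd,
      coeff_derivative, ascPochhammer_eval_succ_left, Nat.factorial_succ, pow_succ]
    have h1 : (ascPochhammer ℝ k).eval (lam + 1) ≠ 0 :=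
      ascPochhammer_eval_ne_zero_of_pos (by linarith) k
    have : (1 / (2 * (lam : ℂ))) = ((1 / (2 * lam) : ℝ) : ℂ) := by push_cast; rfl
    rw [this, ← Complex.ofReal_mul]
    congr 1
    push_cast
    field_simp

/-- Differentiation lowers both indices by one and raises `lam`, until one index is zero.
Orthogonality of `C_(m+1)^lam` to constants is `gegenbauerPairing_shift` for `f = 1`, `f' = 0`. -/
theorem gegenbauerCoeff_gegenbauerPoly {lam : ℝ} (hlam : -1 / 2 < lam) (hlam0 : lam ≠ 0)
    (k m : ℕ) :
    gegenbauerCoeff lam (fun x => ((gegenbauerPoly lam m).eval x : ℝ)) k = if k = m then 1 else 0 := by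
  induction k generalizing lam m with
  | zero =>
    rcases m with _ | m
    · simpa [gegenbauerPoly_zero] using gegenbauerCoeff_zero_one hlam hlam0
    · have h := gegenbauerPairing_shift hlam m (f := fun _ => 1) (f' := fun _ => 0)
        continuousOn_const (fun x _ => hasDerivAt_const x 1) continuousOn_const
      have hn : ((m : ℂ) + 1) * (m + 1 + 2 * lam) ≠ 0 := by
        have h1 := natCast_add_two_mul_pos hlam m.succ_ne_zero
        have : (((m : ℝ) + 1) * (m + 1 + 2 * lam)) ≠ 0 := by
          push_cast at h1
          positivity
        exact_mod_cast this
      have h0 : gegenbauerPairing lam (m + 1) (fun _ => 1) = 0 := by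
        have : gegenbauerPairing (lam + 1) m (fun _ => 0) = 0 := by simp [gegenbauerPairing]
        rw [this, mul_zero, eq_comm, mul_eq_zero] at h
        exact h.resolve_left hn
      have h1 : gegenbauerPairing lam 0 (fun x => ((gegenbauerPoly lam (m + 1)).eval x : ℝ)) =
          gegenbauerPairing lam (m + 1) (fun _ => 1) := by
        simp [gegenbauerPairing_eq, gegenbauerPoly_zero]
      rw [gegenbauerCoeff_eq, h1, h0]
      simp
  | succ k ih =>
    rw [gegenbauerCoeff_shift_polynomial hlam hlam0]
    have hl : (lam : ℂ) ≠ 0 := by exact_mod_cast hlam0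
    rcases m with _ | m
    · simp [gegenbauerPoly_zero, gegenbauerCoeff_zero_right]
    · simp only [derivative_gegenbauerPoly_succ hlam, eval_mul, eval_C, Complex.ofReal_mul,
        gegenbauerCoeff_const_mul, ih (show -1 / 2 < lam + 1 by linarith)
          (show lam + 1 ≠ 0 by linarith), Nat.add_right_cancel_iff]
      push_cast
      field_simp

/-! ### Connection coefficients from Chebyshev to Gegenbauer polynomials. -/

/-- The Gegenbauer differential operator is diagonal in the Gegenbauer polynomials. -/
theorem gegenbauerCoeff_operator {lam : ℝ} (hlam : -1 / 2 < lam) (k : ℕ) (p : ℝ[X]) :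
    gegenbauerCoeff lam (fun x => (((1 - X ^ 2) * derivative (derivative p) -
      C (2 * lam + 1) * X * derivative p).eval x : ℝ)) k =
      -(k * (k + 2 * lam)) * gegenbauerCoeff lam (fun x => (p.eval x : ℝ)) k := by
  rw [gegenbauerCoeff_eq, gegenbauerCoeff_eq, mul_left_comm]
  congr 1
  set y := gegenbauerPoly lam k with hy
  have key := integral_gegenbauerWeight_mul_deriv hlam
    (continuous_ofReal_eval (y * derivative p - derivative y * p)).continuousOn
    (fun x _ => hasDerivAt_ofReal_eval _ x) (continuous_ofReal_eval _).continuousOn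
  rw [← sub_eq_zero, gegenbauerPairing_eq, gegenbauerPairing_eq,
    ← intervalIntegral.integral_const_mul, ← intervalIntegral.integral_sub, ← key]
  -- With `q = y p' - y' p` the first-order terms cancel, and the equation for `y` replaces its
  -- second derivative: this is Green's identity.
  · refine intervalIntegral.integral_congr fun x hx => ?_
    have ode' := congrArg (fun t : ℝ => (t : ℂ)) (eval_ode_gegenbauerPoly hlam k x)
    rw [← hy] at ode' ⊢
    simp only [derivative_sub, derivative_mul, eval_sub, eval_mul, eval_add, eval_one, eval_pow,
      eval_X, eval_C]
    push_cast at ode' ⊢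
    linear_combination (gegenbauerWeight lam x * (eval x p : ℝ) : ℂ) * ode'
  · exact intervalIntegrable_gegenbauerPairing hlam k (continuous_ofReal_eval _).continuousOn
  · exact (intervalIntegrable_gegenbauerPairing hlam k
      (continuous_ofReal_eval _).continuousOn).const_mul _

/-- The Gegenbauer coefficients of the Chebyshev polynomials of the second kind. -/
def chebyshevCoeff (lam : ℝ) (k : ℕ) (m : ℤ) : ℂ :=
  gegenbauerCoeff lam (fun x => ((Chebyshev.U ℝ m).eval x : ℝ)) k

/-- Since `U_(m+2) - U_m = 2 T_(m+2)`, the Chebyshev equation shows that the Gegenbauer operator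
maps this difference to a combination of `U_(m+2)` and `U_m` again. Taking the `k`-th coefficient,
on which the operator acts as the scalar `-k(k + 2 lam)`, yields a two-term recurrence in `m`. -/
theorem chebyshevCoeff_rec {lam : ℝ} (hlam : -1 / 2 < lam) (k : ℕ) (m : ℤ) :
    ((m : ℂ) + 2 - k) * (m + 2 + k + 2 * lam) * chebyshevCoeff lam k (m + 2) =
      (m + 2 + k) * (m + 2 - k - 2 * lam) * chebyshevCoeff lam k m := by
  set p : ℝ[X] := Chebyshev.U ℝ (m + 2) - Chebyshev.U ℝ m with hp
  have hpT : p = 2 * Chebyshev.T ℝ (m + 2) := (Chebyshev.two_mul_T_eq_U_sub_U ℝ m).symm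
  have h := gegenbauerCoeff_operator hlam k p
  have e : (1 - X ^ 2) * derivative (derivative p) - C (2 * lam + 1) * X * derivative p =
      C (-((m + 2) * (m + 2 + 2 * lam))) * Chebyshev.U ℝ (m + 2) +
        C ((m + 2) * (m + 2 - 2 * lam)) * Chebyshev.U ℝ m := by
    have h2 := Chebyshev.one_sub_X_sq_mul_derivative_derivative_T_eq_poly_in_T (R := ℝ) (m + 2)
    have h3 := Chebyshev.T_derivative_eq_U (R := ℝ) (m + 2)
    have h4 := Chebyshev.U_add_two ℝ m
    have h5 := Chebyshev.two_mul_T_eq_U_sub_U ℝ m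
    have e1 : m + 2 - 1 = m + 1 := by ring
    rw [hpT]
    rw [Function.iterate_succ, Function.iterate_one, Function.comp_apply] at h2
    rw [e1] at h3
    have d1 : derivative (2 * Chebyshev.T ℝ (m + 2)) = 2 * derivative (Chebyshev.T ℝ (m + 2)) := by
      simp
    rw [d1, show derivative (2 * derivative (Chebyshev.T ℝ (m + 2))) =
      2 * derivative (derivative (Chebyshev.T ℝ (m + 2))) by simp]
    have c0 : (C 2 : ℝ[X]) = 2 := rfl
    have c1 : (C (2 * lam + 1) : ℝ[X]) = 2 * C lam + 1 := by simp [c0]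
    have c2 : (C (-(((m : ℝ) + 2) * (m + 2 + 2 * lam))) : ℝ[X]) =
      -(((m : ℝ[X]) + 2) * (m + 2 + 2 * C lam)) := by simp [c0]
    have c3 : (C (((m : ℝ) + 2) * (m + 2 - 2 * lam)) : ℝ[X]) =
      (((m : ℝ[X]) + 2) * (m + 2 - 2 * C lam)) := by simp [c0]
    rw [c1, c2, c3]
    push_cast at h2 h3
    linear_combination 2 * h2 - 4 * C lam * X * h3 - ((m : ℝ[X]) + 2) ^ 2 * h5 +
      2 * C lam * ((m : ℝ[X]) + 2) * h4
  have hp' : p = C 1 * Chebyshev.U ℝ (m + 2) + C (-1) * Chebyshev.U ℝ m := by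
    rw [hp, C_neg, C_1]; ring
  rw [e, hp', gegenbauerCoeff_linear_combination hlam, gegenbauerCoeff_linear_combination hlam] at h
  rw [chebyshevCoeff, chebyshevCoeff]
  push_cast at h ⊢
  linear_combination -h

theorem chebyshevCoeff_of_lt {lam : ℝ} (hlam : -1 / 2 < lam) (hlam0 : lam ≠ 0) {k m : ℕ}
    (h : m < k) : chebyshevCoeff lam k m = 0 := by
  have hd := Chebyshev.natDegree_U_natCast ℝ m
  rw [chebyshevCoeff, gegenbauerCoeff_polynomial hlam hlam0 k (by omega),
    coeff_eq_zero_of_natDegree_lt (by omega)]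
  simp

theorem chebyshevCoeff_self {lam : ℝ} (hlam : -1 / 2 < lam) (hlam0 : lam ≠ 0) (k : ℕ) :
    chebyshevCoeff lam k k = ((k.factorial / (ascPochhammer ℝ k).eval lam : ℝ) : ℂ) := by
  have hd := Chebyshev.natDegree_U_natCast ℝ k
  have hl := Chebyshev.leadingCoeff_U_natCast ℝ k
  rw [leadingCoeff, hd] at hl
  rw [chebyshevCoeff, gegenbauerCoeff_polynomial hlam hlam0 k (by omega), hl]
  congr 1
  field_simp

/-- The coefficients of `₂F₁(k + 1, 1 - lam; k + lam + 1; w)`. -/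
def kernelCoeff (lam : ℝ) (k i : ℕ) : ℝ :=
  (ascPochhammer ℝ i).eval ((k : ℝ) + 1) * (ascPochhammer ℝ i).eval (1 - lam) /
    ((ascPochhammer ℝ i).eval ((k : ℝ) + lam + 1) * i.factorial)

theorem kernelCoeff_zero (lam : ℝ) (k : ℕ) : kernelCoeff lam k 0 = 1 := by simp [kernelCoeff]

theorem kernelCoeff_succ {lam : ℝ} (hlam : -1 / 2 < lam) (k i : ℕ) :
    ((k : ℝ) + lam + 1 + i) * (i + 1) * kernelCoeff lam k (i + 1) =
      (k + 1 + i) * (1 - lam + i) * kernelCoeff lam k i := by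
  have h0 : (0 : ℝ) < (k : ℝ) + lam + 1 := by
    have : (0 : ℝ) ≤ k := by positivity
    linarith
  have h1 := ascPochhammer_eval_ne_zero_of_pos h0 i
  have h2 : (k : ℝ) + lam + 1 + i ≠ 0 := by positivity
  have h3 : (i : ℝ) + 1 ≠ 0 := by positivity
  have h4 : (i.factorial : ℝ) ≠ 0 := by positivity
  simp only [kernelCoeff, ascPochhammer_succ_eval, Nat.factorial_succ, Nat.cast_mul, Nat.cast_add,
    Nat.cast_one]
  generalize (ascPochhammer ℝ i).eval ((k : ℝ) + lam + 1) = p at *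
  field_simp

/-- At `m = k + 2i` the factors on both sides of `chebyshevCoeff_rec` are four times those of
`kernelCoeff_succ`, and the starting value comes from the leading coefficient of `U_k`. -/
theorem chebyshevCoeff_add_two_mul {lam : ℝ} (hlam : -1 / 2 < lam) (hlam0 : lam ≠ 0) (k i : ℕ) :
    chebyshevCoeff lam k ((k + 2 * i : ℕ) : ℤ) =
      ((k.factorial / (ascPochhammer ℝ k).eval lam * kernelCoeff lam k i : ℝ) : ℂ) := by
  induction i with
  | zero => simpa [kernelCoeff_zero] using chebyshevCoeff_self hlam hlam0 k
  | succ i ih =>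
    have h := chebyshevCoeff_rec hlam k ((k + 2 * i : ℕ) : ℤ)
    have e : ((k + 2 * i : ℕ) : ℤ) + 2 = ((k + 2 * (i + 1) : ℕ) : ℤ) := by push_cast; ring
    rw [e, ih] at h
    have hk := congrArg (fun t : ℝ => (t : ℂ)) (kernelCoeff_succ hlam k i)
    have hne : (((k : ℝ) + lam + 1 + i) * (i + 1) : ℝ) ≠ 0 := by
      have : (0 : ℝ) ≤ k := by positivity
      have : (0 : ℝ) ≤ i := by positivity
      have : (0 : ℝ) < (k : ℝ) + lam + 1 + i := by linarith
      positivity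
    have hne' : (((k : ℂ) + lam + 1 + i) * (i + 1)) ≠ 0 := by exact_mod_cast hne
    refine mul_left_cancel₀ hne' ?_
    push_cast at h hk ⊢
    generalize (k.factorial : ℂ) / ((ascPochhammer ℝ k).eval lam : ℝ) = c at *
    linear_combination h / 4 - c * hk

theorem chebyshevCoeff_add_two_mul_add_one {lam : ℝ} (hlam : -1 / 2 < lam) (hlam0 : lam ≠ 0)
    (k i : ℕ) : chebyshevCoeff lam k ((k + 2 * i + 1 : ℕ) : ℤ) = 0 := by
  have hstep : ∀ i : ℕ, chebyshevCoeff lam k ((k : ℤ) + 2 * i - 1) = 0 →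
      chebyshevCoeff lam k ((k + 2 * i + 1 : ℕ) : ℤ) = 0 := by
    intro i hi
    have h := chebyshevCoeff_rec hlam k ((k : ℤ) + 2 * i - 1)
    rw [hi, mul_zero, show ((k : ℤ) + 2 * i - 1) + 2 = ((k + 2 * i + 1 : ℕ) : ℤ) by
      push_cast; ring, mul_eq_zero] at h
    refine h.resolve_left ?_
    have hne : ((2 * i + 1) * (2 * k + 2 * i + 1 + 2 * lam) : ℝ) ≠ 0 := by
      have : (0 : ℝ) ≤ k := by positivity
      have : (0 : ℝ) ≤ i := by positivity
      have : (0 : ℝ) < 2 * k + 2 * i + 1 + 2 * lam := by linarith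
      positivity
    have hne' : ((2 * i + 1) * (2 * k + 2 * i + 1 + 2 * lam) : ℂ) ≠ 0 := by exact_mod_cast hne
    convert hne' using 1
    push_cast
    ring_nf
  induction i with
  | zero =>
    refine hstep 0 ?_
    -- The recurrence starts at `m = k - 1`: for `k = 0` this is `U_(-1) = 0`, otherwise the degree
    -- is below `k`.
    rcases k with _ | k
    · simp [chebyshevCoeff, gegenbauerCoeff_zero_right]
    · have := chebyshevCoeff_of_lt hlam hlam0 k.lt_succ_self
      convert this using 2
      push_cast; ring
  | succ i ih =>
    refine hstep (i + 1) ?_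
    convert ih using 2
    push_cast; ring

theorem abs_eval_chebyshev_U_le (m : ℕ) {x : ℝ} (hx : x ∈ Icc (-1 : ℝ) 1) :
    |(Chebyshev.U ℝ m).eval x| ≤ m + 1 := by
  induction m with
  | zero => simp
  | succ m ih =>
    have h := congrArg (eval x) (Chebyshev.U_eq_X_mul_U_add_T ℝ m)
    simp only [eval_add, eval_mul, eval_X] at h
    have hx' : |x| ≤ 1 := abs_le.2 hx
    have hT := Chebyshev.abs_eval_T_real_le_one (m + 1) hx'
    push_cast
    rw [h]
    calc _ ≤ |x * (Chebyshev.U ℝ m).eval x| + |(Chebyshev.T ℝ (m + 1)).eval x| := abs_add_le _ _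
      _ ≤ 1 * (m + 1) + 1 := by
        rw [abs_mul]
        gcongr
      _ = _ := by ring

/-- The Gegenbauer coefficients of a series in the Chebyshev polynomials of the second kind. -/
theorem hasSum_gegenbauerCoeff_chebyshev {lam : ℝ} (hlam : -1 / 2 < lam) (hlam0 : lam ≠ 0) (k : ℕ)
    {s : ℕ → ℂ} {f : ℝ → ℂ} (hs : Summable fun m : ℕ => ‖s m‖ * (m + 1))
    (hf : ∀ x ∈ Ioo (-1 : ℝ) 1,
      HasSum (fun m : ℕ => s m * (((Chebyshev.U ℝ m).eval x : ℝ) : ℂ)) (f x)) :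
    HasSum (fun i : ℕ => ((k.factorial / (ascPochhammer ℝ k).eval lam * kernelCoeff lam k i : ℝ) : ℂ)
      * s (k + 2 * i)) (gegenbauerCoeff lam f k) := by
  have h := hasSum_gegenbauerCoeff hlam k
    (g := fun m x => s m * (((Chebyshev.U ℝ m).eval x : ℝ) : ℂ)) (f := f)
    (B := fun m => ‖s m‖ * (m + 1))
    (fun m => continuousOn_const.mul (continuous_ofReal_eval _).continuousOn)
    (fun m x hx => by
      rw [norm_mul, Complex.norm_real]
      exact mul_le_mul_of_nonneg_left (abs_eval_chebyshev_U_le m hx) (norm_nonneg _)) hs hf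
  simp only [gegenbauerCoeff_const_mul] at h
  have hinj : Function.Injective (fun i : ℕ => k + 2 * i) := fun a b hab => by
    simp only at hab; omega
  rw [← hinj.hasSum_iff] at h
  · refine h.congr_fun fun i => ?_
    have := chebyshevCoeff_add_two_mul hlam hlam0 k i
    rw [chebyshevCoeff] at this
    rw [Function.comp_apply, this, mul_comm]
  · intro m hm
    have : chebyshevCoeff lam k m = 0 := by
      rcases lt_or_ge m k with h | h
      · exact chebyshevCoeff_of_lt hlam hlam0 h
      · obtain ⟨d, rfl⟩ := Nat.exists_eq_add_of_le h
        rcases Nat.even_or_odd' d with ⟨i, rfl | rfl⟩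
        · exact absurd ⟨i, rfl⟩ hm
        · exact chebyshevCoeff_add_two_mul_add_one hlam hlam0 k i
    rw [chebyshevCoeff] at this
    rw [this, mul_zero]

/-! ### The Joukowski map and the Bernstein ellipse. -/

/-- The Joukowski map. -/
def joukowski (u : ℂ) : ℂ := (u + u⁻¹) / 2

theorem joukowski_inv (u : ℂ) : joukowski u⁻¹ = joukowski u := by
  rw [joukowski, joukowski, inv_inv, add_comm]

theorem joukowski_exp_mul_I (θ : ℝ) : joukowski (Complex.exp (θ * Complex.I)) = (cos θ : ℝ) := by
  rw [joukowski, ← Complex.exp_neg, Complex.ofReal_cos, Complex.cos, neg_mul]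

/-- `J(u) ∓ 1 = (u ∓ 1)²/(2u)`, so the sum of the focal distances is a parallelogram sum. This
identifies images of circles with confocal ellipses. -/
theorem norm_joukowski_sub_add_norm_joukowski_add {u : ℂ} (hu : u ≠ 0) :
    ‖joukowski u - 1‖ + ‖joukowski u + 1‖ = ‖u‖ + ‖u‖⁻¹ := by
  have h1 : joukowski u - 1 = (u - 1) * (u - 1) / (2 * u) := by
    rw [joukowski]; field_simp; ring
  have h2 : joukowski u + 1 = (u + 1) * (u + 1) / (2 * u) := by
    rw [joukowski]; field_simp; ring
  have h3 := parallelogram_law_with_norm ℝ u 1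
  have h4 : ‖u‖ ≠ 0 := norm_ne_zero_iff.2 hu
  rw [norm_one] at h3
  rw [h1, h2, norm_div, norm_div, norm_mul, norm_mul, norm_mul, Complex.norm_ofNat]
  field_simp
  linear_combination h3

theorem isOpen_bernsteinRegion (ρ : ℝ) : IsOpen (bernsteinRegion ρ) :=
  isOpen_lt (by fun_prop) continuous_const

theorem joukowski_mem_bernsteinRegion {ρ : ℝ} {u : ℂ} (h1 : 1 ≤ ‖u‖) (h2 : ‖u‖ < ρ) :
    joukowski u ∈ bernsteinRegion ρ := by
  have h0 : 0 < ‖u‖ := by linarith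
  rw [bernsteinRegion, mem_ofPred_eq,
    norm_joukowski_sub_add_norm_joukowski_add (norm_pos_iff.1 h0)]
  have h3 : ρ + ρ⁻¹ - (‖u‖ + ‖u‖⁻¹) = (ρ - ‖u‖) * (ρ * ‖u‖ - 1) / (ρ * ‖u‖) := by
    have : ρ ≠ 0 := by linarith
    field_simp; ring
  have h4 : 1 < ρ * ‖u‖ := by nlinarith
  have h5 : 0 < (ρ - ‖u‖) * (ρ * ‖u‖ - 1) / (ρ * ‖u‖) :=
    div_pos (mul_pos (by linarith) (by linarith)) (by linarith)
  linarith

/-- The sum of the focal distances is convex and equals `2 < ρ + ρ⁻¹` at the origin, so `t z` lies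
in the open region for `0 < t < 1`; let `t → 1`. -/
theorem mem_closure_bernsteinRegion {ρ : ℝ} (hρ : 1 < ρ) {z : ℂ}
    (hz : ‖z - 1‖ + ‖z + 1‖ ≤ ρ + ρ⁻¹) : z ∈ closure (bernsteinRegion ρ) := by
  have hρ2 : 2 < ρ + ρ⁻¹ := by
    have : ρ + ρ⁻¹ - 2 = (ρ - 1) ^ 2 / ρ := by
      have : ρ ≠ 0 := by linarith
      field_simp; ring
    have : 0 < (ρ - 1) ^ 2 / ρ := div_pos (pow_pos (by linarith) 2) (by linarith)
    linarith
  have h1 : Tendsto (fun t : ℝ => (t : ℂ) * z) (𝓝[<] 1) (𝓝 z) := by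
    have : Continuous (fun t : ℝ => (t : ℂ) * z) := by fun_prop
    have h := this.tendsto 1
    simp only [Complex.ofReal_one, one_mul] at h
    exact h.mono_left nhdsWithin_le_nhds
  refine mem_closure_of_tendsto h1 ?_
  filter_upwards [Ioo_mem_nhdsLT (show (0 : ℝ) < 1 by norm_num)] with t ht
  have e1 : (t : ℂ) * z - 1 = t * (z - 1) + ((1 - t : ℝ) : ℂ) * (-1) := by push_cast; ring
  have e2 : (t : ℂ) * z + 1 = t * (z + 1) + ((1 - t : ℝ) : ℂ) * 1 := by push_cast; ring
  have h3 : ‖(t : ℂ) * z - 1‖ ≤ t * ‖z - 1‖ + (1 - t) := by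
    rw [e1]
    refine (norm_add_le _ _).trans_eq ?_
    rw [norm_mul, norm_mul, Complex.norm_real, Complex.norm_real, norm_neg, norm_one,
      norm_of_nonneg ht.1.le, norm_of_nonneg (by linarith [ht.2]), mul_one]
  have h4 : ‖(t : ℂ) * z + 1‖ ≤ t * ‖z + 1‖ + (1 - t) := by
    rw [e2]
    refine (norm_add_le _ _).trans_eq ?_
    rw [norm_mul, norm_mul, Complex.norm_real, Complex.norm_real, norm_one,
      norm_of_nonneg ht.1.le, norm_of_nonneg (by linarith [ht.2]), mul_one]
  rw [bernsteinRegion, mem_ofPred_eq]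
  have := ht.1
  have := ht.2
  nlinarith

theorem joukowski_mem_closure {ρ : ℝ} (hρ : 1 < ρ) {u : ℂ} (h1 : 1 ≤ ‖u‖) (h2 : ‖u‖ ≤ ρ) :
    joukowski u ∈ closure (bernsteinRegion ρ) := by
  rcases h2.lt_or_eq with h | h
  · exact subset_closure (joukowski_mem_bernsteinRegion h1 h)
  · refine mem_closure_bernsteinRegion hρ ?_
    rw [norm_joukowski_sub_add_norm_joukowski_add (norm_pos_iff.1 (by linarith)), h]

theorem ofReal_mem_bernsteinRegion {ρ : ℝ} (hρ : 1 < ρ) {x : ℝ} (hx : x ∈ Icc (-1 : ℝ) 1) :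
    (x : ℂ) ∈ bernsteinRegion ρ := by
  have h := joukowski_exp_mul_I (arccos x)
  rw [cos_arccos hx.1 hx.2] at h
  rw [← h]
  exact joukowski_mem_bernsteinRegion (by rw [Complex.norm_exp_ofReal_mul_I])
    (by rwa [Complex.norm_exp_ofReal_mul_I])

theorem continuousAt_joukowski {u : ℂ} (hu : u ≠ 0) : ContinuousAt joukowski u := by
  unfold joukowski
  fun_prop (disch := exact hu)

theorem differentiableAt_joukowski {u : ℂ} (hu : u ≠ 0) : DifferentiableAt ℂ joukowski u := by
  unfold joukowski
  fun_prop (disch := exact hu)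

theorem bernsteinEllipse_eq (ρ : ℝ) : bernsteinEllipse ρ = joukowski '' Metric.sphere 0 ρ := by
  ext z
  simp only [bernsteinEllipse, mem_ofPred_eq, mem_image, mem_sphere_zero_iff_norm, joukowski]
  exact ⟨fun ⟨u, hu, h⟩ => ⟨u, hu, h.symm⟩, fun ⟨u, hu, h⟩ => ⟨u, hu, h.symm⟩⟩

theorem norm_le_bernsteinMax {ρ : ℝ} (hρ : 1 < ρ) {f : ℂ → ℂ}
    (hf : DiffContOnCl ℂ f (bernsteinRegion ρ)) {u : ℂ} (hu : ‖u‖ = ρ) :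
    ‖f (joukowski u)‖ ≤ bernsteinMax ρ f := by
  have h1 : IsCompact (bernsteinEllipse ρ) := by
    rw [bernsteinEllipse_eq]
    refine (isCompact_sphere 0 ρ).image_of_continuousOn fun u hu => ?_
    rw [mem_sphere_zero_iff_norm] at hu
    exact (continuousAt_joukowski (norm_pos_iff.1 (by linarith))).continuousWithinAt
  have h2 : bernsteinEllipse ρ ⊆ closure (bernsteinRegion ρ) := by
    rw [bernsteinEllipse_eq]
    rintro _ ⟨u, hu, rfl⟩
    rw [mem_sphere_zero_iff_norm] at hu
    exact joukowski_mem_closure hρ (by linarith) hu.le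
  refine le_csSup (h1.bddAbove_image (hf.continuousOn.mono h2).norm) ⟨joukowski u, ?_, rfl⟩
  rw [bernsteinEllipse_eq]
  exact ⟨u, by simpa using hu, rfl⟩

theorem bernsteinMax_nonneg (ρ : ℝ) (f : ℂ → ℂ) : 0 ≤ bernsteinMax ρ f :=
  Real.sSup_nonneg (by rintro _ ⟨z, _, rfl⟩; exact norm_nonneg _)

theorem bernsteinParam_eq (ρ θ : ℝ) : bernsteinParam ρ θ = joukowski (circleMap 0 ρ θ) := by
  simp [bernsteinParam, joukowski, circleMap]

theorem hasDerivAt_bernsteinParam {ρ : ℝ} (hρ : 0 < ρ) (θ : ℝ) :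
    HasDerivAt (bernsteinParam ρ)
      (circleMap 0 ρ θ * Complex.I * (1 - (circleMap 0 ρ θ)⁻¹ ^ 2) / 2) θ := by
  have h0 : circleMap 0 ρ θ ≠ 0 := circleMap_ne_center hρ.ne'
  have h1 := hasDerivAt_circleMap 0 ρ θ
  have h2 := (h1.add (h1.inv h0)).div_const 2
  have e : bernsteinParam ρ = fun θ => (circleMap 0 ρ θ + (circleMap 0 ρ θ)⁻¹) / 2 := by
    ext θ; rw [bernsteinParam_eq, joukowski]
  rw [e]
  refine h2.congr_deriv ?_
  field_simp
  ring

theorem norm_deriv_bernsteinParam {ρ : ℝ} (hρ : 0 < ρ) (θ : ℝ) :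
    ‖deriv (bernsteinParam ρ) θ‖ = ρ / 2 * ‖1 - (circleMap 0 ρ θ)⁻¹ ^ 2‖ := by
  rw [(hasDerivAt_bernsteinParam hρ θ).deriv, norm_div, norm_mul, norm_mul, Complex.norm_I,
    norm_circleMap_zero, abs_of_pos hρ, Complex.norm_ofNat]
  ring

theorem continuous_comp_joukowski_circleMap {ρ : ℝ} (hρ : 1 < ρ) {f : ℂ → ℂ}
    (hf : DiffContOnCl ℂ f (bernsteinRegion ρ)) :
    Continuous fun θ => f (joukowski (circleMap 0 ρ θ)) := by
  have hn : ∀ θ, ‖circleMap 0 ρ θ‖ = ρ := fun θ => by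
    rw [norm_circleMap_zero, abs_of_pos (by linarith)]
  refine hf.continuousOn.comp_continuous (f := fun θ => joukowski (circleMap 0 ρ θ)) ?_ fun θ =>
    joukowski_mem_closure hρ (by rw [hn]; exact hρ.le) (hn θ).le
  refine continuous_iff_continuousAt.2 fun θ => ?_
  exact (continuousAt_joukowski (circleMap_ne_center (by linarith))).comp
    (continuous_circleMap 0 ρ).continuousAt

/-! ### Laurent coefficients and the expansion in Chebyshev polynomials. -/

/-- The Laurent coefficients of `f ∘ joukowski`, computed on the circle of radius `r`. -/
def joukowskiLaurent (f : ℂ → ℂ) (r : ℝ) (m : ℤ) : ℂ :=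
  (2 * π : ℂ)⁻¹ * ∫ θ in (0 : ℝ)..2 * π, (circleMap 0 r θ) ^ (-m) * f (joukowski (circleMap 0 r θ))

/-- Cauchy's theorem on the annulus `1 ≤ |u| ≤ ρ`, which `J` maps into the closed elliptical region,
with the open annulus mapped into the open one. -/
theorem joukowskiLaurent_eq {ρ : ℝ} (hρ : 1 < ρ) {f : ℂ → ℂ}
    (hf : DiffContOnCl ℂ f (bernsteinRegion ρ)) (m : ℤ) :
    joukowskiLaurent f 1 m = joukowskiLaurent f ρ m := by
  have key : ∀ r : ℝ, 0 < r → joukowskiLaurent f r m =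
      (2 * π * Complex.I : ℂ)⁻¹ * ∮ u in C(0, r), u ^ (-m - 1) * f (joukowski u) := by
    intro r hr
    rw [joukowskiLaurent, circleIntegral, mul_inv _ Complex.I, mul_assoc,
      ← intervalIntegral.integral_const_mul Complex.I⁻¹]
    congr 1
    refine intervalIntegral.integral_congr fun θ _ => ?_
    have h0 : circleMap 0 r θ ≠ 0 := circleMap_ne_center hr.ne'
    simp only [deriv_circleMap, smul_eq_mul, zpow_sub₀ h0, zpow_one]
    have := Complex.I_ne_zero
    field_simp
  rw [key 1 one_pos, key ρ (by linarith)]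
  congr 1
  symm
  refine Complex.circleIntegral_eq_of_differentiable_on_annulus_off_countable one_pos hρ.le
    countable_empty ?_ ?_
  · intro u hu
    have h1 : 1 ≤ ‖u‖ := by simpa using hu.2
    have h2 : ‖u‖ ≤ ρ := by simpa using hu.1
    have h0 : u ≠ 0 := norm_pos_iff.1 (by linarith)
    refine ContinuousWithinAt.mul (continuousAt_zpow₀ u _ (Or.inl h0)).continuousWithinAt ?_
    refine (hf.continuousOn _ (joukowski_mem_closure hρ h1 h2)).comp
      (continuousAt_joukowski h0).continuousWithinAt ?_
    intro v hv
    exact joukowski_mem_closure hρ (by simpa using hv.2) (by simpa using hv.1)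
  · intro u hu
    have h1 : 1 < ‖u‖ := by simpa using hu.1.2
    have h2 : ‖u‖ < ρ := by simpa using hu.1.1
    have h0 : u ≠ 0 := norm_pos_iff.1 (by linarith)
    refine DifferentiableAt.mul (differentiableAt_zpow.2 (Or.inl h0)) ?_
    exact (hf.differentiableAt (isOpen_bernsteinRegion ρ)
      (joukowski_mem_bernsteinRegion h1.le h2)).comp u (differentiableAt_joukowski h0)

theorem joukowskiLaurent_neg (f : ℂ → ℂ) (m : ℤ) :
    joukowskiLaurent f 1 (-m) = joukowskiLaurent f 1 m := by
  rw [joukowskiLaurent, joukowskiLaurent]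
  congr 1
  have h := intervalIntegral.integral_comp_sub_left (a := 0) (b := 2 * π)
    (fun θ => (circleMap 0 1 θ) ^ (-m) * f (joukowski (circleMap 0 1 θ))) (2 * π)
  rw [sub_zero, sub_self] at h
  rw [← h]
  refine intervalIntegral.integral_congr fun θ _ => ?_
  have e : circleMap 0 1 (2 * π - θ) = (circleMap 0 1 θ)⁻¹ := by
    rw [circleMap_zero_inv, sub_eq_neg_add, periodic_circleMap 0 1 _, inv_one]
  simp only [e, joukowski_inv, inv_zpow, zpow_neg, inv_inv]

theorem norm_joukowskiLaurent_le {ρ : ℝ} (hρ : 1 < ρ) {f : ℂ → ℂ}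
    (hf : DiffContOnCl ℂ f (bernsteinRegion ρ)) (m : ℕ) :
    ‖joukowskiLaurent f 1 m‖ ≤ bernsteinMax ρ f * ρ⁻¹ ^ m := by
  have hρ0 : 0 < ρ := by linarith
  rw [joukowskiLaurent_eq hρ hf, joukowskiLaurent, norm_mul]
  have h1 : ∀ θ ∈ uIoc (0 : ℝ) (2 * π),
      ‖(circleMap 0 ρ θ) ^ (-(m : ℤ)) * f (joukowski (circleMap 0 ρ θ))‖ ≤
        bernsteinMax ρ f * ρ⁻¹ ^ m := by
    intro θ _
    have hn : ‖circleMap 0 ρ θ‖ = ρ := by rw [norm_circleMap_zero, abs_of_pos hρ0]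
    rw [norm_mul, norm_zpow, hn, zpow_neg, zpow_natCast, ← inv_pow, mul_comm]
    exact mul_le_mul_of_nonneg_right (norm_le_bernsteinMax hρ hf hn) (by positivity)
  have h2 := intervalIntegral.norm_integral_le_of_norm_le_const h1
  have hpi := pi_pos
  rw [sub_zero, abs_of_pos (by positivity)] at h2
  calc _ ≤ ‖(2 * π : ℂ)⁻¹‖ * (bernsteinMax ρ f * ρ⁻¹ ^ m * (2 * π)) := by gcongr
    _ = _ := by
      rw [norm_inv, norm_mul, Complex.norm_ofNat, Complex.norm_real, norm_of_nonneg hpi.le]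
      field_simp

/-- The expansion coefficients in the Chebyshev polynomials of the second kind. -/
def bernsteinChebyshev (f : ℂ → ℂ) (m : ℕ) : ℂ :=
  joukowskiLaurent f 1 m - joukowskiLaurent f 1 (m + 2)

theorem summable_bernsteinChebyshev {ρ : ℝ} (hρ : 1 < ρ) {f : ℂ → ℂ}
    (hf : DiffContOnCl ℂ f (bernsteinRegion ρ)) :
    Summable fun m : ℕ => ‖bernsteinChebyshev f m‖ * (m + 1) := by
  have hM := bernsteinMax_nonneg ρ f
  have hr0 : 0 ≤ ρ⁻¹ := inv_nonneg.2 (by linarith)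
  have hr : ‖ρ⁻¹‖ < 1 := by
    rw [norm_of_nonneg hr0]
    exact inv_lt_one_of_one_lt₀ hρ
  have h1 : ∀ m : ℕ, ‖bernsteinChebyshev f m‖ ≤ 2 * bernsteinMax ρ f * ρ⁻¹ ^ m := by
    intro m
    have h2 := norm_joukowskiLaurent_le hρ hf m
    have h3 := norm_joukowskiLaurent_le hρ hf (m + 2)
    have h4 : ρ⁻¹ ^ (m + 2) ≤ ρ⁻¹ ^ m :=
      pow_le_pow_of_le_one hr0 (inv_le_one_of_one_le₀ hρ.le) (by omega)
    have h5 := mul_le_mul_of_nonneg_left h4 hM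
    push_cast at h3
    calc _ ≤ _ := norm_sub_le _ _
      _ ≤ _ := by linarith
  have h2 : Summable fun m : ℕ => 2 * bernsteinMax ρ f * ((m : ℝ) ^ 1 * ρ⁻¹ ^ m + ρ⁻¹ ^ m) :=
    ((summable_pow_mul_geometric_of_norm_lt_one 1 hr).add
      (summable_geometric_of_norm_lt_one hr)).mul_left _
  refine Summable.of_nonneg_of_le (fun m => by positivity) (fun m => ?_) h2
  calc _ ≤ 2 * bernsteinMax ρ f * ρ⁻¹ ^ m * (m + 1) :=
        mul_le_mul_of_nonneg_right (h1 m) (by positivity)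
    _ = _ := by ring

/-- The Laurent coefficients on the unit circle are the Fourier coefficients of `f(cos θ)`. They
decay geometrically, so the Fourier series converges pointwise. -/
theorem hasSum_fourier_bernstein {ρ : ℝ} (hρ : 1 < ρ) {f : ℂ → ℂ}
    (hf : DiffContOnCl ℂ f (bernsteinRegion ρ)) (θ : ℝ) :
    HasSum (fun m : ℤ => joukowskiLaurent f 1 m * Complex.exp (m * θ * Complex.I))
      (f (cos θ : ℝ)) := by
  have : Fact (0 < 2 * π) := ⟨by positivity⟩
  have hcont : Continuous fun t : AddCircle (2 * π) => f ((Real.cos_periodic.lift t : ℝ) : ℂ) := by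
    have h0 : Continuous fun t : ℝ => f ((cos t : ℝ) : ℂ) := by
      have h := hf.continuousOn.comp_continuous (f := fun t : ℝ => ((cos t : ℝ) : ℂ)) (by fun_prop)
        fun t => subset_closure (ofReal_mem_bernsteinRegion hρ ⟨neg_one_le_cos t, cos_le_one t⟩)
      exact h
    exact continuous_coinduced_dom.2 h0
  set F : C(AddCircle (2 * π), ℂ) := ⟨_, hcont⟩ with hF
  have hFc : ∀ t : ℝ, F (t : AddCircle (2 * π)) = f ((cos t : ℝ) : ℂ) := fun t => rfl
  have hexp : ∀ (m : ℤ) (t : ℝ), fourier m (t : AddCircle (2 * π)) =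
      Complex.exp (m * t * Complex.I) := by
    intro m t
    rw [fourier_coe_apply]
    congr 1
    have : (π : ℂ) ≠ 0 := by exact_mod_cast pi_ne_zero
    push_cast
    field_simp
  have hco : ∀ m : ℤ, fourierCoeff F m = joukowskiLaurent f 1 m := by
    intro m
    rw [fourierCoeff_eq_intervalIntegral F m 0, joukowskiLaurent, zero_add, one_div,
      ← Complex.coe_smul, smul_eq_mul]
    push_cast
    congr 1
    refine intervalIntegral.integral_congr fun t _ => ?_
    simp only [hexp, hFc, smul_eq_mul, circleMap, zero_add, Complex.ofReal_one, one_mul,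
      joukowski_exp_mul_I]
    rw [← Complex.exp_int_mul]
    congr 2
    push_cast
    ring
  have hs : Summable (fourierCoeff F) := by
    have hr : ‖ρ⁻¹‖ < 1 := by
      rw [norm_of_nonneg (inv_nonneg.2 (by linarith))]
      exact inv_lt_one_of_one_lt₀ hρ
    have h1 : Summable fun m : ℕ => bernsteinMax ρ f * ρ⁻¹ ^ m :=
      (summable_geometric_of_norm_lt_one hr).mul_left _
    have h2 : Summable fun m : ℕ => joukowskiLaurent f 1 m :=
      Summable.of_norm_bounded h1 (norm_joukowskiLaurent_le hρ hf)
    refine Summable.of_nat_of_neg ?_ ?_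
    · simpa only [hco] using h2
    · simpa only [hco, joukowskiLaurent_neg] using h2
  have h := has_pointwise_sum_fourier_series_of_summable hs (θ : AddCircle (2 * π))
  simpa only [hco, hexp, smul_eq_mul, hFc] using h

/-- With `e = exp(iθ)`, multiplication of the Fourier series by `e - e⁻¹ = 2i sin θ` turns the
coefficient of `e^m` into `t (m-1) - t (m+1)`, which is odd in `m`. The terms `±m` combine to
multiples of `e^m - e^(-m) = 2i sin θ U_(m-1)(x)`. Division by `sin θ` restricts `x` to the open
interval. -/
theorem hasSum_bernsteinChebyshev {ρ : ℝ} (hρ : 1 < ρ) {f : ℂ → ℂ}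
    (hf : DiffContOnCl ℂ f (bernsteinRegion ρ)) {x : ℝ} (hx : x ∈ Ioo (-1 : ℝ) 1) :
    HasSum (fun m : ℕ => bernsteinChebyshev f m * (((Chebyshev.U ℝ m).eval x : ℝ) : ℂ)) (f x) := by
  set θ := arccos x with hθ
  have hcos : cos θ = x := cos_arccos hx.1.le hx.2.le
  have hsin : (Complex.sin θ) ≠ 0 := by
    have : 0 < sin θ := sin_pos_of_pos_of_lt_pi (arccos_pos.2 hx.2)
      (lt_of_le_of_ne (arccos_le_pi x) (by rw [Ne, arccos_eq_pi]; linarith [hx.1]))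
    exact_mod_cast this.ne'
  have h := hasSum_fourier_bernstein hρ hf θ
  rw [hcos] at h
  set t := joukowskiLaurent f 1 with ht
  set e : ℂ := Complex.exp (θ * Complex.I) with he
  have he0 : e ≠ 0 := Complex.exp_ne_zero _
  have hexp : ∀ m : ℤ, Complex.exp (m * θ * Complex.I) = e ^ m := by
    intro m
    rw [he, ← Complex.exp_int_mul, mul_assoc]
  simp only [hexp] at h
  have h1 : HasSum (fun m : ℤ => t (m - 1) * e ^ m) (e * f x) := by
    rw [← (Equiv.addRight (1 : ℤ)).hasSum_iff]
    refine (h.mul_left e).congr_fun fun m => ?_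
    simp only [Function.comp_apply, Equiv.coe_addRight, add_sub_cancel_right, zpow_add_one₀ he0]
    ring
  have h2 : HasSum (fun m : ℤ => t (m + 1) * e ^ m) (e⁻¹ * f x) := by
    rw [← (Equiv.addRight (-1 : ℤ)).hasSum_iff]
    refine (h.mul_left e⁻¹).congr_fun fun m => ?_
    simp only [Function.comp_apply, Equiv.coe_addRight, neg_add_cancel_right, zpow_add₀ he0,
      zpow_neg_one]
    ring
  -- The index zero is counted twice here, harmlessly: its coefficient `t (-1) - t 1` is zero.
  have h3 := (h1.sub h2).nat_add_neg
  have htn : ∀ m, t (-m) = t m := joukowskiLaurent_neg f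
  have h4 := (hasSum_nat_add_iff' 1).2 h3
  have hsin2 : e - e⁻¹ = 2 * Complex.I * Complex.sin θ := by
    rw [he, ← Complex.exp_neg, Complex.sin, neg_mul]
    linear_combination (-(Complex.exp (-(θ * Complex.I)) - Complex.exp (θ * Complex.I))) *
      Complex.I_mul_I
  have hne : 2 * Complex.I * Complex.sin θ ≠ 0 := by
    simp [hsin]
  have hfx : e * f x - e⁻¹ * f x = 2 * Complex.I * Complex.sin θ * f x := by
    rw [← hsin2]; ring
  have hU : ∀ m : ℕ, e ^ (m + 1) - (e ^ (m + 1))⁻¹ =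
      2 * Complex.I * Complex.sin θ * (((Chebyshev.U ℝ m).eval x : ℝ) : ℂ) := by
    intro m
    have hUc := congrArg (fun t : ℝ => (t : ℂ)) (Chebyshev.U_real_cos θ m)
    simp only [hcos, Complex.ofReal_mul, Complex.ofReal_sin, Complex.ofReal_add, Int.cast_natCast,
      Complex.ofReal_natCast, Complex.ofReal_one] at hUc
    rw [mul_assoc, mul_comm (Complex.sin θ), hUc, Complex.sin, he, ← Complex.exp_nat_mul,
      ← Complex.exp_neg]
    have e1 : -(((m : ℂ) + 1) * θ) * Complex.I = -(((m + 1 : ℕ) : ℂ) * (θ * Complex.I)) := by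
      push_cast; ring
    have e2 : (((m : ℂ) + 1) * θ) * Complex.I = (((m + 1 : ℕ) : ℂ) * (θ * Complex.I)) := by
      push_cast; ring
    rw [e1, e2]
    linear_combination (-(Complex.exp (-(((m + 1 : ℕ) : ℂ) * (θ * Complex.I))) -
      Complex.exp ((((m + 1 : ℕ) : ℂ) * (θ * Complex.I))))) * Complex.I_mul_I
  have h5 := h4.mul_left (2 * Complex.I * Complex.sin θ)⁻¹
  have hf0 : t (-1) = t 1 := htn 1
  simp only [Finset.range_one, Finset.sum_singleton, Nat.cast_zero, neg_zero, zero_sub, zero_add,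
    zpow_zero, hf0, sub_self, add_zero, sub_zero, hfx, inv_mul_cancel_left₀ hne] at h5
  refine h5.congr_fun fun m => ?_
  rw [eq_inv_mul_iff_mul_eq₀ hne, mul_left_comm, ← hU, bernsteinChebyshev]
  have e1 : (((m + 1 : ℕ) : ℤ) - 1) = m := by push_cast; ring
  have e2 : (((m + 1 : ℕ) : ℤ) + 1) = m + 2 := by push_cast; ring
  have e3 : (-((m + 1 : ℕ) : ℤ) - 1) = -(m + 2) := by push_cast; ring
  have e4 : (-((m + 1 : ℕ) : ℤ) + 1) = -m := by push_cast; ring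
  simp only [e1, e2, e3, e4, htn, zpow_neg, zpow_natCast, ← ht]
  ring

theorem bernsteinChebyshev_eq {ρ : ℝ} (hρ : 1 < ρ) {f : ℂ → ℂ}
    (hf : DiffContOnCl ℂ f (bernsteinRegion ρ)) (m : ℕ) :
    bernsteinChebyshev f m = (2 * π : ℂ)⁻¹ * ∫ θ in (0 : ℝ)..2 * π,
      f (joukowski (circleMap 0 ρ θ)) * (1 - (circleMap 0 ρ θ)⁻¹ ^ 2) *
        (circleMap 0 ρ θ)⁻¹ ^ m := by
  have hρ0 : ρ ≠ 0 := by linarith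
  have hi : ∀ m : ℤ, IntervalIntegrable (fun θ => (circleMap 0 ρ θ) ^ (-m) *
      f (joukowski (circleMap 0 ρ θ))) volume 0 (2 * π) := by
    intro m
    refine Continuous.intervalIntegrable ?_ _ _
    refine Continuous.mul ?_ (continuous_comp_joukowski_circleMap hρ hf)
    exact (continuous_circleMap 0 ρ).zpow₀ _ fun θ => Or.inl (circleMap_ne_center hρ0)
  rw [bernsteinChebyshev, joukowskiLaurent_eq hρ hf, joukowskiLaurent_eq hρ hf, joukowskiLaurent,
    joukowskiLaurent, ← mul_sub, ← intervalIntegral.integral_sub (hi _) (hi _)]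
  congr 1
  refine intervalIntegral.integral_congr fun θ _ => ?_
  have h0 : circleMap 0 ρ θ ≠ 0 := circleMap_ne_center hρ0
  have e : (circleMap 0 ρ θ) ^ (-((m : ℤ) + 2)) = (circleMap 0 ρ θ)⁻¹ ^ m *
      (circleMap 0 ρ θ)⁻¹ ^ 2 := by
    rw [← pow_add, inv_pow, zpow_neg]; norm_cast
  simp only [e, zpow_neg, zpow_natCast, inv_pow]
  ring

/-! ### The contour integral bound for the coefficients. -/

/-- The Gegenbauer coefficients of an analytic function, bounded through the values of the
hypergeometric kernel on the circle of radius `ρ⁻²`. -/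
theorem norm_gegenbauerCoeff_le {lam : ℝ} (hlam : -1 / 2 < lam) (hlam0 : lam ≠ 0) {ρ : ℝ}
    (hρ : 1 < ρ) {f : ℂ → ℂ} (hf : DiffContOnCl ℂ f (bernsteinRegion ρ)) (k : ℕ) {Φ : ℝ}
    (hs : Summable fun i => |kernelCoeff lam k i| * (1 / ρ ^ 2) ^ i)
    (hΦ : ∀ w : ℂ, ‖w‖ = 1 / ρ ^ 2 → ‖∑' i, (kernelCoeff lam k i : ℂ) * w ^ i‖ ≤ Φ) :
    ‖gegenbauerCoeff lam (fun t : ℝ => f t) k‖ ≤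
      bernsteinMax ρ f * bernsteinLength ρ / (π * ρ) *
        (|k.factorial / (ascPochhammer ℝ k).eval lam| * Φ * ρ⁻¹ ^ k) := by
  have hρ0 : 0 < ρ := by linarith
  have hM := bernsteinMax_nonneg ρ f
  have hpi := pi_pos
  set c : ℝ := k.factorial / (ascPochhammer ℝ k).eval lam with hc
  set u := circleMap 0 ρ with hu
  have hun : ∀ θ, ‖(u θ)⁻¹‖ = ρ⁻¹ := fun θ => by
    rw [norm_inv, hu, norm_circleMap_zero, abs_of_pos hρ0]
  have hcu : Continuous fun θ => (u θ)⁻¹ :=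
    (continuous_circleMap 0 ρ).inv₀ fun θ => circleMap_ne_center hρ0.ne'
  have hcf := continuous_comp_joukowski_circleMap hρ hf
  set G : ℝ → ℂ := fun θ => f (joukowski (u θ)) * (1 - (u θ)⁻¹ ^ 2) * (u θ)⁻¹ ^ k with hG
  have hGc : Continuous G := (hcf.mul (continuous_const.sub (hcu.pow 2))).mul (hcu.pow k)
  -- The factor `|1 - u⁻²|` is kept as `2/ρ` times the speed of the parametrization, so that its
  -- integral is the circumference.
  have hGn : ∀ θ, ‖G θ‖ ≤ bernsteinMax ρ f * (2 / ρ * ‖deriv (bernsteinParam ρ) θ‖) * ρ⁻¹ ^ k := by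
    intro θ
    have hn : ‖u θ‖ = ρ := by rw [hu, norm_circleMap_zero, abs_of_pos hρ0]
    rw [norm_deriv_bernsteinParam hρ0, ← hu, hG]
    simp only [norm_mul, norm_pow (u θ)⁻¹ k, hun]
    have : 2 / ρ * (ρ / 2 * ‖1 - (u θ)⁻¹ ^ 2‖) = ‖1 - (u θ)⁻¹ ^ 2‖ := by field_simp
    rw [this]
    gcongr
    exact norm_le_bernsteinMax hρ hf hn
  have hsw : ∀ θ, Summable fun i => (kernelCoeff lam k i : ℂ) * ((u θ)⁻¹ ^ 2) ^ i := by
    intro θ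
    refine Summable.of_norm (hs.congr fun i => ?_)
    rw [norm_mul, Complex.norm_real, norm_pow, norm_pow, hun, Real.norm_eq_abs, inv_pow, one_div]
  have hint : HasSum (fun i : ℕ => ∫ θ in (0 : ℝ)..2 * π,
      G θ * ((kernelCoeff lam k i : ℂ) * ((u θ)⁻¹ ^ 2) ^ i))
      (∫ θ in (0 : ℝ)..2 * π, G θ * ∑' i, (kernelCoeff lam k i : ℂ) * ((u θ)⁻¹ ^ 2) ^ i) := by
    refine intervalIntegral.hasSum_integral_of_dominated_convergence
      (fun i θ => ‖G θ‖ * (|kernelCoeff lam k i| * (1 / ρ ^ 2) ^ i)) (fun i => ?_) (fun i => ?_)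
      ?_ ?_ ?_
    · refine Continuous.aestronglyMeasurable ?_
      fun_prop
    · refine Eventually.of_forall fun θ _ => le_of_eq ?_
      rw [norm_mul (G θ), norm_mul (_ : ℂ) ((_ : ℂ) ^ i), Complex.norm_real, norm_pow, norm_pow,
        hun, Real.norm_eq_abs, inv_pow, one_div]
    · exact Eventually.of_forall fun θ _ => hs.mul_left _
    · simp only [tsum_mul_left]
      exact (hGc.norm.mul continuous_const).intervalIntegrable _ _
    · exact Eventually.of_forall fun θ _ => (hsw θ).hasSum.mul_left _
  have hsum := hasSum_gegenbauerCoeff_chebyshev hlam hlam0 k (summable_bernsteinChebyshev hρ hf)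
    fun x hx => hasSum_bernsteinChebyshev hρ hf hx
  -- Exchange of sum and integral: the factors `u^(-(k+2i))` sum to `u⁻ᵏ` times the hypergeometric
  -- kernel at `u⁻²`.
  have heq : gegenbauerCoeff lam (fun t : ℝ => f t) k = (c : ℂ) * ((2 * π : ℂ)⁻¹ *
      ∫ θ in (0 : ℝ)..2 * π, G θ * ∑' i, (kernelCoeff lam k i : ℂ) * ((u θ)⁻¹ ^ 2) ^ i) := by
    refine hsum.unique (((hint.mul_left _).mul_left (c : ℂ)).congr_fun fun i => ?_)
    rw [bernsteinChebyshev_eq hρ hf, Complex.ofReal_mul, ← hc, ← hu, mul_assoc, mul_left_comm _ _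
      (intervalIntegral _ _ _ _), ← intervalIntegral.integral_const_mul]
    congr 3
    ext θ
    simp only [hG, pow_add, pow_mul]
    ring
  have hI : ‖∫ θ in (0 : ℝ)..2 * π, G θ * ∑' i, (kernelCoeff lam k i : ℂ) * ((u θ)⁻¹ ^ 2) ^ i‖ ≤
      ∫ θ in (0 : ℝ)..2 * π, bernsteinMax ρ f * (2 / ρ) * ρ⁻¹ ^ k * Φ *
        ‖deriv (bernsteinParam ρ) θ‖ := by
    refine intervalIntegral.norm_integral_le_of_norm_le (by positivity)
      (Eventually.of_forall fun θ _ => ?_) ?_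
    · rw [norm_mul]
      have h1 := hΦ ((u θ)⁻¹ ^ 2) (by rw [norm_pow, hun, inv_pow, one_div])
      calc _ ≤ (bernsteinMax ρ f * (2 / ρ * ‖deriv (bernsteinParam ρ) θ‖) * ρ⁻¹ ^ k) * Φ :=
            mul_le_mul (hGn θ) h1 (norm_nonneg _) (by positivity)
        _ = _ := by ring
    · refine Continuous.intervalIntegrable ?_ _ _
      simp only [norm_deriv_bernsteinParam hρ0]
      fun_prop
  rw [heq, norm_mul, Complex.norm_real, Real.norm_eq_abs, norm_mul]
  rw [intervalIntegral.integral_const_mul, ← bernsteinLength] at hI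
  have h2 : ‖(2 * π : ℂ)⁻¹‖ = (2 * π)⁻¹ := by
    rw [norm_inv, norm_mul, Complex.norm_ofNat, Complex.norm_real, norm_of_nonneg hpi.le]
  rw [h2]
  calc _ ≤ |c| * ((2 * π)⁻¹ * (bernsteinMax ρ f * (2 / ρ) * ρ⁻¹ ^ k * Φ * bernsteinLength ρ)) := by
        gcongr
    _ = _ := by field_simp

/-! ### Completeness and termwise differentiation. -/

theorem span_gegenbauerPoly {lam : ℝ} (hlam : -1 / 2 < lam) (hlam0 : lam ≠ 0) :
    Submodule.span ℝ (Set.range (gegenbauerPoly lam)) = ⊤ := by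
  let S : Polynomial.Sequence ℝ := ⟨gegenbauerPoly lam, degree_gegenbauerPoly hlam hlam0⟩
  have := S.span fun i => (leadingCoeff_ne_zero.2 (S.ne_zero i)).isUnit
  exact this

theorem gegenbauerH_pos {lam : ℝ} (hlam : 0 < lam) (n : ℕ) : 0 < gegenbauerH lam n := by
  have h1 : 0 < Gamma ((n : ℝ) + 2 * lam) := Gamma_pos_of_pos (by positivity)
  have h2 : 0 < Gamma lam := Gamma_pos_of_pos hlam
  have h3 : 0 < Gamma ((n : ℝ) + 1) := Gamma_pos_of_pos (by positivity)
  have := pi_pos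
  rw [gegenbauerH]
  positivity

theorem gegenbauerWeight_pos (lam : ℝ) {x : ℝ} (hx : x ∈ Ioo (-1 : ℝ) 1) :
    0 < gegenbauerWeight lam x :=
  rpow_pos_of_pos (by nlinarith [hx.1, hx.2]) _

theorem gegenbauerWeight_nonneg (lam : ℝ) {x : ℝ} (hx : x ∈ Icc (-1 : ℝ) 1) :
    0 ≤ gegenbauerWeight lam x :=
  rpow_nonneg (by nlinarith [hx.1, hx.2]) _

/-- A real continuous function orthogonal to all polynomials vanishes. -/
theorem eqOn_zero_of_forall_integral_polynomial {lam : ℝ} (hlam : -1 / 2 < lam) {g : ℝ → ℝ}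
    (hg : ContinuousOn g (Icc (-1) 1))
    (h : ∀ p : ℝ[X], ∫ x in (-1 : ℝ)..1, gegenbauerWeight lam x * (p.eval x * g x) = 0) :
    EqOn g 0 (Icc (-1) 1) := by
  have hw := intervalIntegrable_gegenbauerWeight hlam
  have hwi : ∀ q : ℝ → ℝ, ContinuousOn q (Icc (-1) 1) →
      IntervalIntegrable (fun x => gegenbauerWeight lam x * q x) volume (-1) 1 := fun q hq =>
    hw.mul_continuousOn (by rwa [uIcc_of_le (by norm_num)])
  have hsq : ∫ x in (-1 : ℝ)..1, gegenbauerWeight lam x * (g x * g x) = 0 := by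
    set A := ∫ x in (-1 : ℝ)..1, gegenbauerWeight lam x * |g x| with hA
    -- Weierstrass approximation: by orthogonality one factor `g` may be replaced by `g - p`, which
    -- is at most `ε` in modulus.
    have hbound : ∀ ε > 0, |∫ x in (-1 : ℝ)..1, gegenbauerWeight lam x * (g x * g x)| ≤ ε * A := by
      intro ε hε
      obtain ⟨p, hp⟩ := exists_polynomial_near_of_continuousOn (-1) 1 g hg ε hε
      have e : ∫ x in (-1 : ℝ)..1, gegenbauerWeight lam x * (g x * g x) =
          ∫ x in (-1 : ℝ)..1, gegenbauerWeight lam x * ((g x - p.eval x) * g x) := by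
        have h1 : IntervalIntegrable (fun x => gegenbauerWeight lam x * (g x * g x)) volume (-1) 1 :=
          hwi _ (hg.mul hg)
        have h2 : IntervalIntegrable (fun x => gegenbauerWeight lam x * (p.eval x * g x))
          volume (-1) 1 := hwi _ (p.continuous.continuousOn.mul hg)
        rw [← sub_zero (∫ x in (-1 : ℝ)..1, gegenbauerWeight lam x * (g x * g x)), ← h p,
          ← intervalIntegral.integral_sub h1 h2]
        congr 1; ext x; ring
      rw [e, hA, ← intervalIntegral.integral_const_mul, ← Real.norm_eq_abs]
      refine intervalIntegral.norm_integral_le_of_norm_le (by norm_num)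
        (Eventually.of_forall fun x hx => ?_) ((hwi _ hg.abs).const_mul _)
      have hx' : x ∈ Icc (-1 : ℝ) 1 := ⟨hx.1.le, hx.2⟩
      have h1 := hp x hx'
      rw [norm_mul, norm_mul, Real.norm_eq_abs, Real.norm_eq_abs, Real.norm_eq_abs,
        abs_of_nonneg (gegenbauerWeight_nonneg lam hx'), abs_sub_comm]
      have h2 := mul_le_mul_of_nonneg_right h1.le (abs_nonneg (g x))
      have h3 := mul_le_mul_of_nonneg_left h2 (gegenbauerWeight_nonneg lam hx')
      linarith
    have ht : Tendsto (fun ε : ℝ => ε * A) (𝓝[>] 0) (𝓝 0) := by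
      have : Continuous fun ε : ℝ => ε * A := by fun_prop
      simpa using (this.tendsto 0).mono_left nhdsWithin_le_nhds
    have h0 := ge_of_tendsto ht (eventually_mem_nhdsWithin.mono fun ε hε => hbound ε hε)
    exact abs_nonpos_iff.1 h0
  have hIoo : ∀ x ∈ Ioo (-1 : ℝ) 1, g x = 0 := by
    have hnn : 0 ≤ᵐ[volume.restrict (Ioc (-1 : ℝ) 1)]
        fun x => gegenbauerWeight lam x * (g x * g x) := by
      refine (ae_restrict_iff' measurableSet_Ioc).2 (Eventually.of_forall fun x hx => ?_)
      exact mul_nonneg (gegenbauerWeight_nonneg lam ⟨hx.1.le, hx.2⟩) (mul_self_nonneg _)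
    have hae := (intervalIntegral.integral_eq_zero_iff_of_le_of_nonneg_ae (by norm_num) hnn
      (hwi _ (hg.mul hg))).1 hsq
    have hae2 : g =ᵐ[volume.restrict (Ioo (-1 : ℝ) 1)] fun _ => 0 := by
      have h1 := ae_restrict_of_ae_restrict_of_subset Ioo_subset_Ioc_self hae
      filter_upwards [h1, ae_restrict_mem measurableSet_Ioo] with x hx hx'
      have := (mul_eq_zero.1 hx).resolve_left (gegenbauerWeight_pos lam hx').ne'
      exact mul_self_eq_zero.1 this
    intro x hx
    exact Measure.eqOn_open_of_ae_eq hae2 isOpen_Ioo (hg.mono Ioo_subset_Icc_self)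
      continuousOn_const hx
  have hcl : closure (Ioo (-1 : ℝ) 1) = Icc (-1) 1 := closure_Ioo (by norm_num)
  exact EqOn.of_subset_closure (s := Ioo (-1 : ℝ) 1) hIoo hg continuousOn_const
    Ioo_subset_Icc_self hcl.ge

/-- The Gegenbauer coefficients determine a continuous function. -/
theorem eqOn_of_gegenbauerCoeff_eq {lam : ℝ} (hlam : 0 < lam) {f g : ℝ → ℂ}
    (hf : ContinuousOn f (Icc (-1) 1)) (hg : ContinuousOn g (Icc (-1) 1))
    (h : ∀ k, gegenbauerCoeff lam f k = gegenbauerCoeff lam g k) : EqOn f g (Icc (-1) 1) := by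
  have hlam' : -1 / 2 < lam := by linarith
  have hd : ContinuousOn (fun x => f x - g x) (Icc (-1) 1) := hf.sub hg
  have hi : ∀ p : ℝ[X], IntervalIntegrable (fun x => (gegenbauerWeight lam x : ℂ) *
      (((p.eval x : ℝ) : ℂ) * (f x - g x))) volume (-1) 1 := fun p =>
    intervalIntegrable_gegenbauerWeight_mul hlam' ((continuous_ofReal_eval p).continuousOn.mul hd)
  have hp : ∀ p : ℝ[X], ∫ x in (-1 : ℝ)..1, (gegenbauerWeight lam x : ℂ) *
      (((p.eval x : ℝ) : ℂ) * (f x - g x)) = 0 := by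
    intro p
    have hmem : p ∈ Submodule.span ℝ (Set.range (gegenbauerPoly lam)) := by
      rw [span_gegenbauerPoly hlam' hlam.ne']; trivial
    induction hmem using Submodule.span_induction with
    | mem p hp =>
      obtain ⟨k, rfl⟩ := hp
      have hk := h k
      have hH : ((1 / gegenbauerH lam k : ℝ) : ℂ) ≠ 0 := by
        exact_mod_cast (one_div_pos.2 (gegenbauerH_pos hlam k)).ne'
      rw [gegenbauerCoeff_eq, gegenbauerCoeff_eq] at hk
      have := mul_left_cancel₀ hH hk
      rw [gegenbauerPairing_eq, gegenbauerPairing_eq, ← sub_eq_zero,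
        ← intervalIntegral.integral_sub (intervalIntegrable_gegenbauerPairing hlam' k hf)
          (intervalIntegrable_gegenbauerPairing hlam' k hg)] at this
      simpa only [mul_sub] using this
    | zero => simp
    | add p q _ _ hp hq =>
      have := intervalIntegral.integral_add (hi p) (hi q)
      rw [hp, hq, add_zero] at this
      rw [← this]
      congr 1; ext x
      rw [eval_add]; push_cast; ring
    | smul a p _ hp =>
      have := intervalIntegral.integral_const_mul (a : ℂ) (fun x => (gegenbauerWeight lam x : ℂ) *
        (((p.eval x : ℝ) : ℂ) * (f x - g x))) (μ := volume) (a := -1) (b := 1)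
      rw [hp, mul_zero] at this
      rw [← this]
      congr 1; ext x
      rw [eval_smul, smul_eq_mul]; push_cast; ring
  have hre : EqOn (fun x => (f x - g x).re) 0 (Icc (-1) 1) := by
    refine eqOn_zero_of_forall_integral_polynomial hlam'
      (Complex.continuous_re.comp_continuousOn hd) fun p => ?_
    have h1 := Complex.reCLM.intervalIntegral_comp_comm (hi p)
    rw [hp p, map_zero] at h1
    rw [← h1]
    congr 1; ext x
    simp
  have him : EqOn (fun x => (f x - g x).im) 0 (Icc (-1) 1) := by
    refine eqOn_zero_of_forall_integral_polynomial hlam'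
      (Complex.continuous_im.comp_continuousOn hd) fun p => ?_
    have h1 := Complex.imCLM.intervalIntegral_comp_comm (hi p)
    rw [hp p, map_zero] at h1
    rw [← h1]
    congr 1; ext x
    simp
  intro x hx
  exact sub_eq_zero.1 (Complex.ext (hre hx) (him hx))

/-- The derivative of the Gegenbauer coefficients in closed form, for iterated derivatives. -/
theorem gegenbauerCoeff_iteratedDeriv {lam : ℝ} (hlam : -1 / 2 < lam) (hlam0 : lam ≠ 0) (j n : ℕ)
    {f : ℝ → ℂ} {s : Set ℝ} (hs : IsOpen s) (hIs : Icc (-1 : ℝ) 1 ⊆ s)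
    (hf : ∀ i, DifferentiableOn ℝ (iteratedDeriv i f) s) :
    gegenbauerCoeff (lam + j) (iteratedDeriv j f) n =
      2 ^ j * ((ascPochhammer ℝ j).eval lam : ℝ) * gegenbauerCoeff lam f (n + j) := by
  induction j generalizing n with
  | zero => simp
  | succ j ih =>
    have hj : -1 / 2 < lam + j := by
      have : (0 : ℝ) ≤ j := by positivity
      linarith
    have hj0 : lam + j ≠ 0 := by
      rcases j.eq_zero_or_pos with rfl | h
      · simpa
      · have : (1 : ℝ) ≤ j := by exact_mod_cast h
        linarith
    have h := gegenbauerCoeff_shift hj hj0 n (f := iteratedDeriv j f)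
      (f' := iteratedDeriv (j + 1) f) ((hf j).continuousOn.mono hIs)
      (fun x hx => by
        rw [iteratedDeriv_succ]
        exact ((hf j).differentiableAt (hs.mem_nhds (hIs ⟨hx.1.le, hx.2.le⟩))).hasDerivAt)
      ((hf (j + 1)).continuousOn.mono hIs)
    rw [Nat.cast_succ, ← add_assoc, h, ih, ascPochhammer_succ_eval, pow_succ,
      show n + 1 + j = n + (j + 1) by ring]
    push_cast
    ring

theorem iteratedDeriv_ofReal_eval_gegenbauerPoly {lam : ℝ} (hlam : -1 / 2 < lam) (j k : ℕ) :
    iteratedDeriv j (fun x : ℝ => ((gegenbauerC lam k x : ℝ) : ℂ)) = fun x =>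
      if j ≤ k then 2 ^ j * ((ascPochhammer ℝ j).eval lam : ℝ) *
        ((gegenbauerC (lam + j) (k - j) x : ℝ) : ℂ) else 0 := by
  simp only [gegenbauerC_eq_eval]
  induction j generalizing k lam with
  | zero => simp
  | succ j ih =>
    have hd : deriv (fun x : ℝ => (((gegenbauerPoly lam k).eval x : ℝ) : ℂ)) =
        fun x => (((derivative (gegenbauerPoly lam k)).eval x : ℝ) : ℂ) :=
      funext fun x => (hasDerivAt_ofReal_eval _ x).deriv
    rw [iteratedDeriv_succ', hd]
    ext x
    rcases k with _ | k
    · simp [derivative_gegenbauerPoly_zero]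
    · simp only [derivative_gegenbauerPoly_succ hlam, eval_mul, eval_C, Complex.ofReal_mul]
      rw [iteratedDeriv_const_mul_field, congrFun (ih (show -1 / 2 < lam + 1 by linarith) k) x]
      simp only [Nat.add_le_add_iff_right]
      split_ifs with h
      · rw [ascPochhammer_eval_succ_left, Nat.add_sub_add_right,
          show lam + ((j + 1 : ℕ) : ℝ) = lam + 1 + j by push_cast; ring]
        push_cast
        ring
      · simp

/-- The real points of the region form an open neighbourhood of `[-1, 1]`, so the derivatives are
two-sided also at `±1`. -/
theorem differentiableOn_iteratedDeriv_ofReal {ρ : ℝ} {f : ℂ → ℂ}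
    (hf : DiffContOnCl ℂ f (bernsteinRegion ρ)) (i : ℕ) :
    DifferentiableOn ℝ (iteratedDeriv i fun t : ℝ => f t) {t : ℝ | (t : ℂ) ∈ bernsteinRegion ρ} := by
  intro t ht
  have h1 : AnalyticAt ℂ f t := hf.differentiableOn.analyticAt
    ((isOpen_bernsteinRegion ρ).mem_nhds ht)
  have h2 : AnalyticAt ℝ (fun t : ℝ => f t) t :=
    h1.restrictScalars.comp (f := fun t : ℝ => (t : ℂ)) (Complex.ofRealCLM.analyticAt t)
  rw [iteratedDeriv_eq_iterate]
  exact (h2.iterated_deriv i).differentiableAt.differentiableWithinAt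

/-- The maximum of `C_(k-j)^(lam+j)` on `[-1, 1]`, which is zero for `k < j`. -/
def gegenbauerSup (lam : ℝ) (j k : ℕ) : ℝ :=
  if j ≤ k then (ascPochhammer ℝ (k - j)).eval (2 * (lam + j)) / ((k - j).factorial : ℝ) else 0

theorem norm_iteratedDeriv_gegenbauerC_le {lam : ℝ} (hlam : -1 / 2 < lam) {j : ℕ} (hj : 1 ≤ j)
    (k : ℕ) {x : ℝ} (hx : x ∈ Icc (-1 : ℝ) 1) :
    ‖iteratedDeriv j (fun x : ℝ => ((gegenbauerC lam k x : ℝ) : ℂ)) x‖ ≤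
      2 ^ j * |(ascPochhammer ℝ j).eval lam| * gegenbauerSup lam j k := by
  have hj1 : (1 : ℝ) ≤ j := by exact_mod_cast hj
  rw [iteratedDeriv_ofReal_eval_gegenbauerPoly hlam, gegenbauerSup]
  split_ifs with h
  · rw [norm_mul, norm_mul, norm_pow, Complex.norm_ofNat, Complex.norm_real, Complex.norm_real,
      Real.norm_eq_abs, Real.norm_eq_abs, gegenbauerC_eq_eval]
    gcongr
    exact abs_eval_gegenbauerPoly_le (by linarith) _ hx
  · simp

theorem continuous_gegenbauerC (lam : ℝ) (k : ℕ) :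
    Continuous fun x : ℝ => ((gegenbauerC lam k x : ℝ) : ℂ) := by
  simpa only [gegenbauerC_eq_eval] using continuous_ofReal_eval (gegenbauerPoly lam k)

/-- Termwise differentiation of the Gegenbauer series of an analytic function. -/
theorem hasSum_iteratedDeriv {lam : ℝ} (hlam : -1 / 2 < lam) (hlam0 : lam ≠ 0) {j : ℕ}
    (hj : 1 ≤ j) {ρ : ℝ} (hρ : 1 < ρ) {f : ℂ → ℂ} (hf : DiffContOnCl ℂ f (bernsteinRegion ρ))
    (hs : Summable fun k => ‖gegenbauerCoeff lam (fun t : ℝ => f t) k‖ * gegenbauerSup lam j k)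
    {x : ℝ} (hx : x ∈ Icc (-1 : ℝ) 1) :
    HasSum (fun k => gegenbauerCoeff lam (fun t : ℝ => f t) k *
      iteratedDeriv j (fun x : ℝ => ((gegenbauerC lam k x : ℝ) : ℂ)) x)
      (iteratedDeriv j (fun t : ℝ => f t) x) := by
  have hj1 : (1 : ℝ) ≤ j := by exact_mod_cast hj
  have hL : 0 < lam + j := by linarith
  have hL' : -1 / 2 < lam + j := by linarith
  set a : ℕ → ℂ := gegenbauerCoeff lam (fun t : ℝ => f t) with ha
  set P : ℝ := (ascPochhammer ℝ j).eval lam with hP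
  set g : ℕ → ℝ → ℂ := fun m x => 2 ^ j * (P : ℂ) * a (m + j) *
    ((gegenbauerC (lam + j) m x : ℝ) : ℂ) with hg
  set B : ℕ → ℝ := fun m => 2 ^ j * |P| * (‖a (m + j)‖ * gegenbauerSup lam j (m + j)) with hB
  have hBs : Summable B := ((summable_nat_add_iff j).2 hs).mul_left _
  have hgc : ∀ m, ContinuousOn (g m) (Icc (-1) 1) := fun m =>
    (continuous_const.mul (continuous_gegenbauerC _ _)).continuousOn
  have hgB : ∀ m, ∀ x ∈ Icc (-1 : ℝ) 1, ‖g m x‖ ≤ B m := by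
    intro m x hx
    simp only [hg, hB, gegenbauerSup, Nat.le_add_left, if_true, Nat.add_sub_cancel, norm_mul,
      norm_pow, Complex.norm_ofNat, Complex.norm_real, Real.norm_eq_abs, gegenbauerC_eq_eval]
    have := abs_eval_gegenbauerPoly_le hL.le m hx
    rw [mul_assoc (2 ^ j * |P|)]
    gcongr
  set S : ℝ → ℂ := fun x => ∑' m, g m x with hS
  have hSum : ∀ x ∈ Icc (-1 : ℝ) 1, HasSum (fun m => g m x) (S x) := fun x hx =>
    (Summable.of_norm_bounded hBs fun m => hgB m x hx).hasSum
  have hSc : ContinuousOn S (Icc (-1) 1) := continuousOn_tsum hgc hBs hgB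
  set s : Set ℝ := {t : ℝ | (t : ℂ) ∈ bernsteinRegion ρ} with hsdef
  have hso : IsOpen s := (isOpen_bernsteinRegion ρ).preimage Complex.continuous_ofReal
  have hIs : Icc (-1 : ℝ) 1 ⊆ s := fun t ht => ofReal_mem_bernsteinRegion hρ ht
  have hdiff := differentiableOn_iteratedDeriv_ofReal hf
  -- No theorem on differentiating series is needed: the formally differentiated series has a
  -- continuous sum whose coefficients for the parameter `lam + j > 0` agree with those of the
  -- `j`-th derivative of `f`, and these determine a continuous function.
  have hEq : EqOn (iteratedDeriv j fun t : ℝ => f t) S (Icc (-1) 1) := by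
    refine eqOn_of_gegenbauerCoeff_eq hL ((hdiff j).continuousOn.mono hIs) hSc fun k => ?_
    rw [gegenbauerCoeff_iteratedDeriv hlam hlam0 j k hso hIs hdiff]
    have h := hasSum_gegenbauerCoeff hL' k hgc hgB hBs fun x hx =>
      hSum x (Ioo_subset_Icc_self hx)
    refine HasSum.unique ?_ h
    have h1 : ∀ m, gegenbauerCoeff (lam + j) (g m) k =
        if m = k then 2 ^ j * (P : ℂ) * a (k + j) else 0 := by
      intro m
      simp only [hg, gegenbauerCoeff_const_mul, gegenbauerC_eq_eval,
        gegenbauerCoeff_gegenbauerPoly hL' hL.ne']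
      rcases eq_or_ne m k with rfl | h
      · simp
      · simp [h, h.symm]
    simp only [h1]
    exact hasSum_ite_eq k _
  rw [hEq hx]
  have hE : ∀ k, iteratedDeriv j (fun x : ℝ => ((gegenbauerC lam k x : ℝ) : ℂ)) x =
      if j ≤ k then 2 ^ j * (P : ℂ) * ((gegenbauerC (lam + j) (k - j) x : ℝ) : ℂ) else 0 :=
    fun k => congrFun (iteratedDeriv_ofReal_eval_gegenbauerPoly hlam j k) x
  simp only [hE]
  rw [← hasSum_nat_add_iff' j, Finset.sum_eq_zero, sub_zero]
  · refine (hSum x hx).congr_fun fun m => ?_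
    simp only [Nat.le_add_left, if_true, Nat.add_sub_cancel, hg]
    ring
  · intro i hi
    rw [if_neg (by simpa using hi), mul_zero]

theorem norm_iteratedDeriv_sub_le {lam : ℝ} (hlam : -1 / 2 < lam) (hlam0 : lam ≠ 0) {j : ℕ}
    (hj : 1 ≤ j) {ρ : ℝ} (hρ : 1 < ρ) {f : ℂ → ℂ} (hf : DiffContOnCl ℂ f (bernsteinRegion ρ))
    (hs : Summable fun k => ‖gegenbauerCoeff lam (fun t : ℝ => f t) k‖ * gegenbauerSup lam j k)
    (n : ℕ) {x : ℝ} (hx : x ∈ Icc (-1 : ℝ) 1) :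
    ‖iteratedDeriv j (fun t : ℝ => f t) x -
        iteratedDeriv j (gegenbauerProj lam n (fun t : ℝ => f t)) x‖ ≤
      2 ^ j * |(ascPochhammer ℝ j).eval lam| * ∑' i : ℕ,
        ‖gegenbauerCoeff lam (fun t : ℝ => f t) (i + (n + 1))‖ *
          gegenbauerSup lam j (i + (n + 1)) := by
  have h := hasSum_iteratedDeriv hlam hlam0 hj hρ hf hs hx
  have hC : ∀ k, ContDiff ℝ j fun x : ℝ => ((gegenbauerC lam k x : ℝ) : ℂ) := fun k => by
    simp only [gegenbauerC_eq_eval]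
    have h := (gegenbauerPoly lam k).contDiff_aeval (𝕜 := ℝ) j
    simp only [coe_aeval_eq_eval] at h
    exact Complex.ofRealCLM.contDiff.comp h
  have hproj : iteratedDeriv j (gegenbauerProj lam n (fun t : ℝ => f t)) x =
      ∑ k ∈ Finset.range (n + 1), gegenbauerCoeff lam (fun t : ℝ => f t) k *
        iteratedDeriv j (fun x : ℝ => ((gegenbauerC lam k x : ℝ) : ℂ)) x := by
    unfold gegenbauerProj
    rw [iteratedDeriv_fun_sum fun k _ => (contDiff_const.mul (hC k)).contDiffAt]
    refine Finset.sum_congr rfl fun k _ => ?_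
    rw [iteratedDeriv_const_mul_field]
  rw [hproj]
  have h1 := (hasSum_nat_add_iff' (n + 1)).2 h
  rw [← h1.tsum_eq, ← tsum_mul_left]
  refine tsum_of_norm_bounded (((summable_nat_add_iff (n + 1)).2 hs).mul_left _).hasSum fun i => ?_
  rw [norm_mul]
  have h2 := norm_iteratedDeriv_gegenbauerC_le hlam hj (i + (n + 1)) hx
  calc _ ≤ _ := mul_le_mul_of_nonneg_left h2 (norm_nonneg _)
    _ = _ := by ring

/-! ### Binomial series and bounds for the hypergeometric kernel. -/

/-- The coefficients `(s)_i / i!` of the binomial series of `(1 - w) ^ (-s)`. -/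
def risingCoeff (s : ℝ) (i : ℕ) : ℝ := (ascPochhammer ℝ i).eval s / i.factorial

theorem ringChoose_add_sub_one (s : ℝ) (n : ℕ) : Ring.choose (s + n - 1) n = risingCoeff s n := by
  rw [risingCoeff, ← Ring.multichoose_eq, eq_div_iff (by positivity),
    ← ascPochhammer_smeval_eq_eval, ← Ring.factorial_nsmul_multichoose_eq_ascPochhammer,
    nsmul_eq_mul, mul_comm]

theorem hasSum_risingCoeff_complex (s : ℝ) {w : ℂ} (hw : ‖w‖ < 1) :
    HasSum (fun i => ((risingCoeff s i : ℝ) : ℂ) * w ^ i) ((1 - w) ^ ((-s : ℝ) : ℂ)) := by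
  have h := (Complex.one_div_one_sub_cpow_hasFPowerSeriesOnBall_zero (s : ℂ)).hasSum
    (y := w) (by simpa [enorm_eq_nnnorm, ← NNReal.coe_lt_coe] using hw)
  simp only [zero_add, FormalMultilinearSeries.ofScalars_apply_eq, smul_eq_mul] at h
  rw [Complex.ofReal_neg, Complex.cpow_neg, ← one_div]
  refine h.congr_fun fun n => ?_
  rw [← ringChoose_add_sub_one, Complex.ofReal_choose]
  push_cast
  rfl

theorem hasSum_risingCoeff (s : ℝ) {r : ℝ} (h0 : 0 ≤ r) (h1 : r < 1) :
    HasSum (fun i => risingCoeff s i * r ^ i) ((1 - r) ^ (-s)) := by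
  have h := hasSum_risingCoeff_complex s (w := (r : ℂ)) (by simpa [abs_of_nonneg h0] using h1)
  rw [← Complex.ofReal_one, ← Complex.ofReal_sub, ← Complex.ofReal_cpow (by linarith)] at h
  exact_mod_cast h

theorem summable_abs_risingCoeff (s : ℝ) {r : ℝ} (h0 : 0 ≤ r) (h1 : r < 1) :
    Summable fun i => |risingCoeff s i| * r ^ i := by
  have := (hasSum_risingCoeff s h0 h1).summable.norm
  simpa [abs_of_nonneg h0] using this

theorem ascPochhammer_eval_mono {a b : ℝ} (ha : 0 < a) (hab : a ≤ b) (i : ℕ) :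
    (ascPochhammer ℝ i).eval a ≤ (ascPochhammer ℝ i).eval b := by
  induction i with
  | zero => simp
  | succ i ih =>
    rw [ascPochhammer_succ_eval, ascPochhammer_succ_eval]
    have := ascPochhammer_pos i a ha
    have := ascPochhammer_pos i b (ha.trans_le hab)
    gcongr

theorem kernelCoeff_eq (lam : ℝ) (k i : ℕ) : kernelCoeff lam k i =
    (ascPochhammer ℝ i).eval ((k : ℝ) + 1) / (ascPochhammer ℝ i).eval ((k : ℝ) + lam + 1) *
      risingCoeff (1 - lam) i := by
  rw [kernelCoeff, risingCoeff, div_mul_div_comm]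

/-- For `lam > 0` the quotient `(k+1)_i / (k+lam+1)_i` is at most one. -/
theorem abs_kernelCoeff_le_of_pos {lam : ℝ} (hlam : 0 < lam) (k i : ℕ) :
    |kernelCoeff lam k i| ≤ |risingCoeff (1 - lam) i| := by
  have hk : (0 : ℝ) ≤ k := k.cast_nonneg
  have h1 := ascPochhammer_pos i ((k : ℝ) + 1) (by positivity)
  have h2 := ascPochhammer_eval_mono (a := (k : ℝ) + 1) (b := k + lam + 1) (by positivity)
    (by linarith) i
  rw [kernelCoeff_eq, abs_mul, abs_of_nonneg (div_nonneg h1.le (h1.le.trans h2))]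
  exact mul_le_of_le_one_left (abs_nonneg _) (div_le_one_of_le₀ h2 (h1.le.trans h2))

theorem ascPochhammer_eval_mul_Gamma {x : ℝ} (hx : ∀ m : ℕ, x ≠ -m) (i : ℕ) :
    (ascPochhammer ℝ i).eval x * Gamma x = Gamma (x + i) := by
  induction i with
  | zero => simp
  | succ i ih =>
    rw [ascPochhammer_succ_eval, Nat.cast_succ, ← add_assoc,
      Gamma_add_one fun h => hx i (eq_neg_of_add_eq_zero_left h), ← ih]
    ring

theorem ascPochhammer_eval_eq_Gamma_div {x : ℝ} (hx : 0 < x) (i : ℕ) :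
    (ascPochhammer ℝ i).eval x = Gamma (x + i) / Gamma x := by
  rw [eq_div_iff (Gamma_pos_of_pos hx).ne', ascPochhammer_eval_mul_Gamma fun m => by
    have : (0 : ℝ) ≤ m := m.cast_nonneg
    linarith]

theorem ne_neg_natCast {lam : ℝ} (hlam : -1 / 2 < lam) (hlam0 : lam ≠ 0) (m : ℕ) : lam ≠ -m := by
  rintro hm
  rcases m with _ | m
  · exact hlam0 (by simpa using hm)
  · have : (0 : ℝ) ≤ m := m.cast_nonneg
    push_cast at hm
    linarith

/-- Log-convexity of `Γ`: the points `x + d` and `x + 2d` divide the segment from `x` to `x + 3d`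
symmetrically. -/
theorem Gamma_mul_Gamma_le {x d : ℝ} (hx : 0 < x) (hd : 0 ≤ d) :
    Gamma (x + d) * Gamma (x + 2 * d) ≤ Gamma x * Gamma (x + 3 * d) := by
  have hp : ∀ y : ℝ, 0 < y → 0 < Gamma y := fun y hy => Gamma_pos_of_pos hy
  have p0 := hp x hx
  have p1 := hp (x + d) (by positivity)
  have p2 := hp (x + 2 * d) (by positivity)
  have p3 := hp (x + 3 * d) (by positivity)
  rw [← Real.log_le_log_iff (by positivity) (by positivity), Real.log_mul p1.ne' p2.ne',
    Real.log_mul p0.ne' p3.ne']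
  have hc := Real.convexOn_log_Gamma.2 (x := x) (y := x + 3 * d) hx
    (show (0 : ℝ) < x + 3 * d by positivity)
  have h1 := hc (a := 2 / 3) (b := 1 / 3) (by norm_num) (by norm_num) (by norm_num)
  have h2 := hc (a := 1 / 3) (b := 2 / 3) (by norm_num) (by norm_num) (by norm_num)
  simp only [smul_eq_mul, Function.comp_apply] at h1 h2
  rw [show 2 / 3 * x + 1 / 3 * (x + 3 * d) = x + d by ring] at h1
  rw [show 1 / 3 * x + 2 / 3 * (x + 3 * d) = x + 2 * d by ring] at h2
  linarith

/-- For `lam ≤ 0` each factor `(k+1+i)/(k+lam+1+i)` decreases in `k`, so `k = 0` is the worst case.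
-/
theorem ascPochhammer_ratio_antitone {lam : ℝ} (hlam : -1 < lam) (hlam0 : lam ≤ 0) (k i : ℕ) :
    (ascPochhammer ℝ i).eval ((k : ℝ) + 1) / (ascPochhammer ℝ i).eval ((k : ℝ) + lam + 1) ≤
      (ascPochhammer ℝ i).eval 1 / (ascPochhammer ℝ i).eval (1 + lam) := by
  have hk : (0 : ℝ) ≤ k := k.cast_nonneg
  have hl : 0 < 1 + lam := by linarith
  have hl' : 0 < (k : ℝ) + lam + 1 := by linarith
  induction i with
  | zero => simp
  | succ i ih =>
    simp only [ascPochhammer_succ_eval]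
    rw [mul_div_mul_comm, mul_div_mul_comm]
    have h1 := ascPochhammer_pos i ((k : ℝ) + 1) (by positivity)
    have h2 := ascPochhammer_pos i _ hl'
    have h3 := ascPochhammer_pos i (1 : ℝ) one_pos
    have h4 := ascPochhammer_pos i _ hl
    refine mul_le_mul ih ?_ (by positivity) (by positivity)
    rw [div_le_div_iff₀ (by positivity) (by positivity)]
    nlinarith

/-- After reduction to `k = 0`, the claim in Gamma functions is `Γ(1+i) Γ(1-lam+i) ≤ Γ(1+lam+i)
Γ(1-2 lam+i)`, which is `Gamma_mul_Gamma_le` with `x = 1 + lam + i` and `d = -lam`. -/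
theorem abs_kernelCoeff_le_of_neg {lam : ℝ} (hlam : -1 / 2 < lam) (hlam0 : lam < 0) (k i : ℕ) :
    |kernelCoeff lam k i| ≤
      Gamma (1 + lam) * Gamma (1 - 2 * lam) / Gamma (1 - lam) * risingCoeff (1 - 2 * lam) i := by
  have hk : (0 : ℝ) ≤ k := k.cast_nonneg
  have h1 := ascPochhammer_pos i ((k : ℝ) + 1) (by positivity)
  have h2 := ascPochhammer_pos i ((k : ℝ) + lam + 1) (by linarith)
  have h3 := ascPochhammer_pos i (1 - lam) (by linarith)
  rw [kernelCoeff_eq, abs_of_nonneg (by rw [risingCoeff]; positivity)]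
  calc _ ≤ (ascPochhammer ℝ i).eval 1 / (ascPochhammer ℝ i).eval (1 + lam) *
        risingCoeff (1 - lam) i := by
        refine mul_le_mul_of_nonneg_right
          (ascPochhammer_ratio_antitone (by linarith) hlam0.le k i) ?_
        rw [risingCoeff]; positivity
    _ ≤ _ := by
        have g1 := Gamma_pos_of_pos (show 0 < 1 + lam by linarith)
        have g2 := Gamma_pos_of_pos (show 0 < 1 - lam by linarith)
        have g3 := Gamma_pos_of_pos (show 0 < 1 - 2 * lam by linarith)
        have hi : (0 : ℝ) ≤ i := i.cast_nonneg
        have g4 := Gamma_pos_of_pos (show 0 < 1 + lam + i by linarith)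
        rw [risingCoeff, risingCoeff, ascPochhammer_eval_eq_Gamma_div one_pos,
          ascPochhammer_eval_eq_Gamma_div (show 0 < 1 + lam by linarith),
          ascPochhammer_eval_eq_Gamma_div (show 0 < 1 - lam by linarith),
          ascPochhammer_eval_eq_Gamma_div (show 0 < 1 - 2 * lam by linarith), Gamma_one, div_one]
        have h := Gamma_mul_Gamma_le (x := 1 + lam + i) (d := -lam) (by linarith) (by linarith)
        rw [show 1 + lam + i + -lam = 1 + (i : ℝ) by ring,
          show 1 + lam + i + 2 * -lam = 1 - lam + (i : ℝ) by ring,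
          show 1 + lam + i + 3 * -lam = 1 - 2 * lam + (i : ℝ) by ring] at h
        calc _ = Gamma (1 + lam) / (Gamma (1 - lam) * Gamma (1 + lam + i) * i.factorial) *
              (Gamma (1 + i) * Gamma (1 - lam + i)) := by field_simp
          _ ≤ Gamma (1 + lam) / (Gamma (1 - lam) * Gamma (1 + lam + i) * i.factorial) *
              (Gamma (1 + lam + i) * Gamma (1 - 2 * lam + i)) := by gcongr
          _ = _ := by
            generalize Gamma (1 - 2 * lam) = G at g3 ⊢
            field_simp

/-- The sign of `(1 - lam)_i` is eventually constant, so the series telescopes. -/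
theorem summable_abs_risingCoeff_one {lam : ℝ} (hlam : 1 < lam) :
    Summable fun i => |risingCoeff (1 - lam) i| := by
  obtain ⟨N, hN⟩ := exists_nat_gt lam
  rw [← summable_nat_add_iff N]
  have hrec : ∀ i : ℕ, ((i + N + 1 : ℕ) : ℝ) * |risingCoeff (1 - lam) (i + 1 + N)| =
      (i + N : ℕ) * |risingCoeff (1 - lam) (i + N)| -
        (lam - 1) * |risingCoeff (1 - lam) (i + N)| := fun i => by
    have h : ((i + N + 1 : ℕ) : ℝ) * risingCoeff (1 - lam) (i + 1 + N) =
        (1 - lam + (i + N : ℕ)) * risingCoeff (1 - lam) (i + N) := by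
      rw [show i + 1 + N = i + N + 1 by ring, risingCoeff, risingCoeff, ascPochhammer_succ_eval,
        Nat.factorial_succ]
      push_cast
      field_simp
    have h2 := congrArg abs h
    have hi : (0 : ℝ) ≤ i := i.cast_nonneg
    rw [abs_mul, abs_mul, abs_of_nonneg (Nat.cast_nonneg _),
      abs_of_nonneg (show 0 ≤ 1 - lam + ((i + N : ℕ) : ℝ) by push_cast; linarith)] at h2
    rw [h2]
    ring
  have hsum : ∀ n : ℕ, (lam - 1) * ∑ i ∈ Finset.range n, |risingCoeff (1 - lam) (i + N)| =
      N * |risingCoeff (1 - lam) N| - ((n + N : ℕ) : ℝ) * |risingCoeff (1 - lam) (n + N)| := by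
    intro n
    induction n with
    | zero => simp
    | succ n ih =>
      rw [Finset.sum_range_succ, mul_add, ih, show n + 1 + N = n + N + 1 by ring]
      have := hrec n
      rw [show n + 1 + N = n + N + 1 by ring] at this
      linarith
  refine summable_of_sum_range_le (c := N * |risingCoeff (1 - lam) N| / (lam - 1))
    (fun _ => abs_nonneg _) fun n => ?_
  rw [le_div_iff₀ (by linarith), mul_comm, hsum n]
  have : 0 ≤ ((n + N : ℕ) : ℝ) * |risingCoeff (1 - lam) (n + N)| := by positivity
  linarith

theorem tendsto_ascPochhammer_ratio (lam : ℝ) (i : ℕ) :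
    Tendsto (fun k : ℕ => (ascPochhammer ℝ i).eval ((k : ℝ) + 1) /
      (ascPochhammer ℝ i).eval ((k : ℝ) + lam + 1)) atTop (𝓝 1) := by
  induction i with
  | zero => simp
  | succ i ih =>
    simp only [ascPochhammer_succ_eval, mul_div_mul_comm]
    suffices h : Tendsto (fun k : ℕ => ((k : ℝ) + 1 + i) / (k + lam + 1 + i)) atTop (𝓝 1) by
      simpa using ih.mul h
    have h : Tendsto (fun k : ℕ => (k : ℝ) + (lam + 1 + i)) atTop atTop :=
      tendsto_atTop_add_const_right _ _ tendsto_natCast_atTop_atTop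
    have h2 := (tendsto_const_nhds (x := lam)).div_atTop h
    have h3 := (tendsto_const_nhds (x := (1 : ℝ))).sub h2
    rw [sub_zero] at h3
    refine h3.congr' ?_
    filter_upwards [h.eventually_gt_atTop 0] with k hk
    rw [show (k : ℝ) + lam + 1 + i = k + (lam + 1 + i) by ring, eq_div_iff hk.ne', sub_mul,
      div_mul_cancel₀ _ hk.ne']
    ring

theorem norm_tsum_kernelCoeff_le {lam : ℝ} {k : ℕ} {r : ℝ} {w : ℂ} (hw : ‖w‖ = r)
    (hs : Summable fun i => |kernelCoeff lam k i| * r ^ i) :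
    ‖∑' i, (kernelCoeff lam k i : ℂ) * w ^ i‖ ≤ ∑' i, |kernelCoeff lam k i| * r ^ i :=
  tsum_of_norm_bounded hs.hasSum fun i => by
    rw [norm_mul, norm_pow, hw, Complex.norm_real, Real.norm_eq_abs]

theorem summable_kernelCoeff {lam : ℝ} (hlam : -1 / 2 < lam) (hlam0 : lam ≠ 0) (k : ℕ) {r : ℝ}
    (h0 : 0 ≤ r) (h1 : r < 1) : Summable fun i => |kernelCoeff lam k i| * r ^ i := by
  rcases lt_or_gt_of_ne hlam0 with h | h
  · refine Summable.of_nonneg_of_le (fun i => by positivity) (fun i =>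
      mul_le_mul_of_nonneg_right (abs_kernelCoeff_le_of_neg hlam h k i) (pow_nonneg h0 i)) ?_
    simp only [mul_assoc]
    exact (hasSum_risingCoeff _ h0 h1).summable.mul_left _
  · exact Summable.of_nonneg_of_le (fun i => by positivity) (fun i =>
      mul_le_mul_of_nonneg_right (abs_kernelCoeff_le_of_pos h k i) (pow_nonneg h0 i))
      (summable_abs_risingCoeff _ h0 h1)

/-- The dependence of `bernsteinD` on `lam`. -/
def bernsteinFactor (lam ρ : ℝ) : ℝ :=
  if lam < 0 then
      |Gamma lam| * Gamma (1 + lam) * Gamma (1 - 2 * lam) / Gamma (1 - lam) *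
        (1 - 1 / ρ ^ 2) ^ (2 * lam - 1)
    else if lam ≤ 1 then 1 / lam * (1 - 1 / ρ ^ 2) ^ (lam - 1)
    else Gamma lam * (1 + 1 / ρ ^ 2) ^ (lam - 1)

theorem one_div_sq_lt_one {ρ : ℝ} (hρ : 1 < ρ) : 1 / ρ ^ 2 < 1 := by
  rw [div_lt_one (by positivity)]
  exact one_lt_pow₀ hρ two_ne_zero

theorem kernel_bound_of_neg {lam : ℝ} (hlam : -1 / 2 < lam) (hlam0 : lam < 0) {ρ : ℝ} (hρ : 1 < ρ)
    (k : ℕ) {w : ℂ} (hw : ‖w‖ = 1 / ρ ^ 2) :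
    |Gamma lam| * ‖∑' i, (kernelCoeff lam k i : ℂ) * w ^ i‖ ≤ bernsteinFactor lam ρ := by
  have h0 : 0 ≤ 1 / ρ ^ 2 := by positivity
  have h1 := one_div_sq_lt_one hρ
  have hs := summable_kernelCoeff hlam hlam0.ne k h0 h1
  have hB := (hasSum_risingCoeff (1 - 2 * lam) h0 h1).mul_left
    (Gamma (1 + lam) * Gamma (1 - 2 * lam) / Gamma (1 - lam))
  have h2 := hasSum_le (f := fun i => |kernelCoeff lam k i| * (1 / ρ ^ 2) ^ i) (fun i => by
    rw [← mul_assoc]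
    exact mul_le_mul_of_nonneg_right (abs_kernelCoeff_le_of_neg hlam hlam0 k i) (pow_nonneg h0 i)) hs.hasSum hB
  rw [bernsteinFactor, if_pos hlam0]
  calc _ ≤ |Gamma lam| * _ :=
        mul_le_mul_of_nonneg_left ((norm_tsum_kernelCoeff_le hw hs).trans h2) (abs_nonneg _)
    _ = _ := by rw [show 2 * lam - 1 = -(1 - 2 * lam) by ring]; ring

theorem Gamma_le_one_of_mem_Icc {x : ℝ} (hx : x ∈ Icc (1 : ℝ) 2) : Gamma x ≤ 1 := by
  have h := Real.convexOn_Gamma.le_on_segment (x := 1) (y := 2) (z := x) (by simp) (by simp)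
    (by rwa [segment_eq_Icc (by norm_num)])
  simpa [Gamma_two] using h

/-- The majorant `(1-lam)_i / i!` is nonnegative and sums to `(1 - r)^(lam-1)` with `r = ρ⁻²`. The
prefactor uses `lam Γ(lam) = Γ(lam+1) ≤ 1`. -/
theorem kernel_bound_of_le_one {lam : ℝ} (hlam : 0 < lam) (hlam1 : lam ≤ 1) {ρ : ℝ} (hρ : 1 < ρ)
    (k : ℕ) {w : ℂ} (hw : ‖w‖ = 1 / ρ ^ 2) :
    |Gamma lam| * ‖∑' i, (kernelCoeff lam k i : ℂ) * w ^ i‖ ≤ bernsteinFactor lam ρ := by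
  have h0 : 0 ≤ 1 / ρ ^ 2 := by positivity
  have h1 := one_div_sq_lt_one hρ
  have hs := summable_kernelCoeff (by linarith) hlam.ne' k h0 h1
  have h2 := hasSum_le (fun i => by
    have h3 : 0 ≤ risingCoeff (1 - lam) i := by
      rcases hlam1.lt_or_eq with h | h
      · have := ascPochhammer_pos i (1 - lam) (by linarith)
        rw [risingCoeff]; positivity
      · rw [risingCoeff, h, sub_self, ascPochhammer_eval_zero]; split_ifs <;> positivity
    have h4 := abs_kernelCoeff_le_of_pos hlam k i
    rw [abs_of_nonneg h3] at h4
    exact mul_le_mul_of_nonneg_right h4 (pow_nonneg h0 i)) hs.hasSum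
    (hasSum_risingCoeff (1 - lam) h0 h1)
  have hG := Gamma_pos_of_pos hlam
  have h5 : Gamma lam ≤ 1 / lam := by
    rw [le_div_iff₀ hlam, mul_comm, ← Gamma_add_one hlam.ne']
    exact Gamma_le_one_of_mem_Icc ⟨by linarith, by linarith⟩
  rw [bernsteinFactor, if_neg hlam.not_gt, if_pos hlam1, abs_of_pos hG,
    show lam - 1 = -(1 - lam) by ring]
  exact mul_le_mul h5 ((norm_tsum_kernelCoeff_le hw hs).trans h2) (norm_nonneg _) (by positivity)

/-- For `lam > 1` the majorant `|(1-lam)_i| / i!` is summable even at radius one, which makes the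
constant independent of `ρ` and `k`. -/
theorem exists_kernel_bound_of_one_lt {lam : ℝ} (hlam : 1 < lam) :
    ∃ Q : ℝ, 0 < Q ∧ ∀ ρ : ℝ, 1 < ρ → ∀ (k : ℕ) (w : ℂ), ‖w‖ = 1 / ρ ^ 2 →
      |Gamma lam| * ‖∑' i, (kernelCoeff lam k i : ℂ) * w ^ i‖ ≤ Q * bernsteinFactor lam ρ := by
  refine ⟨∑' i, |risingCoeff (1 - lam) i|, (summable_abs_risingCoeff_one hlam).tsum_pos
    (fun _ => abs_nonneg _) 0 (by simp [risingCoeff]), fun ρ hρ k w hw => ?_⟩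
  have h0 : 0 ≤ 1 / ρ ^ 2 := by positivity
  have h1 := one_div_sq_lt_one hρ
  have hs := summable_kernelCoeff (by linarith) (by linarith : lam ≠ 0) k h0 h1
  have h2 := hasSum_le (fun i =>
    (mul_le_of_le_one_right (abs_nonneg _) (pow_le_one₀ h0 h1.le)).trans
      (abs_kernelCoeff_le_of_pos (by linarith) k i)) hs.hasSum
    (summable_abs_risingCoeff_one hlam).hasSum
  have hG := Gamma_pos_of_pos (show 0 < lam by linarith)
  have hQ : 0 ≤ ∑' i, |risingCoeff (1 - lam) i| := tsum_nonneg fun _ => abs_nonneg _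
  rw [bernsteinFactor, if_neg (by linarith), if_neg (by linarith), abs_of_pos hG]
  have h3 : 1 ≤ (1 + 1 / ρ ^ 2) ^ (lam - 1) := one_le_rpow (by linarith) (by linarith)
  have h4 := (norm_tsum_kernelCoeff_le hw hs).trans h2
  calc _ ≤ Gamma lam * ∑' i, |risingCoeff (1 - lam) i| := by gcongr
    _ = (∑' i, |risingCoeff (1 - lam) i|) * (Gamma lam * 1) := by ring
    _ ≤ _ := by gcongr

/-- By dominated convergence the kernel tends to `(1 - w)^(lam-1)` uniformly on the circle, and `|1
- w| ≤ 1 + ρ⁻²`. -/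
theorem eventually_kernel_bound_of_one_lt {lam : ℝ} (hlam : 1 < lam) {ρ : ℝ} (hρ : 1 < ρ) {Q : ℝ}
    (hQ : 1 < Q) : ∀ᶠ k : ℕ in atTop, ∀ w : ℂ, ‖w‖ = 1 / ρ ^ 2 →
      |Gamma lam| * ‖∑' i, (kernelCoeff lam k i : ℂ) * w ^ i‖ ≤ Q * bernsteinFactor lam ρ := by
  have h0 : 0 ≤ 1 / ρ ^ 2 := by positivity
  have h1 := one_div_sq_lt_one hρ
  have hG := Gamma_pos_of_pos (show 0 < lam by linarith)
  have hsr := summable_abs_risingCoeff (1 - lam) h0 h1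
  have hd : ∀ k i, |kernelCoeff lam k i - risingCoeff (1 - lam) i| * (1 / ρ ^ 2) ^ i ≤
      2 * (|risingCoeff (1 - lam) i| * (1 / ρ ^ 2) ^ i) := fun k i => by
    rw [← mul_assoc]
    refine mul_le_mul_of_nonneg_right ((abs_sub _ _).trans ?_) (pow_nonneg h0 i)
    have := abs_kernelCoeff_le_of_pos (show 0 < lam by linarith) k i
    linarith
  have hT : Tendsto (fun k : ℕ => ∑' i, |kernelCoeff lam k i - risingCoeff (1 - lam) i| *
      (1 / ρ ^ 2) ^ i) atTop (𝓝 (∑' i : ℕ, (0 : ℝ))) := by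
    refine tendsto_tsum_of_dominated_convergence (hsr.mul_left 2) (fun i => ?_)
      (Eventually.of_forall fun k i => ?_)
    · have h := (((tendsto_ascPochhammer_ratio lam i).mul_const (risingCoeff (1 - lam) i)).sub_const
        (risingCoeff (1 - lam) i)).abs.mul_const ((1 / ρ ^ 2) ^ i)
      simp only [one_mul, sub_self, abs_zero, zero_mul] at h
      simpa only [kernelCoeff_eq] using h
    · rw [Real.norm_of_nonneg (by positivity)]
      exact hd k i
  rw [tsum_zero] at hT
  filter_upwards [hT.eventually_le_const (show 0 < Q - 1 by linarith)] with k hk w hw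
  have hs := (summable_kernelCoeff (by linarith) (by linarith : lam ≠ 0) k h0 h1)
  have hsw : Summable fun i => (kernelCoeff lam k i : ℂ) * w ^ i := by
    refine Summable.of_norm (hs.congr fun i => ?_)
    rw [norm_mul, norm_pow, hw, Complex.norm_real, Real.norm_eq_abs]
  have hb := hasSum_risingCoeff_complex (1 - lam) (w := w) (by rwa [hw])
  have hsub := hsw.hasSum.sub hb
  have hle : ‖(∑' i, (kernelCoeff lam k i : ℂ) * w ^ i) - (1 - w) ^ ((-(1 - lam) : ℝ) : ℂ)‖ ≤
      Q - 1 := by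
    rw [← hsub.tsum_eq]
    refine (tsum_of_norm_bounded (Summable.of_nonneg_of_le (fun i => by positivity) (hd k)
      (hsr.mul_left 2)).hasSum fun i => ?_).trans hk
    rw [← sub_mul, norm_mul, norm_pow, hw, ← Complex.ofReal_sub, Complex.norm_real,
      Real.norm_eq_abs]
  have h3 : 1 ≤ (1 + 1 / ρ ^ 2) ^ (lam - 1) := one_le_rpow (by linarith) (by linarith)
  have h4 : ‖(1 - w) ^ ((-(1 - lam) : ℝ) : ℂ)‖ ≤ (1 + 1 / ρ ^ 2) ^ (lam - 1) := by
    rw [Complex.norm_cpow_real, neg_sub]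
    refine rpow_le_rpow (norm_nonneg _) ?_ (by linarith)
    simpa [hw] using norm_sub_le (1 : ℂ) w
  have h5 := norm_le_norm_add_norm_sub' (∑' i, (kernelCoeff lam k i : ℂ) * w ^ i)
    ((1 - w) ^ ((-(1 - lam) : ℝ) : ℂ))
  rw [bernsteinFactor, if_neg (by linarith), if_neg (by linarith), abs_of_pos hG]
  -- The additive error `Q - 1` becomes a factor `Q` because `(1 + ρ⁻²)^(lam-1) ≥ 1`.
  have h6 : ‖∑' i, (kernelCoeff lam k i : ℂ) * w ^ i‖ ≤ Q * (1 + 1 / ρ ^ 2) ^ (lam - 1) := by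
    nlinarith
  calc _ ≤ Gamma lam * (Q * (1 + 1 / ρ ^ 2) ^ (lam - 1)) := by gcongr
    _ = _ := by ring

theorem bernsteinFactor_pos {lam : ℝ} (hlam : -1 / 2 < lam) (hlam0 : lam ≠ 0) {ρ : ℝ} (hρ : 1 < ρ) :
    0 < bernsteinFactor lam ρ := by
  have h0 : 0 ≤ 1 / ρ ^ 2 := by positivity
  have h1 : 0 < 1 - 1 / ρ ^ 2 := by linarith [one_div_sq_lt_one hρ]
  unfold bernsteinFactor
  split_ifs with h h'
  · have g0 : 0 < |Gamma lam| := abs_pos.2 (Gamma_ne_zero (ne_neg_natCast hlam hlam0))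
    have g1 := Gamma_pos_of_pos (show 0 < 1 + lam by linarith)
    have g2 := Gamma_pos_of_pos (show 0 < 1 - lam by linarith)
    have g3 := Gamma_pos_of_pos (show 0 < 1 - 2 * lam by linarith)
    positivity
  · have : 0 < lam := lt_of_le_of_ne (not_lt.1 h) hlam0.symm
    positivity
  · have := Gamma_pos_of_pos (show 0 < lam by linarith)
    positivity

theorem exists_kernel_bound {lam : ℝ} (hlam : -1 / 2 < lam) (hlam0 : lam ≠ 0) :
    ∃ Q : ℝ, 0 < Q ∧ ∀ ρ : ℝ, 1 < ρ → ∀ (k : ℕ) (w : ℂ), ‖w‖ = 1 / ρ ^ 2 →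
      |Gamma lam| * ‖∑' i, (kernelCoeff lam k i : ℂ) * w ^ i‖ ≤ Q * bernsteinFactor lam ρ := by
  rcases lt_or_gt_of_ne hlam0 with h | h
  · exact ⟨1, one_pos, fun ρ hρ k w hw => by
      rw [one_mul]; exact kernel_bound_of_neg hlam h hρ k hw⟩
  rcases le_or_gt lam 1 with h' | h'
  · exact ⟨1, one_pos, fun ρ hρ k w hw => by
      rw [one_mul]; exact kernel_bound_of_le_one h h' hρ k hw⟩
  · exact exists_kernel_bound_of_one_lt h'

theorem eventually_kernel_bound {lam : ℝ} (hlam : -1 / 2 < lam) (hlam0 : lam ≠ 0) {ρ : ℝ}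
    (hρ : 1 < ρ) {Q : ℝ} (hQ : 1 < Q) : ∀ᶠ k : ℕ in atTop, ∀ w : ℂ, ‖w‖ = 1 / ρ ^ 2 →
      |Gamma lam| * ‖∑' i, (kernelCoeff lam k i : ℂ) * w ^ i‖ ≤ Q * bernsteinFactor lam ρ := by
  have hB := bernsteinFactor_pos hlam hlam0 hρ
  have hB' : bernsteinFactor lam ρ ≤ Q * bernsteinFactor lam ρ := le_mul_of_one_le_left hB.le hQ.le
  rcases lt_or_gt_of_ne hlam0 with h | h
  · exact Eventually.of_forall fun k w hw => (kernel_bound_of_neg hlam h hρ k hw).trans hB'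
  rcases le_or_gt lam 1 with h' | h'
  · exact Eventually.of_forall fun k w hw => (kernel_bound_of_le_one h h' hρ k hw).trans hB'
  · exact eventually_kernel_bound_of_one_lt h' hρ hQ

/-! ### Growth of the coefficients and of the maxima. -/

theorem ascPochhammer_eval_eq_prod (s : ℝ) (n : ℕ) :
    (ascPochhammer ℝ n).eval s = ∏ i ∈ Finset.range n, (s + i) := by
  induction n with
  | zero => simp
  | succ n ih => rw [ascPochhammer_succ_eval, Finset.prod_range_succ, ih]

theorem tendsto_natCast_div_add (s : ℝ) :
    Tendsto (fun n : ℕ => (n : ℝ) / (s + n)) atTop (𝓝 1) := by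
  have h : Tendsto (fun n : ℕ => s + (n : ℝ)) atTop atTop :=
    tendsto_atTop_add_const_left _ _ tendsto_natCast_atTop_atTop
  have h2 := (tendsto_const_nhds (x := (1 : ℝ))).sub ((tendsto_const_nhds (x := s)).div_atTop h)
  rw [sub_zero] at h2
  refine h2.congr' ?_
  filter_upwards [h.eventually_gt_atTop 0] with k hk
  field_simp
  ring

/-- Euler's limit `n^s n! / (s)_(n+1) → Γ(s)`, inverted; the last factor `s + n` is replaced by `n`.
-/
theorem tendsto_risingCoeff {s : ℝ} (hs : ∀ m : ℕ, s ≠ -m) :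
    Tendsto (fun n : ℕ => risingCoeff s n * (n : ℝ) ^ (1 - s)) atTop (𝓝 (Gamma s)⁻¹) := by
  have h := ((Real.GammaSeq_tendsto_Gamma s).inv₀ (Gamma_ne_zero hs)).mul (tendsto_natCast_div_add s)
  rw [mul_one] at h
  refine h.congr' ?_
  filter_upwards [eventually_gt_atTop 0] with n hn
  have hn' : (0 : ℝ) < n := by exact_mod_cast hn
  have h1 : s + n ≠ 0 := fun h => hs n (eq_neg_of_add_eq_zero_left h)
  have h2 : (n : ℝ) ^ s ≠ 0 := (rpow_pos_of_pos hn' s).ne'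
  rw [GammaSeq, ← ascPochhammer_eval_eq_prod, ascPochhammer_succ_eval, risingCoeff,
    rpow_sub hn', rpow_one, inv_div]
  field_simp

theorem tendsto_gegenbauerSup {lam : ℝ} (hlam : -1 / 2 < lam) {j : ℕ} (hj : 1 ≤ j) :
    Tendsto (fun k : ℕ => gegenbauerSup lam j k * (k : ℝ) ^ (1 - 2 * (lam + j))) atTop
      (𝓝 (Gamma (2 * (lam + j)))⁻¹) := by
  have hj' : (1 : ℝ) ≤ j := by exact_mod_cast hj
  have hs : ∀ m : ℕ, 2 * (lam + j) ≠ -m := fun m => by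
    have : (0 : ℝ) ≤ m := m.cast_nonneg
    linarith
  rw [← tendsto_add_atTop_iff_nat j]
  have h1 : Tendsto (fun m : ℕ => ((m : ℝ) / (j + m)) ^ (-(1 - 2 * (lam + j)))) atTop (𝓝 1) := by
    simpa using (tendsto_natCast_div_add j).rpow_const (p := -(1 - 2 * (lam + j)))
      (Or.inl one_ne_zero)
  have h := (tendsto_risingCoeff hs).mul h1
  rw [mul_one] at h
  refine h.congr' ?_
  filter_upwards [eventually_gt_atTop 0] with m hm
  have hm' : (0 : ℝ) < m := by exact_mod_cast hm
  rw [gegenbauerSup, if_pos (Nat.le_add_left j m), Nat.add_sub_cancel, risingCoeff, rpow_neg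
    (by positivity), div_rpow hm'.le (by positivity), inv_div, mul_assoc, Nat.cast_add,
    mul_div_cancel₀ _ (rpow_pos_of_pos hm' _).ne', add_comm (m : ℝ)]

/-- The exponents `1 - lam` from `k!/(lam)_k` and `2(lam+j) - 1` from the maximum add up to `lam +
2j`. -/
theorem tendsto_growth {lam : ℝ} (hlam : -1 / 2 < lam) (hlam0 : lam ≠ 0) {j : ℕ} (hj : 1 ≤ j) :
    Tendsto (fun k : ℕ => |k.factorial / (ascPochhammer ℝ k).eval lam| * gegenbauerSup lam j k /
      (k : ℝ) ^ (lam + 2 * j)) atTop (𝓝 (|Gamma lam| / Gamma (2 * (lam + j)))) := by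
  have hs := ne_neg_natCast hlam hlam0
  have h := ((tendsto_risingCoeff hs).inv₀ (inv_ne_zero (Gamma_ne_zero hs))).abs.mul
    (tendsto_gegenbauerSup hlam hj)
  rw [inv_inv, ← div_eq_mul_inv] at h
  refine h.congr' ?_
  filter_upwards [eventually_gt_atTop 0] with k hk
  have hk' : (0 : ℝ) < k := by exact_mod_cast hk
  rw [mul_inv, abs_mul, risingCoeff, inv_div, abs_of_pos (inv_pos.2 (rpow_pos_of_pos hk' _)),
    ← rpow_neg hk'.le, div_eq_mul_inv _ ((k : ℝ) ^ _), ← rpow_neg hk'.le,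
    show -(lam + 2 * j) = -(1 - lam) + (1 - 2 * (lam + j)) by ring, rpow_add hk']
  ring

theorem gegenbauerSup_nonneg {lam : ℝ} (hlam : -1 / 2 < lam) {j : ℕ} (hj : 1 ≤ j) (k : ℕ) :
    0 ≤ gegenbauerSup lam j k := by
  have hj' : (1 : ℝ) ≤ j := by exact_mod_cast hj
  have := ascPochhammer_pos (k - j) (2 * (lam + j)) (by linarith)
  unfold gegenbauerSup
  split_ifs <;> positivity

theorem exists_growth_bound {lam : ℝ} (hlam : -1 / 2 < lam) (hlam0 : lam ≠ 0) {j : ℕ} (hj : 1 ≤ j) :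
    ∃ Q : ℝ, 0 < Q ∧ ∀ k : ℕ, 1 ≤ k →
      |k.factorial / (ascPochhammer ℝ k).eval lam| * gegenbauerSup lam j k ≤
        Q * (|Gamma lam| / Gamma (2 * (lam + j))) * (k : ℝ) ^ (lam + 2 * j) := by
  have hj' : (1 : ℝ) ≤ j := by exact_mod_cast hj
  obtain ⟨b, hb⟩ := (tendsto_growth hlam hlam0 hj).bddAbove_range
  have hG : 0 < |Gamma lam| / Gamma (2 * (lam + j)) :=
    div_pos (abs_pos.2 (Gamma_ne_zero (ne_neg_natCast hlam hlam0)))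
      (Gamma_pos_of_pos (by linarith))
  refine ⟨max b 1 / (|Gamma lam| / Gamma (2 * (lam + j))), by positivity, fun k hk => ?_⟩
  have hk' : (0 : ℝ) < k := by exact_mod_cast hk
  rw [div_mul_cancel₀ _ hG.ne', ← div_le_iff₀ (by positivity)]
  exact (hb ⟨k, rfl⟩).trans (le_max_left _ _)

theorem eventually_growth_bound {lam : ℝ} (hlam : -1 / 2 < lam) (hlam0 : lam ≠ 0) {j : ℕ}
    (hj : 1 ≤ j) {Q : ℝ} (hQ : 1 < Q) : ∀ᶠ k : ℕ in atTop,
      |k.factorial / (ascPochhammer ℝ k).eval lam| * gegenbauerSup lam j k ≤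
        Q * (|Gamma lam| / Gamma (2 * (lam + j))) * (k : ℝ) ^ (lam + 2 * j) := by
  have hj' : (1 : ℝ) ≤ j := by exact_mod_cast hj
  have hG : 0 < |Gamma lam| / Gamma (2 * (lam + j)) :=
    div_pos (abs_pos.2 (Gamma_ne_zero (ne_neg_natCast hlam hlam0)))
      (Gamma_pos_of_pos (by linarith))
  filter_upwards [(tendsto_growth hlam hlam0 hj).eventually_le_const (lt_mul_left hG hQ),
    eventually_gt_atTop 0] with k hk hk0
  have hk' : (0 : ℝ) < k := by exact_mod_cast hk0
  rwa [← div_le_iff₀ (by positivity)]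

/-! ### Tails of power times geometric series. -/

theorem summable_rpow_mul_geometric (a : ℝ) {q : ℝ} (h0 : 0 ≤ q) (h1 : q < 1) :
    Summable fun k : ℕ => (k : ℝ) ^ a * q ^ k := by
  rw [← summable_nat_add_iff 1]
  have hq : ‖q‖ < 1 := by rwa [Real.norm_of_nonneg h0]
  have h := (summable_nat_add_iff 1).2
    (summable_pow_mul_geometric_of_norm_lt_one (R := ℝ) ⌈a⌉₊ hq)
  refine Summable.of_nonneg_of_le (fun k => by positivity) (fun k => ?_) h
  refine mul_le_mul_of_nonneg_right ?_ (pow_nonneg h0 _)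
  rw [← rpow_natCast]
  refine rpow_le_rpow_of_exponent_le ?_ (Nat.le_ceil a)
  push_cast
  linarith [(k.cast_nonneg : (0 : ℝ) ≤ k)]

/-- The terms of the tail of `∑ k ^ a * q ^ k`, normalized by `n ^ a * q ^ n`. -/
theorem tail_term_eq (a q : ℝ) {n : ℕ} (hn : 1 ≤ n) (i : ℕ) :
    ((i + (n + 1) : ℕ) : ℝ) ^ a * q ^ (i + (n + 1)) =
      (n : ℝ) ^ a * q ^ n * ((1 + (i + 1) / n) ^ a * q ^ (i + 1)) := by
  have hn' : (0 : ℝ) < n := by exact_mod_cast hn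
  have : ((i + (n + 1) : ℕ) : ℝ) = n * (1 + (i + 1) / n) := by
    push_cast
    field_simp
    ring
  rw [this, mul_rpow hn'.le (by positivity)]
  ring

theorem tail_factor_le {a : ℝ} (ha : 0 ≤ a) {n : ℕ} (hn : 1 ≤ n) (i : ℕ) :
    (1 + ((i : ℝ) + 1) / n) ^ a ≤ ((i + 2 : ℕ) : ℝ) ^ a := by
  have hn' : (1 : ℝ) ≤ n := by exact_mod_cast hn
  refine rpow_le_rpow (by positivity) ?_ ha
  have := div_le_self (show (0 : ℝ) ≤ i + 1 by positivity) hn'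
  push_cast
  linarith

theorem summable_tail_majorant (a : ℝ) {q : ℝ} (h0 : 0 < q) (h1 : q < 1) :
    Summable fun i : ℕ => ((i + 2 : ℕ) : ℝ) ^ a * q ^ (i + 1) := by
  refine (((summable_nat_add_iff 2).2 (summable_rpow_mul_geometric a h0.le h1)).mul_left
    q⁻¹).congr fun i => ?_
  rw [show i + 2 = i + 1 + 1 by ring, pow_succ q (i + 1)]
  field_simp

theorem tail_le {a : ℝ} (ha : 0 ≤ a) {q : ℝ} (h0 : 0 < q) (h1 : q < 1) {n : ℕ} (hn : 1 ≤ n) :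
    ∑' i : ℕ, ((i + (n + 1) : ℕ) : ℝ) ^ a * q ^ (i + (n + 1)) ≤
      (∑' i : ℕ, ((i + 2 : ℕ) : ℝ) ^ a * q ^ (i + 1)) * ((n : ℝ) ^ a * q ^ n) := by
  have hs := summable_tail_majorant a h0 h1
  have hle : ∀ i : ℕ, (1 + ((i : ℝ) + 1) / n) ^ a * q ^ (i + 1) ≤
      ((i + 2 : ℕ) : ℝ) ^ a * q ^ (i + 1) := fun i =>
    mul_le_mul_of_nonneg_right (tail_factor_le ha hn i) (by positivity)
  simp only [tail_term_eq a q hn, tsum_mul_left]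
  rw [mul_comm]
  exact mul_le_mul_of_nonneg_right ((hs.of_nonneg_of_le (fun i => by positivity) hle).tsum_le_tsum
    hle hs) (by positivity)

/-- From `1 + t ≤ 2 exp(t/2)` with `t = (i+1)/n` the power growth is at most `2^a exp(ta/2)`. The
condition on `n` bounds `ta/2` by `(i+1) log ρ / 2`, leaving a geometric series of ratio `s =
ρ^(-1/2)`. -/
theorem tail_le_of_div_log_le {a : ℝ} (ha : 0 ≤ a) {ρ : ℝ} (hρ : 1 < ρ) {n : ℕ} (hn : 1 ≤ n)
    (h : a / Real.log ρ ≤ n) :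
    ∑' i : ℕ, ((i + (n + 1) : ℕ) : ℝ) ^ a * ρ⁻¹ ^ (i + (n + 1)) ≤
      2 ^ (a + 1) / Real.log ρ * ((n : ℝ) ^ a * ρ⁻¹ ^ n) := by
  have hn' : (0 : ℝ) < n := by exact_mod_cast hn
  have hL := Real.log_pos hρ
  set L := Real.log ρ with hLdef
  have hq : ρ⁻¹ = rexp (-L) := by rw [Real.exp_neg, hLdef, Real.exp_log (by linarith)]
  set s := rexp (-(L / 2)) with hs
  have hs1 : s < 1 := by rw [hs, Real.exp_lt_one_iff]; linarith
  have hs0 : 0 < s := Real.exp_pos _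
  have hle : ∀ i : ℕ, (1 + ((i : ℝ) + 1) / n) ^ a * ρ⁻¹ ^ (i + 1) ≤ 2 ^ a * s * s ^ i := by
    intro i
    set t : ℝ := ((i : ℝ) + 1) / n with ht
    have ht0 : 0 ≤ t := by positivity
    have h1 : 1 + t ≤ 2 * rexp (t / 2) := by linarith [Real.add_one_le_exp (t / 2)]
    have h2 : (1 + t) ^ a ≤ 2 ^ a * rexp (t / 2 * a) := by
      calc (1 + t) ^ a ≤ (2 * rexp (t / 2)) ^ a := rpow_le_rpow (by positivity) h1 ha
        _ = _ := by rw [mul_rpow (by norm_num) (Real.exp_pos _).le, ← Real.exp_mul]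
    have h3 : t / 2 * a ≤ (i + 1) * (L / 2) := by
      rw [div_le_iff₀ hL] at h
      rw [ht, div_div, div_mul_eq_mul_div, div_le_iff₀ (by positivity)]
      have : (0 : ℝ) ≤ i + 1 := by positivity
      nlinarith
    calc _ ≤ 2 ^ a * rexp ((i + 1) * (L / 2)) * ρ⁻¹ ^ (i + 1) := by
          have h4 := Real.exp_le_exp.2 h3
          have h5 : (1 + t) ^ a ≤ 2 ^ a * rexp ((i + 1) * (L / 2)) :=
            h2.trans (mul_le_mul_of_nonneg_left h4 (by positivity))
          exact mul_le_mul_of_nonneg_right h5 (by positivity)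
      _ = _ := by
          rw [hq, mul_assoc, mul_assoc, ← pow_succ', hs, ← Real.exp_nat_mul, ← Real.exp_nat_mul,
            ← Real.exp_add]
          congr 2
          push_cast
          ring
  have hsum := (summable_geometric_of_lt_one hs0.le hs1).mul_left (2 ^ a * s)
  simp only [tail_term_eq a _ hn, tsum_mul_left]
  rw [mul_comm]
  refine mul_le_mul_of_nonneg_right (((hsum.of_nonneg_of_le (fun i => by positivity)
    hle).tsum_le_tsum hle hsum).trans ?_) (by positivity)
  rw [tsum_mul_left, tsum_geometric_of_lt_one hs0.le hs1, ← div_eq_mul_inv,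
    div_le_div_iff₀ (by linarith) hL, rpow_add_one (by norm_num), mul_assoc, mul_assoc]
  refine mul_le_mul_of_nonneg_left ?_ (by positivity)
  -- The sum is `s/(1-s) = 1/(exp(L/2) - 1) ≤ 2/L`, whence the exponent `a + 1` of two.
  have h6 : s * rexp (L / 2) = 1 := by rw [hs, ← Real.exp_add]; simp
  nlinarith [Real.add_one_le_exp (L / 2)]

/-- The normalized tail tends to `∑ ρ^(-(i+1)) = 1/(ρ - 1)`, which is strictly below `1/log ρ`, so
the constant here is exactly one. -/
theorem eventually_tail_le {a : ℝ} (ha : 0 ≤ a) {ρ : ℝ} (hρ : 1 < ρ) : ∀ᶠ n : ℕ in atTop,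
    ∑' i : ℕ, ((i + (n + 1) : ℕ) : ℝ) ^ a * ρ⁻¹ ^ (i + (n + 1)) ≤
      1 / Real.log ρ * ((n : ℝ) ^ a * ρ⁻¹ ^ n) := by
  have h0 : 0 < ρ⁻¹ := by positivity
  have h1 : ρ⁻¹ < 1 := inv_lt_one_of_one_lt₀ hρ
  have hT : Tendsto (fun n : ℕ => ∑' i : ℕ, (1 + ((i : ℝ) + 1) / n) ^ a * ρ⁻¹ ^ (i + 1)) atTop
      (𝓝 (∑' i : ℕ, ρ⁻¹ ^ (i + 1))) := by
    refine tendsto_tsum_of_dominated_convergence (summable_tail_majorant a h0 h1) (fun i => ?_) ?_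
    · have h := (((tendsto_const_nhds (x := (i : ℝ) + 1)).div_atTop
        tendsto_natCast_atTop_atTop).const_add 1).rpow_const (p := a) (Or.inr ha)
      simpa using h.mul_const (ρ⁻¹ ^ (i + 1))
    · filter_upwards [eventually_ge_atTop 1] with n hn i
      rw [Real.norm_of_nonneg (by positivity)]
      exact mul_le_mul_of_nonneg_right (tail_factor_le ha hn i) (by positivity)
  have hval : ∑' i : ℕ, ρ⁻¹ ^ (i + 1) = 1 / (ρ - 1) := by
    simp only [pow_succ]
    rw [tsum_mul_right, tsum_geometric_of_lt_one h0.le h1]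
    have : ρ - 1 ≠ 0 := by linarith
    field_simp
  have hlt : 1 / (ρ - 1) < 1 / Real.log ρ :=
    one_div_lt_one_div_of_lt (Real.log_pos hρ) (Real.log_lt_sub_one_of_pos (by linarith) hρ.ne')
  rw [hval] at hT
  filter_upwards [hT.eventually_le_const hlt, eventually_ge_atTop 1] with n hn hn1
  simp only [tail_term_eq a _ hn1, tsum_mul_left]
  rw [mul_comm]
  exact mul_le_mul_of_nonneg_right hn (by positivity)

/-! ### Assembly of the error estimate. -/

theorem bernsteinLength_nonneg (ρ : ℝ) : 0 ≤ bernsteinLength ρ :=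
  intervalIntegral.integral_nonneg (by positivity) fun _ _ => norm_nonneg _

theorem bernsteinD_eq (lam ρ : ℝ) (f : ℂ → ℂ) : bernsteinD lam ρ f =
    bernsteinMax ρ f * bernsteinLength ρ / (π * ρ) * bernsteinFactor lam ρ := rfl

theorem bernsteinD_nonneg {lam : ℝ} (hlam : -1 / 2 < lam) (hlam0 : lam ≠ 0) {ρ : ℝ} (hρ : 1 < ρ)
    (f : ℂ → ℂ) : 0 ≤ bernsteinD lam ρ f := by
  have h1 := bernsteinMax_nonneg ρ f
  have h2 := bernsteinLength_nonneg ρ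
  have h3 := bernsteinFactor_pos hlam hlam0 hρ
  rw [bernsteinD_eq]
  positivity

/-- The `k`-th term of the differentiated expansion decays like `k ^ (lam + 2 j) / ρ ^ k`. -/
theorem norm_gegenbauerCoeff_mul_sup_le {lam : ℝ} (hlam : -1 / 2 < lam) (hlam0 : lam ≠ 0) {j : ℕ}
    (hj : 1 ≤ j) {ρ : ℝ} (hρ : 1 < ρ) {k : ℕ} {Q₁ Q₂ : ℝ} (hQ₁ : 0 ≤ Q₁)
    (h₁ : ∀ w : ℂ, ‖w‖ = 1 / ρ ^ 2 →
      |Gamma lam| * ‖∑' i, (kernelCoeff lam k i : ℂ) * w ^ i‖ ≤ Q₁ * bernsteinFactor lam ρ)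
    (h₂ : |k.factorial / (ascPochhammer ℝ k).eval lam| * gegenbauerSup lam j k ≤
        Q₂ * (|Gamma lam| / Gamma (2 * (lam + j))) * (k : ℝ) ^ (lam + 2 * j))
    {f : ℂ → ℂ} (hf : DiffContOnCl ℂ f (bernsteinRegion ρ)) :
    ‖gegenbauerCoeff lam (fun t : ℝ => f t) k‖ * gegenbauerSup lam j k ≤
      Q₁ * Q₂ * (bernsteinD lam ρ f / Gamma (2 * (lam + j))) *
        ((k : ℝ) ^ (lam + 2 * j) * ρ⁻¹ ^ k) := by
  have hG : 0 < |Gamma lam| := abs_pos.2 (Gamma_ne_zero (ne_neg_natCast hlam hlam0))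
  have h0 : 0 ≤ 1 / ρ ^ 2 := by positivity
  have hM := bernsteinMax_nonneg ρ f
  have hL := bernsteinLength_nonneg ρ
  have hB := (bernsteinFactor_pos hlam hlam0 hρ).le
  have h := norm_gegenbauerCoeff_le hlam hlam0 hρ hf k
    (summable_kernelCoeff hlam hlam0 k h0 (one_div_sq_lt_one hρ))
    (Φ := Q₁ * bernsteinFactor lam ρ / |Gamma lam|) fun w hw => by
      rw [le_div_iff₀ hG, mul_comm]
      exact h₁ w hw
  have hS := gegenbauerSup_nonneg hlam hj k
  rw [bernsteinD_eq]
  set A := bernsteinMax ρ f * bernsteinLength ρ / (π * ρ) with hA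
  have hA0 : 0 ≤ A := by positivity
  calc _ ≤ _ := mul_le_mul_of_nonneg_right h hS
    _ = A * (Q₁ * bernsteinFactor lam ρ / |Gamma lam|) * ρ⁻¹ ^ k *
        (|k.factorial / (ascPochhammer ℝ k).eval lam| * gegenbauerSup lam j k) := by ring
    _ ≤ A * (Q₁ * bernsteinFactor lam ρ / |Gamma lam|) * ρ⁻¹ ^ k *
        (Q₂ * (|Gamma lam| / Gamma (2 * (lam + j))) * (k : ℝ) ^ (lam + 2 * j)) :=
      mul_le_mul_of_nonneg_left h₂ (by positivity)
    _ = _ := by field_simp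

/-- `(lam)_j Γ(lam) = Γ(lam + j)` together with the duplication formula at `lam + j`. -/
theorem two_pow_mul_abs_ascPochhammer_div_Gamma {lam : ℝ} (hlam : -1 / 2 < lam) (hlam0 : lam ≠ 0)
    {j : ℕ} (hj : 1 ≤ j) :
    2 ^ j * |(ascPochhammer ℝ j).eval lam| / Gamma (2 * (lam + j)) =
      (2 : ℝ) ^ (1 - (j : ℝ) - 2 * lam) * √π / (|Gamma lam| * Gamma (lam + j + 1 / 2)) := by
  have hj' : (1 : ℝ) ≤ j := by exact_mod_cast hj
  have hs := ne_neg_natCast hlam hlam0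
  have hG : 0 < |Gamma lam| := abs_pos.2 (Gamma_ne_zero hs)
  have g1 := Gamma_pos_of_pos (show 0 < lam + j by linarith)
  have g2 := Gamma_pos_of_pos (show 0 < 2 * (lam + j) by linarith)
  have g3 := Gamma_pos_of_pos (show 0 < lam + j + 1 / 2 by linarith)
  have h1 := congrArg abs (ascPochhammer_eval_mul_Gamma hs j)
  rw [abs_mul, abs_of_pos g1] at h1
  have h2 := Real.Gamma_mul_Gamma_add_half (lam + j)
  have h3 : (2 : ℝ) ^ j * (2 : ℝ) ^ (1 - 2 * (lam + j)) = (2 : ℝ) ^ (1 - (j : ℝ) - 2 * lam) := by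
    rw [← rpow_natCast, ← rpow_add two_pos]
    congr 1
    ring
  rw [div_eq_div_iff g2.ne' (by positivity), ← h3]
  linear_combination (2 : ℝ) ^ j * Gamma (lam + j + 1 / 2) * h1 + (2 : ℝ) ^ j * h2

theorem summable_norm_gegenbauerCoeff_mul_sup {lam : ℝ} (hlam : -1 / 2 < lam) (hlam0 : lam ≠ 0)
    {j : ℕ} (hj : 1 ≤ j) {ρ : ℝ} (hρ : 1 < ρ) {f : ℂ → ℂ}
    (hf : DiffContOnCl ℂ f (bernsteinRegion ρ)) :
    Summable fun k => ‖gegenbauerCoeff lam (fun t : ℝ => f t) k‖ * gegenbauerSup lam j k := by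
  obtain ⟨Q₁, hQ₁, h₁⟩ := exists_kernel_bound hlam hlam0
  obtain ⟨Q₂, hQ₂, h₂⟩ := exists_growth_bound hlam hlam0 hj
  rw [← summable_nat_add_iff 1]
  refine Summable.of_nonneg_of_le
    (fun k => mul_nonneg (norm_nonneg _) (gegenbauerSup_nonneg hlam hj _))
    (fun k => norm_gegenbauerCoeff_mul_sup_le hlam hlam0 hj hρ hQ₁.le (h₁ ρ hρ (k + 1))
      (h₂ (k + 1) (Nat.le_add_left 1 k)) hf) ?_
  exact ((summable_nat_add_iff 1).2 (summable_rpow_mul_geometric (lam + 2 * j)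
    (inv_nonneg.2 (zero_le_one.trans hρ.le)) (inv_lt_one_of_one_lt₀ hρ))).mul_left _

/-- Bounds for the kernels, for the growth of the coefficients and for the tail of
`∑ k ^ (lam + 2 j) / ρ ^ k` combine to the error estimate. -/
theorem diffErrorEstimate_of_bounds {lam : ℝ} (hlam : -1 / 2 < lam) (hlam0 : lam ≠ 0) {j : ℕ}
    (hj : 1 ≤ j) {ρ : ℝ} (hρ : 1 < ρ) {n : ℕ} {Q₁ Q₂ K : ℝ} (hQ₁ : 0 ≤ Q₁) (hQ₂ : 0 ≤ Q₂)
    (h₁ : ∀ k, n < k → ∀ w : ℂ, ‖w‖ = 1 / ρ ^ 2 →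
      |Gamma lam| * ‖∑' i, (kernelCoeff lam k i : ℂ) * w ^ i‖ ≤ Q₁ * bernsteinFactor lam ρ)
    (h₂ : ∀ k : ℕ, n < k → |k.factorial / (ascPochhammer ℝ k).eval lam| * gegenbauerSup lam j k ≤
        Q₂ * (|Gamma lam| / Gamma (2 * (lam + j))) * (k : ℝ) ^ (lam + 2 * j))
    (hK : ∑' i : ℕ, ((i + (n + 1) : ℕ) : ℝ) ^ (lam + 2 * j) * ρ⁻¹ ^ (i + (n + 1)) ≤
      K / Real.log ρ * ((n : ℝ) ^ (lam + 2 * j) * ρ⁻¹ ^ n)) :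
    DiffErrorEstimate lam j ρ n (Q₁ * Q₂ * K) := by
  intro f hf x hx
  have hj' : (1 : ℝ) ≤ j := by exact_mod_cast hj
  have hs := summable_norm_gegenbauerCoeff_mul_sup hlam hlam0 hj hρ hf
  have hD := bernsteinD_nonneg hlam hlam0 hρ f
  have hG := Gamma_pos_of_pos (show 0 < 2 * (lam + j) by linarith)
  have hr := (summable_nat_add_iff (n + 1)).2 (summable_rpow_mul_geometric (lam + 2 * j)
    (inv_nonneg.2 (zero_le_one.trans hρ.le)) (inv_lt_one_of_one_lt₀ hρ))
  have ht := ((summable_nat_add_iff (n + 1)).2 hs).tsum_le_tsum (fun i =>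
    norm_gegenbauerCoeff_mul_sup_le hlam hlam0 hj hρ hQ₁ (h₁ (i + (n + 1)) (by omega))
      (h₂ (i + (n + 1)) (by omega)) hf) (hr.mul_left _)
  rw [tsum_mul_left] at ht
  have hid := two_pow_mul_abs_ascPochhammer_div_Gamma hlam hlam0 hj
  calc _ ≤ _ := norm_iteratedDeriv_sub_le hlam hlam0 hj hρ hf hs n hx
    _ ≤ _ := mul_le_mul_of_nonneg_left (ht.trans (mul_le_mul_of_nonneg_left hK (by positivity)))
      (by positivity)
    _ = Q₁ * Q₂ * K * ((2 ^ j * |(ascPochhammer ℝ j).eval lam| / Gamma (2 * (lam + j))) *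
        bernsteinD lam ρ f / Real.log ρ * ((n : ℝ) ^ (lam + 2 * j) / ρ ^ n)) := by
      rw [inv_pow]
      ring
    _ = _ := by
      rw [hid, diffErrorRate]
      ring

end

theorem theorem6p5 (lam : ℝ) (hlam : -1 / 2 < lam) (hlam0 : lam ≠ 0) (j : ℕ) (hj : 1 ≤ j) :
    -- a constant valid for all degrees and all functions
    (∀ ρ : ℝ, 1 < ρ → ∃ c : ℝ, 0 < c ∧ ∀ n : ℕ, 1 ≤ n → DiffErrorEstimate lam j ρ n c) ∧
    -- the constant does not depend on the ellipse once `n` exceeds `(lam + 2 j) / log ρ`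
    (∃ c : ℝ, 0 < c ∧ ∀ ρ : ℝ, 1 < ρ → ∀ n : ℕ, 1 ≤ n → (lam + 2 * j) / Real.log ρ ≤ n →
      DiffErrorEstimate lam j ρ n c) ∧
    -- the constant may be taken as close to one as desired for large `n`
    (∀ ρ : ℝ, 1 < ρ → ∀ c : ℝ, 1 < c → ∃ N : ℕ, ∀ n : ℕ, N ≤ n →
      DiffErrorEstimate lam j ρ n c) := by
  have ha : 0 ≤ lam + 2 * j := by
    have : (1 : ℝ) ≤ j := by exact_mod_cast hj
    linarith
  obtain ⟨Q₁, hQ₁, h₁⟩ := exists_kernel_bound hlam hlam0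
  obtain ⟨Q₂, hQ₂, h₂⟩ := exists_growth_bound hlam hlam0 hj
  refine ⟨fun ρ hρ => ?_, ?_, fun ρ hρ c hc => ?_⟩
  · have h0 : 0 < ρ⁻¹ := by positivity
    have h1 : ρ⁻¹ < 1 := inv_lt_one_of_one_lt₀ hρ
    have hL := Real.log_pos hρ
    have hpos := (summable_tail_majorant (lam + 2 * j) h0 h1).tsum_pos (fun i => by positivity) 0
      (by positivity)
    -- The factor `log ρ` cancels the `1/log ρ` in the stated rate.
    refine ⟨Q₁ * Q₂ * ((∑' i : ℕ, ((i + 2 : ℕ) : ℝ) ^ (lam + 2 * j) * ρ⁻¹ ^ (i + 1)) * Real.log ρ),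
      by positivity, fun n hn => ?_⟩
    refine diffErrorEstimate_of_bounds hlam hlam0 hj hρ hQ₁.le hQ₂.le (fun k _ => h₁ ρ hρ k)
      (fun k hk => h₂ k (by omega)) ?_
    rw [mul_div_cancel_right₀ _ hL.ne']
    exact tail_le ha h0 h1 hn
  · refine ⟨Q₁ * Q₂ * 2 ^ (lam + 2 * j + 1), by positivity, fun ρ hρ n hn h => ?_⟩
    exact diffErrorEstimate_of_bounds hlam hlam0 hj hρ hQ₁.le hQ₂.le (fun k _ => h₁ ρ hρ k)
      (fun k hk => h₂ k (by omega)) (tail_le_of_div_log_le ha hρ hn h)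
  -- The slack `c` is shared equally between kernel and growth; the tail needs none.
  · have hc' : 1 < √c := Real.lt_sqrt_of_sq_lt (by simpa using hc)
    have hev := (eventually_kernel_bound hlam hlam0 hρ hc').and
      (eventually_growth_bound hlam hlam0 hj hc')
    obtain ⟨N₁, hN₁⟩ := eventually_atTop.1 hev
    obtain ⟨N₂, hN₂⟩ := eventually_atTop.1 (eventually_tail_le ha hρ)
    refine ⟨max N₁ N₂, fun n hn => ?_⟩
    have h := diffErrorEstimate_of_bounds hlam hlam0 hj hρ (by positivity) (by positivity)
      (fun k hk => (hN₁ k (by omega)).1) (fun k hk => (hN₁ k (by omega)).2) (hN₂ n (by omega))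
    rwa [Real.mul_self_sqrt (by linarith), mul_one] at h
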